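/- A dilation structure on a topological surface $\Sigma$ (possibly with boundary) consists of a finite set $S\subset\Sigma$ of singularities and an atlas of $\mathbb{C}$-valued charts on $\Sigma\setminus S$ whose transition maps are locally dilations $z\mapsto az+b$ ($a>0$, $b\in\mathbb{C}$), such that the boundary is a straight line in every chart, every singularity in the interior has a punctured neighbourhood equivalent to that of the apex of a Euclidean cone of angle $2\pi k$ with $k\ge 1$ an integer, and every singularity on the boundary has a punctured neighbourhood equivalent to that of the apex of a Euclidean sector. It is polygonable if the surface decomposes into finitely many polygons with straight sides, meeting along full sides and vertices, whose set of vertices is exactly $S$ and such that the boundary of $\Sigma$ is contained in the union of the sides. Let $\mathcal{D}(1,1,1)$ be the moduli space of polygonable dilation structures on the torus with one boundary component having exactly one singularity, which lies on the boundary. Theorem. Every dilation structure in $\mathcal{D}(1,1,1)$ is obtained from a pentagon in the plane by gluing two pairs of parallel sides, each pair being glued by the dilation that carries one side to the other; the five vertices become the singularity and the fifth side becomes the boundary. Moreover, the pentagon can be chosen to be convex. -/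

import Mathlib

open Set Filter Topology

/-- Dilations of the plane: `z ↦ a z + b` with `a` a positive real number and `b` complex. -/
def IsDilation (g : ℂ → ℂ) : Prop :=
  ∃ a : ℝ, 0 < a ∧ ∃ b : ℂ, ∀ z, g z = (a : ℂ) * z + b

/-- A chart candidate on `X`: a domain and a map to the plane (only its values on the domain
matter). -/
structure PlaneChart (X : Type*) where
  source : Set X
  toFun : X → ℂ

/-- `c` is a chart of the surface with boundary `X` (with boundary set `bdry`), defined on an
open set: a homeomorphism onto its image, which is a neighbourhood of the image of every interior
point, and which is a closed half-plane near the image of every boundary point, so that the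
boundary is a straight line in the chart. -/
structure PlaneChart.IsChart {X : Type*} [TopologicalSpace X] (bdry : Set X)
    (c : PlaneChart X) : Prop where
  isOpen_source : IsOpen c.source
  isEmbedding : IsEmbedding (c.source.domRestrict c.toFun)
  interior_point : ∀ x ∈ c.source, x ∉ bdry → c.toFun '' c.source ∈ 𝓝 (c.toFun x)
  boundary_point : ∀ x ∈ c.source, x ∈ bdry → ∃ n : ℂ, n ≠ 0 ∧
    ∀ᶠ z in 𝓝 (c.toFun x), (z ∈ c.toFun '' c.source ↔ 0 ≤ inner ℝ n (z - c.toFun x))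

/-- Compatibility of two charts: the transition map is locally a dilation. -/
def PlaneChart.Compatible {X : Type*} [TopologicalSpace X] (c c' : PlaneChart X) : Prop :=
  ∀ x ∈ c.source ∩ c'.source, ∃ g, IsDilation g ∧ ∀ᶠ y in 𝓝 x, c'.toFun y = g (c.toFun y)

/-- Polar coordinates `(ρ, t)` on the punctured Euclidean sector of radius `r` and angle `θ`
(with its two boundary rays); `θ` may exceed `2π`. -/
def polarSector (r θ : ℝ) : Set (ℝ × ℝ) :=
  {p | 0 < p.1 ∧ p.1 < r ∧ 0 ≤ p.2 ∧ p.2 ≤ θ}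

/-- Polar coordinates on the universal cover of the punctured disc of radius `r`. -/
def polarDisc (r : ℝ) : Set (ℝ × ℝ) :=
  {p | 0 < p.1 ∧ p.1 < r}

/-- The complex number with polar coordinates `p`. -/
noncomputable def polarPoint (p : ℝ × ℝ) : ℂ :=
  (p.1 : ℂ) * Complex.exp ((p.2 : ℂ) * Complex.I)

/-- In every chart of `atlas`, the map `G` (defined on `A`, seen in the plane through `dev`) is
locally a dilation near each point of `A`. -/
def IsLocallyDilation {X Y : Type*} [TopologicalSpace X] [TopologicalSpace Y]
    (atlas : Set (PlaneChart X)) (A : Set Y) (dev : Y → ℂ) (G : Y → X) : Prop :=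
  ∀ p ∈ A, ∀ c ∈ atlas, G p ∈ c.source →
    ∃ g, IsDilation g ∧ ∀ᶠ q in 𝓝[A] p, c.toFun (G q) = g (dev q)

/-- The boundary point `s` has a punctured neighbourhood which is equivalent, through dilations in
charts, to a punctured neighbourhood of the apex of a Euclidean cone (sector) of some positive
angle. -/
def IsBoundaryCone {X : Type*} [TopologicalSpace X] (bdry sing : Set X)
    (atlas : Set (PlaneChart X)) (s : X) : Prop :=
  ∃ θ : ℝ, 0 < θ ∧ ∃ r : ℝ, 0 < r ∧ ∃ G : ℝ × ℝ → X,
    ContinuousOn G (polarSector r θ) ∧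
    InjOn G (polarSector r θ) ∧
    (∀ p ∈ polarSector r θ, G p ∉ sing) ∧
    (∀ p ∈ polarSector r θ, (G p ∈ bdry ↔ p.2 = 0 ∨ p.2 = θ)) ∧
    (𝓝 s).HasBasis (fun ε : ℝ => 0 < ε ∧ ε ≤ r) (fun ε => insert s (G '' polarSector ε θ)) ∧
    IsLocallyDilation atlas (polarSector r θ) polarPoint G

/-- The interior point `s` has a punctured neighbourhood which is equivalent, through dilations in
charts, to a punctured neighbourhood of the apex of a Euclidean cone of angle `2πk`, `k ≥ 1`. -/
def IsInteriorCone {X : Type*} [TopologicalSpace X] (bdry sing : Set X)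
    (atlas : Set (PlaneChart X)) (s : X) : Prop :=
  ∃ k : ℕ, 1 ≤ k ∧ ∃ r : ℝ, 0 < r ∧ ∃ G : ℝ × ℝ → X,
    ContinuousOn G (polarDisc r) ∧
    (∀ p ∈ polarDisc r, ∀ q ∈ polarDisc r,
      (G p = G q ↔ p.1 = q.1 ∧ ∃ m : ℤ, q.2 = p.2 + 2 * Real.pi * k * m)) ∧
    (∀ p ∈ polarDisc r, G p ∉ sing ∧ G p ∉ bdry) ∧
    (𝓝 s).HasBasis (fun ε : ℝ => 0 < ε ∧ ε ≤ r) (fun ε => insert s (G '' polarDisc ε)) ∧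
    IsLocallyDilation atlas (polarDisc r) polarPoint G

/-- A dilation structure on a topological surface `X`, possibly with boundary `bdry`: a finite set
of singularities, and an atlas on the complement whose transition maps are locally dilations, such
that the boundary is straight in charts and the singularities are Euclidean cone points. -/
structure DilationStructure (X : Type*) [TopologicalSpace X] where
  bdry : Set X
  sing : Set X
  atlas : Set (PlaneChart X)
  finite_sing : sing.Finite
  isChart : ∀ c ∈ atlas, c.IsChart bdry
  cover : (⋃ c ∈ atlas, c.source) = singᶜ
  compatible : ∀ c ∈ atlas, ∀ c' ∈ atlas, c.Compatible c'
  interior_cone : ∀ s ∈ sing, s ∉ bdry → IsInteriorCone bdry sing atlas s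
  boundary_cone : ∀ s ∈ sing, s ∈ bdry → IsBoundaryCone bdry sing atlas s

/-- A polygon in the plane with `n ≥ 3` vertices, in cyclic order: a closed topological disc whose
frontier is a simple closed curve made of the `n` sides `[v i, v (i + 1)]`. The angle at a vertex
may be `π`. -/
structure PlanarPolygon (n : ℕ) where
  three_le : 3 ≤ n
  vert : ZMod n → ℂ
  vert_injective : Function.Injective vert
  vert_notMem : ∀ i k, vert k ∉ openSegment ℝ (vert i) (vert (i + 1))
  side_disjoint : ∀ i j, i ≠ j →
    Disjoint (openSegment ℝ (vert i) (vert (i + 1))) (openSegment ℝ (vert j) (vert (j + 1)))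
  region : Set ℂ
  interior_nonempty : (interior region).Nonempty
  frontier_region : frontier region = ⋃ i, segment ℝ (vert i) (vert (i + 1))
  disc : Nonempty (region ≃ₜ Metric.closedBall (0 : ℂ) 1)

namespace PlanarPolygon

variable {n : ℕ} (P : PlanarPolygon n)

/-- The closed side number `i`. -/
def side (i : ZMod n) : Set ℂ := segment ℝ (P.vert i) (P.vert (i + 1))

/-- The open side number `i`. -/
def openSide (i : ZMod n) : Set ℂ := openSegment ℝ (P.vert i) (P.vert (i + 1))

/-- A convex polygon, all of whose vertices are genuine corners. -/
def IsConvex : Prop :=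
  Convex ℝ P.region ∧ ∀ i, P.vert i ∈ P.region.extremePoints ℝ

/-- The identification of side `i` with its image under `g` and of side `k` with its image
under `h`. -/
def GlueRel (i k : ZMod n) (g h : ℂ → ℂ) (z w : ℂ) : Prop :=
  (z ∈ P.side i ∧ w = g z) ∨ (z ∈ P.side k ∧ w = h z)

end PlanarPolygon

namespace DilationStructure

variable {X : Type*} [TopologicalSpace X] (D : DilationStructure X)

/-- `F` maps the closed polygon `P` to the surface, is a dilation in charts away from the vertices,
and exactly the vertices go to singularities. In particular sides go to saddle connections. -/
structure IsPolygonMap {n : ℕ} (P : PlanarPolygon n) (F : ℂ → X) : Prop where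
  continuousOn : ContinuousOn F P.region
  sing_iff : ∀ z ∈ P.region, (F z ∈ D.sing ↔ z ∈ range P.vert)
  dilation : IsLocallyDilation D.atlas (P.region \ range P.vert) id F

/-- A straight line polygonation: finitely many polygonal faces covering the surface, embedded
along their interiors, with pairwise disjoint interiors, and meeting along full sides (saddle
connections) and vertices; the vertices are the singularities, and the boundary of the surface lies
in the union of the edges. -/
structure Polygonation where
  numFaces : ℕ
  numSides : Fin numFaces → ℕ
  face : ∀ j, PlanarPolygon (numSides j)
  map : Fin numFaces → ℂ → X
  isPolygonMap : ∀ j, D.IsPolygonMap (face j) (map j)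
  surjective : ∀ x, ∃ j, ∃ z ∈ (face j).region, map j z = x
  interior_injective : ∀ j, ∀ z ∈ interior (face j).region, ∀ j', ∀ z' ∈ (face j').region,
    map j z = map j' z' → j = j' ∧ z = z'
  side_injective : ∀ j i, InjOn (map j) ((face j).openSide i)
  side_match : ∀ j i j' i',
    map j '' (face j).openSide i = map j' '' (face j').openSide i' ∨
    Disjoint (map j '' (face j).openSide i) (map j' '' (face j').openSide i')
  bdry_subset : D.bdry ⊆ ⋃ j, ⋃ i, map j '' (face j).side i

/-- A dilation structure is polygonable if it has a straight line polygonation. -/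
def IsPolygonable : Prop := Nonempty D.Polygonation

end DilationStructure

/-- The torus with one boundary component: the product of two circles minus the open square
`{Re z > 0, Re w > 0}`. -/
def OneHoledTorus : Type :=
  {p : Circle × Circle // (p.1 : ℂ).re ≤ 0 ∨ (p.2 : ℂ).re ≤ 0}

instance : TopologicalSpace OneHoledTorus :=
  inferInstanceAs (TopologicalSpace
    {p : Circle × Circle // (p.1 : ℂ).re ≤ 0 ∨ (p.2 : ℂ).re ≤ 0})

/-- The boundary of the one-holed torus: the boundary of the removed square. -/
def OneHoledTorus.boundary : Set OneHoledTorus :=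
  {p | 0 ≤ (p.1.1 : ℂ).re ∧ 0 ≤ (p.1.2 : ℂ).re}

namespace DilationStructure

variable {X : Type*} [TopologicalSpace X] (D : DilationStructure X)

/-- `D` represents a point of the moduli space `𝒟(1,1,1)`: a polygonable dilation structure on a
torus with one boundary component, with exactly one singularity, which lies on the boundary. -/
structure InD111 : Prop where
  torus : ∃ e : X ≃ₜ OneHoledTorus, ∀ x, x ∈ D.bdry ↔ e x ∈ OneHoledTorus.boundary
  one_singularity : ∃ s ∈ D.bdry, D.sing = {s}
  polygonable : D.IsPolygonable

/-- The dilation surface is obtained from the pentagon `Q` by gluing two pairs of parallel sides,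
`i` with `j` and `k` with `l`, through the dilations `g` and `h` that carry one side of a pair to
the other. The remaining side `m` becomes the boundary. -/
def IsPentagonGluing (Q : PlanarPolygon 5) : Prop :=
  ∃ i j k l m : ZMod 5, [i, j, k, l, m].Nodup ∧
  ∃ g h : ℂ → ℂ, IsDilation g ∧ g '' Q.side i = Q.side j ∧
    IsDilation h ∧ h '' Q.side k = Q.side l ∧
  ∃ F : ℂ → X, D.IsPolygonMap Q F ∧
    F '' Q.region = univ ∧
    (∀ z ∈ Q.region, ∀ w ∈ Q.region, (F z = F w ↔ Relation.EqvGen (Q.GlueRel i k g h) z w)) ∧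
    F '' Q.side m = D.bdry

end DilationStructure

/-! The proof has a topological half, which reduces the surface to three triangles, and a planar
half, which reassembles these triangles into a convex pentagon.

Topology. The first cohomology of the one-holed torus has rank 2: any three circle-valued maps
satisfy a nontrivial integral relation modulo real-valued maps (`OneHoledTorus.exists_relation`).
Given a polygonation, integral weights on the sides that are compatible with the gluings and have
sum zero around each face integrate to a circle-valued map, because there is a single vertex; so
they form a group of rank at most 2 (`cocycle_relation`). The boundary is exactly one side and the
other sides are glued in pairs (`exists_partner`). With F faces and P pairs there are 2P + 1 unknown
weights and P + F equations, hence P ≤ F + 1 (`sum_numSides_le`); this inequality is all that is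
needed of the Euler characteristic. Since every face has at least three sides, no face has more than
five. A polygon with at most five sides, convex or not, is cut into triangles by the diagonals from
a suitable vertex (`exists_isFan`); for four and five sides the vertex is found by a finite search
among the possible signs of the triangles on the vertices. The same count, now for triangles, gives
at most three of them.

Combinatorics. Gluings are dilations and the two faces along a common side lie on opposite sides of
it, so glued sides are parallel with opposite boundary orientations. Adjacent sides of a triangle
are therefore never glued, and every two sides of a triangle are adjacent. This forces the pattern
of `exists_three_triangles`: the triangle that carries the boundary is glued to two other triangles,
whose remaining sides are glued to each other in the same cyclic order.

Geometry. Let x, y, κ, d be the ratios of the four gluings. Computing one area in two ways gives κ d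
> 1 (`one_lt_mul_of_gluing`). Each of the triangles without boundary may be taken as the middle one,
with the two others developed around one of its vertices. If x < y d one choice gives a convex
pentagon; otherwise the other choice does. The developed triangles form a fan of the pentagon and
merge into one face (`merge`). In a convex pentagon consecutive sides are not parallel, so only one
pairing of the four remaining sides is possible (`isPentagonGluing`). -/

/-! ### Convex polygons as intersections of half-planes -/

/-- Twice the signed area of the triangle `a b c`. -/
def orient (a b c : ℂ) : ℝ :=
  (b - a).re * (c - a).im - (b - a).im * (c - a).re

theorem orient_rotate (a b c : ℂ) : orient b c a = orient a b c := by
  simp only [orient, Complex.sub_re, Complex.sub_im]; ring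

theorem orient_swap (a b c : ℂ) : orient b a c = -orient a b c := by
  simp only [orient, Complex.sub_re, Complex.sub_im]; ring

@[simp] theorem orient_self_left (a b : ℂ) : orient a b a = 0 := by simp [orient]

@[simp] theorem orient_self_right (a b : ℂ) : orient a b b = 0 := by
  simp only [orient, Complex.sub_re, Complex.sub_im]; ring

@[simp] theorem orient_self (a b : ℂ) : orient a a b = 0 := by simp [orient]

theorem orient_combo (a b x y : ℂ) (t : ℝ) :
    orient a b ((1 - t) • x + t • y) = (1 - t) * orient a b x + t * orient a b y := by
  simp only [orient, Complex.sub_re, Complex.sub_im, Complex.add_re, Complex.add_im,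
    Complex.real_smul, Complex.mul_re, Complex.mul_im, Complex.ofReal_re, Complex.ofReal_im]
  ring

theorem continuous_orient (a b : ℂ) : Continuous (orient a b) := by
  unfold orient; fun_prop

theorem ZMod.one_ne_zero_of_three_le {n : ℕ} (h : 3 ≤ n) : (1 : ZMod n) ≠ 0 := by
  intro h1
  have := (ZMod.natCast_eq_zero_iff 1 n).1 (by exact_mod_cast h1)
  have := Nat.le_of_dvd (by norm_num) this
  omega

theorem ZMod.two_ne_zero_of_three_le {n : ℕ} (h : 3 ≤ n) : (2 : ZMod n) ≠ 0 := by
  intro h1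
  have := (ZMod.natCast_eq_zero_iff 2 n).1 (by exact_mod_cast h1)
  have := Nat.le_of_dvd (by norm_num) this
  omega

theorem ZMod.ne_succ {n : ℕ} (h : 3 ≤ n) (i : ZMod n) : i ≠ i + 1 := fun e =>
  ZMod.one_ne_zero_of_three_le h (by simpa using e.symm)

/-- A closed broken line that turns left and stays on the left of each of its sides. -/
def IsConvexCycle {n : ℕ} (v : ZMod n → ℂ) : Prop :=
  ∀ i k, k ≠ i → k ≠ i + 1 → 0 < orient (v i) (v (i + 1)) (v k)

/-- The intersection of the half-planes on the left of the sides. -/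
def leftRegion {n : ℕ} (v : ZMod n → ℂ) : Set ℂ := {z | ∀ i, 0 ≤ orient (v i) (v (i + 1)) z}

theorem isClosed_leftRegion {n : ℕ} (v : ZMod n → ℂ) : IsClosed (leftRegion v) := by
  simp only [leftRegion, ofPred_forall]
  exact isClosed_iInter fun i => isClosed_le continuous_const (continuous_orient _ _)

theorem convex_leftRegion {n : ℕ} (v : ZMod n → ℂ) : Convex ℝ (leftRegion v) := by
  intro x hx y hy a b ha hb hab i
  obtain rfl : a = 1 - b := by linarith
  rw [orient_combo]
  have := hx i; have := hy i
  positivity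

namespace IsConvexCycle

variable {n : ℕ} {v : ZMod n → ℂ}

theorem nonneg (hv : IsConvexCycle v) (i k : ZMod n) : 0 ≤ orient (v i) (v (i + 1)) (v k) := by
  by_cases h : k = i
  · simp [h]
  by_cases h' : k = i + 1
  · simp [h']
  exact (hv i k h h').le

theorem vert_mem (hv : IsConvexCycle v) (k : ZMod n) : v k ∈ leftRegion v :=
  fun i => hv.nonneg i k

theorem orient_pos_of_openSegment (h3 : 3 ≤ n) (hv : IsConvexCycle v) {i j : ZMod n} (hij : j ≠ i)
    {z : ℂ} (hz : z ∈ openSegment ℝ (v i) (v (i + 1))) : 0 < orient (v j) (v (j + 1)) z := by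
  rw [openSegment_eq_image] at hz
  obtain ⟨t, ⟨h0, h1⟩, rfl⟩ := hz
  simp only [orient_combo]
  -- The function is affine and nonnegative at both ends of side `i`, so one end off side `j` is
  -- enough. When `i = j + 1` the initial point is on side `j` and the final one serves; otherwise
  -- the initial point does.
  by_cases h : i = j + 1
  · have h2 := hv j (i + 1)
      (fun e => ZMod.two_ne_zero_of_three_le h3 (by subst h; linear_combination e))
      (fun e => ZMod.one_ne_zero_of_three_le h3 (by subst h; linear_combination e))
    have := hv.nonneg j i
    have := mul_nonneg (sub_nonneg.2 h1.le) this
    have := mul_pos h0 h2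
    linarith
  · have h2 := hv j i hij.symm h
    have := hv.nonneg j (i + 1)
    have := mul_nonneg h0.le this
    have := mul_pos (sub_pos.2 h1) h2
    linarith

theorem exists_ne_ne (h3 : 3 ≤ n) (i : ZMod n) : ∃ k, k ≠ i ∧ k ≠ i + 1 :=
  ⟨i + 2, fun e => ZMod.two_ne_zero_of_three_le h3 (by linear_combination e),
    fun e => ZMod.one_ne_zero_of_three_le h3 (by linear_combination e)⟩

theorem injective (h3 : 3 ≤ n) (hv : IsConvexCycle v) : Function.Injective v := by
  have aux : ∀ i k, k ≠ i + 1 → v i = v k → i = k := by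
    intro i k hk e
    by_contra hne
    have := hv i k (Ne.symm hne) hk
    simp [← e] at this
  intro i k e
  by_cases hk : k = i + 1
  · refine (aux k i (fun e' => ZMod.two_ne_zero_of_three_le h3 ?_) e.symm).symm
    subst hk; linear_combination -e'
  · exact aux i k hk e

theorem vert_notMem (h3 : 3 ≤ n) (hv : IsConvexCycle v) (i k : ZMod n) :
    v k ∉ openSegment ℝ (v i) (v (i + 1)) := by
  intro hz
  by_cases h : k = i
  · have := hv.orient_pos_of_openSegment h3 (j := k - 1)
      (fun e => ZMod.one_ne_zero_of_three_le h3 (by subst h; linear_combination -e)) hz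
    simp at this
  · have := hv.orient_pos_of_openSegment h3 h hz
    simp at this

theorem side_disjoint (h3 : 3 ≤ n) (hv : IsConvexCycle v) (i j : ZMod n) (hij : i ≠ j) :
    Disjoint (openSegment ℝ (v i) (v (i + 1))) (openSegment ℝ (v j) (v (j + 1))) := by
  rw [Set.disjoint_left]
  intro z hz hz'
  have := hv.orient_pos_of_openSegment h3 hij.symm hz
  rw [openSegment_eq_image] at hz'
  obtain ⟨t, -, rfl⟩ := hz'
  simp only [orient_combo] at this
  simp at this

theorem mem_interior_iff (h3 : 3 ≤ n) (hv : IsConvexCycle v) {z : ℂ} :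
    z ∈ interior (leftRegion v) ↔ ∀ i, 0 < orient (v i) (v (i + 1)) z := by
  have : NeZero n := ⟨by omega⟩
  constructor
  · intro hz i
    refine lt_of_le_of_ne (interior_subset hz i) fun h0 => ?_
    obtain ⟨k, hk, hk'⟩ := exists_ne_ne h3 i
    have hpos := hv i k hk hk'
    -- For small negative `t` this point moves away from the vertex `v k`, which is strictly on the
    -- left, and thus leaves the half-plane on whose boundary `z` would lie.
    have hc : Tendsto (fun t : ℝ => (1 - t) • z + t • v k) (𝓝[<] 0) (𝓝 z) := by
      have : Continuous (fun t : ℝ => (1 - t) • z + t • v k) := by fun_prop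
      have := this.tendsto 0
      simp only [sub_zero, one_smul, zero_smul, add_zero] at this
      exact this.mono_left nhdsWithin_le_nhds
    have hev := (hc.eventually (isOpen_interior.mem_nhds hz)).and self_mem_nhdsWithin
    obtain ⟨t, ht, ht0⟩ := hev.exists
    have := interior_subset ht i
    rw [orient_combo, ← h0] at this
    have ht0' : t < 0 := ht0
    nlinarith
  · intro hz
    have ho : IsOpen {z | ∀ i, 0 < orient (v i) (v (i + 1)) z} := by
      simp only [ofPred_forall]
      exact isOpen_iInter_of_finite fun i => isOpen_lt continuous_const (continuous_orient _ _)
    exact interior_maximal (fun w hw i => (hw i).le) ho hz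

theorem interior_nonempty (h3 : 3 ≤ n) (hv : IsConvexCycle v) :
    (interior (leftRegion v)).Nonempty := by
  -- The witness is the centroid of three consecutive vertices: no side contains all three, so each
  -- form is positive at one of them.
  refine ⟨(1 - 1 / 3 : ℝ) • ((1 - 1 / 2 : ℝ) • v 0 + (1 / 2 : ℝ) • v (0 + 1)) +
    (1 / 3 : ℝ) • v (0 + 1 + 1), (hv.mem_interior_iff h3).2 fun i => ?_⟩
  rw [orient_combo, orient_combo]
  have key : ∀ A B C : ℝ, 0 ≤ A → 0 ≤ B → 0 ≤ C → (0 < A ∨ 0 < B ∨ 0 < C) →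
      0 < (1 - 1 / 3) * ((1 - 1 / 2) * A + 1 / 2 * B) + 1 / 3 * C := by
    rintro A B C hA hB hC (h | h | h) <;> linarith
  refine key _ _ _ (hv.nonneg i _) (hv.nonneg i _) (hv.nonneg i _) ?_
  by_cases hi : 0 = i
  · exact .inr <| .inr <| hv i (0 + 1 + 1)
      (fun e => ZMod.two_ne_zero_of_three_le h3 (by subst hi; linear_combination e))
      (fun e => ZMod.one_ne_zero_of_three_le h3 (by subst hi; linear_combination e))
  by_cases hi' : 0 = i + 1
  · exact .inr <| .inl <| hv i (0 + 1)
      (fun e => ZMod.two_ne_zero_of_three_le h3 (by linear_combination e - hi'))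
      (fun e => ZMod.one_ne_zero_of_three_le h3 (by linear_combination e - hi'))
  · exact .inl <| hv i 0 hi hi'

/-- The signed areas of the triangles from `z` to the sides add up to a constant `S`, because the
side vectors have sum zero. On the region all terms are nonnegative, so each is at most `S`; the two
forms of consecutive sides are affine coordinates of the plane. -/
theorem isBounded (h3 : 3 ≤ n) (hv : IsConvexCycle v) : Bornology.IsBounded (leftRegion v) := by
  have : NeZero n := ⟨by omega⟩
  set S : ℝ := ∑ i, orient (v i) (v (i + 1)) (v 0) with hS
  have hsum : ∀ z, ∑ i, orient (v i) (v (i + 1)) z = S := by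
    intro z
    have h0 : ∑ i, (v (i + 1) - v i) = 0 := by
      rw [Finset.sum_sub_distrib, sub_eq_zero]
      exact Equiv.sum_comp (Equiv.addRight (1 : ZMod n)) v
    have hre := congrArg Complex.re h0
    have him := congrArg Complex.im h0
    rw [Complex.re_sum] at hre
    rw [Complex.im_sum] at him
    rw [hS, ← sub_eq_zero, ← Finset.sum_sub_distrib]
    have : ∀ i, orient (v i) (v (i + 1)) z - orient (v i) (v (i + 1)) (v 0) =
        (v (i + 1) - v i).re * (z - v 0).im - (v (i + 1) - v i).im * (z - v 0).re := by
      intro i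
      simp only [orient, Complex.sub_re, Complex.sub_im]; ring
    simp only [this]
    rw [Finset.sum_sub_distrib, ← Finset.sum_mul, ← Finset.sum_mul, hre, him]
    simp
  have hle : ∀ z ∈ leftRegion v, ∀ i, orient (v i) (v (i + 1)) z ≤ S := by
    intro z hz i
    rw [← hsum z]
    exact Finset.single_le_sum (f := fun i => orient (v i) (v (i + 1)) z)
      (fun j _ => hz j) (Finset.mem_univ i)
  set e0 := v (0 + 1) - v 0
  set e1 := v (0 + 1 + 1) - v (0 + 1)
  set D := orient (v 0) (v (0 + 1)) (v (0 + 1 + 1)) with hD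
  have hDpos : 0 < D := hv _ _ (fun e => ZMod.two_ne_zero_of_three_le h3 (by
      linear_combination e)) (fun e => ZMod.one_ne_zero_of_three_le h3 (by linear_combination e))
  refine (Metric.isBounded_closedBall (x := v (0 + 1))
    (r := S / D * ‖e1‖ + S / D * ‖e0‖)).subset fun z hz => ?_
  rw [mem_closedBall_iff_norm]
  have hx : z - v (0 + 1) = (orient (v 0) (v (0 + 1)) z / D) • e1 -
      (orient (v (0 + 1)) (v (0 + 1 + 1)) z / D) • e0 := by
    have hD' : D ≠ 0 := hDpos.ne'
    apply Complex.ext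
    · simp only [Complex.sub_re, Complex.smul_re, smul_eq_mul]
      field_simp
      simp only [e0, e1, D, orient, Complex.sub_re, Complex.sub_im]
      ring
    · simp only [Complex.sub_im, Complex.smul_im, smul_eq_mul]
      field_simp
      simp only [e0, e1, D, orient, Complex.sub_re, Complex.sub_im]
      ring
  rw [hx]
  refine (norm_sub_le _ _).trans ?_
  rw [norm_smul, norm_smul, Real.norm_eq_abs, Real.norm_eq_abs,
    abs_of_nonneg (div_nonneg (hz _) hDpos.le), abs_of_nonneg (div_nonneg (hz _) hDpos.le)]
  gcongr
  · exact hle z hz 0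
  · exact hle z hz (0 + 1)

/-- A frontier point lies on the line of some side `i`. In the affine coordinates given by sides `i
- 1` and `i`, the form of side `i - 1` bounds its parameter below by 0 and the form of side `i + 1`
bounds it above by 1. -/
theorem frontier_eq (h3 : 3 ≤ n) (hv : IsConvexCycle v) :
    frontier (leftRegion v) = ⋃ i, segment ℝ (v i) (v (i + 1)) := by
  rw [(isClosed_leftRegion v).frontier_eq]
  ext z
  simp only [Set.mem_sdiff, hv.mem_interior_iff h3, mem_iUnion, not_forall, not_lt]
  constructor
  · rintro ⟨hz, i, hi⟩
    refine ⟨i, ?_⟩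
    have hi0 : orient (v i) (v (i + 1)) z = 0 := le_antisymm hi (hz i)
    have hA := hz (i - 1)
    have hB := hz (i + 1)
    have hA' := hv (i - 1) (i + 1) (fun e => ZMod.two_ne_zero_of_three_le h3 (by
      linear_combination e)) (fun e => ZMod.one_ne_zero_of_three_le h3 (by linear_combination e))
    have hB' := hv (i + 1) i (fun e => ZMod.one_ne_zero_of_three_le h3 (by
      linear_combination -e)) (fun e => ZMod.two_ne_zero_of_three_le h3 (by linear_combination -e))
    rw [sub_add_cancel] at hA hA'
    set p := v (i - 1)
    set q := v i
    set r := v (i + 1)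
    set s := v (i + 1 + 1)
    have e1 : ∀ w, orient p q r * (w - q).re = orient p q w * (r - q).re - orient q r w * (q - p).re := by
      intro w; simp only [orient, Complex.sub_re, Complex.sub_im]; ring
    have e2 : ∀ w, orient p q r * (w - q).im = orient p q w * (r - q).im - orient q r w * (q - p).im := by
      intro w; simp only [orient, Complex.sub_re, Complex.sub_im]; ring
    set t := orient p q z / orient p q r with ht
    have hzt : z = (1 - t) • q + t • r := by
      have a1 := e1 z
      have a2 := e2 z
      rw [hi0] at a1 a2
      apply Complex.ext
      · simp only [Complex.add_re, Complex.smul_re, smul_eq_mul, ht, Complex.sub_re] at *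
        field_simp
        linear_combination a1
      · simp only [Complex.add_im, Complex.smul_im, smul_eq_mul, ht, Complex.sub_im] at *
        field_simp
        linear_combination a2
    have ht0 : 0 ≤ t := div_nonneg hA hA'.le
    have ht1 : t ≤ 1 := by
      rw [hzt, orient_combo] at hB
      simp only [orient_self_left, mul_zero, add_zero] at hB
      nlinarith
    rw [segment_eq_image]
    exact ⟨t, ⟨ht0, ht1⟩, hzt.symm⟩
  · rintro ⟨i, hi⟩
    refine ⟨(convex_leftRegion v).segment_subset (hv.vert_mem i) (hv.vert_mem (i + 1)) hi, i, ?_⟩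
    rw [segment_eq_image] at hi
    obtain ⟨t, -, rfl⟩ := hi
    simp only [orient_combo]
    simp

theorem nonempty_homeomorph_closedBall (h3 : 3 ≤ n) (hv : IsConvexCycle v) :
    Nonempty (leftRegion v ≃ₜ Metric.closedBall (0 : ℂ) 1) := by
  obtain ⟨h, -, h2, -⟩ := exists_homeomorph_image_interior_closure_frontier_eq_unitBall
    (convex_leftRegion v) (hv.interior_nonempty h3) (hv.isBounded h3)
  rw [(isClosed_leftRegion v).closure_eq] at h2
  exact ⟨(h.image _).trans (Homeomorph.setCongr h2)⟩

/-- The convex polygon with the given vertices. -/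
def polygon (h3 : 3 ≤ n) (hv : IsConvexCycle v) : PlanarPolygon n where
  three_le := h3
  vert := v
  vert_injective := hv.injective h3
  vert_notMem := hv.vert_notMem h3
  side_disjoint := hv.side_disjoint h3
  region := leftRegion v
  interior_nonempty := hv.interior_nonempty h3
  frontier_region := hv.frontier_eq h3
  disc := hv.nonempty_homeomorph_closedBall h3

@[simp] theorem polygon_vert (h3 : 3 ≤ n) (hv : IsConvexCycle v) : (hv.polygon h3).vert = v := rfl

/-- A vertex lies on the lines of its two sides. If it is inside a segment of the region, the two
nonnegative forms vanish at the ends of the segment as well, and these lines have only the vertex in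
common. -/
theorem polygon_isConvex (h3 : 3 ≤ n) (hv : IsConvexCycle v) : (hv.polygon h3).IsConvex := by
  refine ⟨convex_leftRegion v, fun k => ⟨hv.vert_mem k, ?_⟩⟩
  intro x hx y hy hz
  have key : ∀ i, orient (v i) (v (i + 1)) (v k) = 0 → orient (v i) (v (i + 1)) x = 0 := by
    intro i hi
    have hz := hz
    rw [openSegment_eq_image] at hz
    obtain ⟨t, ⟨h0, h1⟩, e⟩ := hz
    rw [polygon_vert] at e
    rw [← e, orient_combo] at hi
    have a := hx i
    have b := hy i
    nlinarith [mul_nonneg h0.le b, mul_nonneg (sub_pos.2 h1).le a]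
  have h1 := key k (by simp)
  have h2 := key (k - 1) (by simp)
  have h3' := hv (k - 1) (k + 1) (fun e => ZMod.two_ne_zero_of_three_le h3 (by
      linear_combination e)) (fun e => ZMod.one_ne_zero_of_three_le h3 (by linear_combination e))
  rw [sub_add_cancel] at h2 h3'
  rw [polygon_vert]
  have e1 : orient (v (k - 1)) (v k) (v (k + 1)) * (x - v k).re = orient (v (k - 1)) (v k) x * (v (k + 1) - v k).re - orient (v k) (v (k + 1)) x * (v k - v (k - 1)).re := by
    simp only [orient, Complex.sub_re, Complex.sub_im]; ring
  have e2 : orient (v (k - 1)) (v k) (v (k + 1)) * (x - v k).im = orient (v (k - 1)) (v k) x * (v (k + 1) - v k).im - orient (v k) (v (k + 1)) x * (v k - v (k - 1)).im := by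
    simp only [orient, Complex.sub_re, Complex.sub_im]; ring
  rw [h1, h2] at e1 e2
  simp only [zero_mul, sub_zero, mul_eq_zero, h3'.ne', false_or] at e1 e2
  exact sub_eq_zero.1 (Complex.ext e1 e2)

end IsConvexCycle

/-! ### Planar polygons: connectedness and shape near a side -/

/-- Off the frontier the space is the union of two disjoint open sets, the interior and the
exterior. The arguments about polygons below use this in place of the Jordan curve theorem. -/
theorem IsPreconnected.subset_interior_or_of_disjoint_frontier {X : Type*} [TopologicalSpace X]
    {s t : Set X} (hs : IsPreconnected s) (h : Disjoint s (frontier t)) :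
    s ⊆ interior t ∨ s ⊆ (closure t)ᶜ := by
  refine hs.subset_or_subset isOpen_interior isClosed_closure.isOpen_compl ?_ ?_
  · rw [Set.disjoint_left]
    exact fun x hx hx' => hx' (subset_closure (interior_subset hx))
  · intro x hx
    by_cases hc : x ∈ closure t
    · by_contra hn
      exact Set.disjoint_left.1 h hx ⟨hc, fun hi => hn (.inl hi)⟩
    · exact .inr hc

/-- The open disc is homeomorphic to the plane, and removing a countable set does not disconnect the
plane. -/
theorem Complex.isPreconnected_ball_diff_countable {C : Set ℂ} (hC : C.Countable) :
    IsPreconnected (Metric.ball (0 : ℂ) 1 \ C) := by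
  let h : ℂ → ℂ := fun z => ((Homeomorph.unitBall z : Metric.ball (0 : ℂ) 1) : ℂ)
  have hc : Continuous h := continuous_subtype_val.comp Homeomorph.unitBall.continuous
  have hinj : Function.Injective h := Subtype.val_injective.comp Homeomorph.unitBall.injective
  have hC' : (h ⁻¹' C).Countable := hC.preimage_of_injOn hinj.injOn
  have := (hC'.isConnected_compl_of_one_lt_rank (by simp)).isPreconnected.image h hc.continuousOn
  convert this using 1
  ext z
  constructor
  · rintro ⟨hz, hzC⟩
    refine ⟨Homeomorph.unitBall.symm ⟨z, hz⟩, ?_, ?_⟩ <;> simp [h, hzC]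
  · rintro ⟨w, hw, rfl⟩
    exact ⟨(Homeomorph.unitBall w).2, hw⟩

theorem Complex.isPreconnected_closedBall_diff_countable {C : Set ℂ} (hC : C.Countable) :
    IsPreconnected (Metric.closedBall (0 : ℂ) 1 \ C) := by
  refine (isPreconnected_ball_diff_countable hC).subset_closure
    (Set.sdiff_subset_sdiff_left Metric.ball_subset_closedBall) ?_
  have hd : Dense Cᶜ := hC.dense_compl ℝ
  have := hd.open_subset_closure_inter (Metric.isOpen_ball (x := (0 : ℂ)) (ε := 1))
  have h2 := closure_minimal this isClosed_closure
  rw [closure_ball (0 : ℂ) one_ne_zero] at h2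
  exact Set.sdiff_subset.trans h2

namespace PlanarPolygon

variable {n : ℕ} (P : PlanarPolygon n)

theorem neZero {n : ℕ} (P : PlanarPolygon n) : NeZero n := ⟨by have := P.three_le; omega⟩

theorem isCompact_region : IsCompact P.region := by
  obtain ⟨e⟩ := P.disc
  have : CompactSpace P.region := e.symm.compactSpace
  exact isCompact_iff_compactSpace.2 this

theorem isClosed_region : IsClosed P.region := P.isCompact_region.isClosed

/-- Besides compactness, this is what being a topological disc is used for: two points do not
disconnect a disc, whereas they disconnect a set that is one-dimensional near some point. -/
theorem isPreconnected_region_diff_countable {C : Set ℂ} (hC : C.Countable) :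
    IsPreconnected (P.region \ C) := by
  obtain ⟨e⟩ := P.disc
  have hC' : (Subtype.val '' (e '' (Subtype.val ⁻¹' C)) : Set ℂ).Countable :=
    ((hC.preimage_of_injOn Subtype.val_injective.injOn).image _).image _
  have h := Complex.isPreconnected_closedBall_diff_countable hC'
  have key : (Subtype.val '' (e '' (Subtype.val ⁻¹' C))ᶜ : Set ℂ) =
      Metric.closedBall (0 : ℂ) 1 \ Subtype.val '' (e '' (Subtype.val ⁻¹' C)) := by
    rw [Set.image_compl_eq_range_sdiff_image Subtype.val_injective, Subtype.range_coe]
  rw [← key, IsInducing.subtypeVal.isPreconnected_image] at h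
  have h3 := (h.image e.symm e.symm.continuous.continuousOn).image Subtype.val
    continuous_subtype_val.continuousOn
  convert h3 using 1
  ext z
  constructor
  · rintro ⟨hz, hzC⟩
    refine ⟨⟨z, hz⟩, ⟨e ⟨z, hz⟩, ?_, by simp⟩, rfl⟩
    rintro ⟨w, hw, he⟩
    rw [e.injective he] at hw
    exact hzC hw
  · rintro ⟨_, ⟨w, hw, rfl⟩, rfl⟩
    refine ⟨(e.symm w).2, fun hC => hw ⟨e.symm w, hC, by simp⟩⟩

theorem side_eq (i : ZMod n) : P.side i = insert (P.vert i) (insert (P.vert (i + 1)) (P.openSide i)) :=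
  (insert_endpoints_openSegment ℝ _ _).symm

theorem openSide_subset_side (i : ZMod n) : P.openSide i ⊆ P.side i :=
  openSegment_subset_segment ℝ _ _

theorem side_subset_frontier (i : ZMod n) : P.side i ⊆ frontier P.region := by
  rw [P.frontier_region]
  exact subset_iUnion (fun i => segment ℝ (P.vert i) (P.vert (i + 1))) i

theorem side_subset_region (i : ZMod n) : P.side i ⊆ P.region :=
  (P.side_subset_frontier i).trans P.isClosed_region.frontier_subset

theorem openSide_subset_region (i : ZMod n) : P.openSide i ⊆ P.region :=
  (P.openSide_subset_side i).trans (P.side_subset_region i)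

theorem vert_mem_region (i : ZMod n) : P.vert i ∈ P.region :=
  P.side_subset_region i (left_mem_segment ℝ _ _)

theorem disjoint_openSide_interior (i : ZMod n) : Disjoint (P.openSide i) (interior P.region) :=
  disjoint_interior_frontier.symm.mono_left ((P.openSide_subset_side i).trans
    (P.side_subset_frontier i))

theorem notMem_range_vert {i : ZMod n} {z : ℂ} (hz : z ∈ P.openSide i) : z ∉ range P.vert := by
  rintro ⟨k, rfl⟩
  exact P.vert_notMem i k hz

theorem eq_of_mem_openSide {i j : ZMod n} {z : ℂ} (hi : z ∈ P.openSide i) (hj : z ∈ P.openSide j) :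
    i = j := by
  by_contra h
  exact Set.disjoint_left.1 (P.side_disjoint i j h) hi hj

theorem mem_region_cases {z : ℂ} (hz : z ∈ P.region) :
    z ∈ interior P.region ∨ z ∈ range P.vert ∨ ∃ i, z ∈ P.openSide i := by
  by_cases hi : z ∈ interior P.region
  · exact .inl hi
  have hf : z ∈ frontier P.region := ⟨subset_closure hz, hi⟩
  rw [P.frontier_region, mem_iUnion] at hf
  obtain ⟨i, hi⟩ := hf
  rw [← insert_endpoints_openSegment] at hi
  rcases hi with rfl | rfl | hi
  · exact .inr (.inl ⟨_, rfl⟩)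
  · exact .inr (.inl ⟨_, rfl⟩)
  · exact .inr (.inr ⟨i, hi⟩)

theorem vert_ne_succ (i : ZMod n) : P.vert i ≠ P.vert (i + 1) :=
  fun e => ZMod.ne_succ P.three_le i (P.vert_injective e)

theorem notMem_side_of_mem_openSide {i j : ZMod n} (hij : j ≠ i) {z : ℂ} (hz : z ∈ P.openSide i) :
    z ∉ P.side j := by
  rw [P.side_eq]
  rintro (rfl | rfl | h)
  · exact P.notMem_range_vert hz ⟨_, rfl⟩
  · exact P.notMem_range_vert hz ⟨_, rfl⟩
  · exact hij (P.eq_of_mem_openSide h hz)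

end PlanarPolygon

theorem orient_eq_zero_iff {p q z : ℂ} (hpq : p ≠ q) :
    orient p q z = 0 ↔ ∃ t : ℝ, z = (1 - t) • p + t • q := by
  constructor
  · intro h
    have hne : (q - p).re ^ 2 + (q - p).im ^ 2 ≠ 0 := by
      intro h0
      have h1 : (q - p).re = 0 := by nlinarith [sq_nonneg (q - p).re, sq_nonneg (q - p).im]
      have h2 : (q - p).im = 0 := by nlinarith [sq_nonneg (q - p).re, sq_nonneg (q - p).im]
      exact hpq (sub_eq_zero.1 (Complex.ext h1 h2)).symm
    refine ⟨((q - p).re * (z - p).re + (q - p).im * (z - p).im) /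
      ((q - p).re ^ 2 + (q - p).im ^ 2), ?_⟩
    simp only [orient] at h
    apply Complex.ext
    · simp only [Complex.add_re, Complex.smul_re, smul_eq_mul]
      field_simp
      simp only [Complex.sub_re, Complex.sub_im] at *
      linear_combination (q.im - p.im) * (-h)
    · simp only [Complex.add_im, Complex.smul_im, smul_eq_mul]
      field_simp
      simp only [Complex.sub_re, Complex.sub_im] at *
      linear_combination (q.re - p.re) * h
  · rintro ⟨t, rfl⟩
    rw [orient_combo]; simp

theorem orient_eq_zero_of_mem_segment {p q z : ℂ} (hz : z ∈ segment ℝ p q) : orient p q z = 0 := by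
  rw [segment_eq_image] at hz
  obtain ⟨t, -, rfl⟩ := hz
  simp only [orient_combo]; simp

theorem exists_ball_line_subset_openSegment {p q z : ℂ} (hpq : p ≠ q)
    (hz : z ∈ openSegment ℝ p q) :
    ∃ ε > 0, ∀ w ∈ Metric.ball z ε, orient p q w = 0 → w ∈ openSegment ℝ p q := by
  rw [openSegment_eq_image] at hz ⊢
  obtain ⟨t, ⟨h0, h1⟩, rfl⟩ := hz
  have hd : 0 < ‖q - p‖ := norm_pos_iff.2 (sub_ne_zero.2 hpq.symm)
  refine ⟨min t (1 - t) * ‖q - p‖, mul_pos (lt_min h0 (by linarith)) hd, fun w hw hw0 => ?_⟩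
  obtain ⟨s, rfl⟩ := (orient_eq_zero_iff hpq).1 hw0
  rw [mem_ball_iff_norm] at hw
  have : ((1 - s) • p + s • q - ((1 - t) • p + t • q)) = (s - t) • (q - p) := by
    simp only [Complex.real_smul]; push_cast; ring
  simp only [this] at hw
  rw [norm_smul, mul_lt_mul_iff_left₀ hd, Real.norm_eq_abs, lt_min_iff, abs_lt, abs_lt] at hw
  exact ⟨s, ⟨by linarith [hw.1.1], by linarith [hw.2.2]⟩, rfl⟩

theorem convex_orient_pos (σ : ℝ) (p q : ℂ) : Convex ℝ {z | 0 < σ * orient p q z} := by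
  intro x hx y hy a b ha hb hab
  obtain rfl : a = 1 - b := by linarith
  simp only [mem_ofPred] at *
  rw [orient_combo]
  rcases hb.eq_or_lt with rfl | hb
  · simpa using hx
  · have := mul_pos hb hy
    have := mul_nonneg ha hx.le
    nlinarith

namespace PlanarPolygon

variable {n : ℕ} (P : PlanarPolygon n)

/-- The other sides form a closed set that misses the point, so near it the frontier is the line of
its own side. -/
theorem exists_ball_of_mem_openSide {i : ZMod n} {z₀ : ℂ} (hz : z₀ ∈ P.openSide i) :
    ∃ ε > 0, ∀ w ∈ Metric.ball z₀ ε,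
      (w ∈ frontier P.region ↔ orient (P.vert i) (P.vert (i + 1)) w = 0) ∧
      (orient (P.vert i) (P.vert (i + 1)) w = 0 → w ∈ P.openSide i) := by
  have := P.neZero
  obtain ⟨ε, hε, h⟩ := exists_ball_line_subset_openSegment (P.vert_ne_succ i) hz
  have hcl : IsClosed (⋃ j ∈ {j | j ≠ i}, P.side j) :=
    (Set.toFinite _).isClosed_biUnion fun j _ => by
      have : IsCompact (P.side j) := by
        rw [side, segment_eq_image]
        exact isCompact_Icc.image (by fun_prop)
      exact this.isClosed
  have hz' : z₀ ∉ ⋃ j ∈ {j | j ≠ i}, P.side j := by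
    simp only [mem_iUnion, not_exists]
    exact fun j hj => P.notMem_side_of_mem_openSide hj hz
  obtain ⟨ε', hε', h'⟩ := Metric.mem_nhds_iff.1 (hcl.isOpen_compl.mem_nhds hz')
  refine ⟨min ε ε', lt_min hε hε', fun w hw => ?_⟩
  have hw1 := Metric.ball_subset_ball (min_le_left _ _) hw
  have hw2 := h' (Metric.ball_subset_ball (min_le_right _ _) hw)
  refine ⟨⟨fun hf => ?_, fun h0 => ?_⟩, h w hw1⟩
  · rw [P.frontier_region, mem_iUnion] at hf
    obtain ⟨j, hj⟩ := hf
    by_cases hji : j = i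
    · subst hji
      exact orient_eq_zero_of_mem_segment hj
    · exact (hw2 (mem_biUnion (show j ∈ {j | j ≠ i} from hji) hj)).elim
  · exact P.side_subset_frontier i (P.openSide_subset_side i (h w hw1 h0))

/-- Near a point of an open side, a polygon is a half-plane. -/
theorem exists_halfPlane {i : ZMod n} {z₀ : ℂ} (hz : z₀ ∈ P.openSide i) :
    ∃ σ : ℝ, (σ = 1 ∨ σ = -1) ∧ ∀ᶠ z in 𝓝 z₀,
      (z ∈ P.region ↔ 0 ≤ σ * orient (P.vert i) (P.vert (i + 1)) z) ∧
      (z ∈ interior P.region ↔ 0 < σ * orient (P.vert i) (P.vert (i + 1)) z) := by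
  obtain ⟨ε, hε, h⟩ := P.exists_ball_of_mem_openSide hz
  set p := P.vert i
  set q := P.vert (i + 1)
  have hpq : p ≠ q := P.vert_ne_succ i
  -- Each of the two open half-discs is convex and avoids the frontier, so it is entirely inside or
  -- entirely outside the polygon.
  have half : ∀ σ : ℝ, Metric.ball z₀ ε ∩ {z | 0 < σ * orient p q z} ⊆ interior P.region ∨
      Metric.ball z₀ ε ∩ {z | 0 < σ * orient p q z} ⊆ (closure P.region)ᶜ := by
    intro σ
    refine ((convex_ball _ _).inter
      (convex_orient_pos σ p q)).isPreconnected.subset_interior_or_of_disjoint_frontier ?_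
    rw [Set.disjoint_left]
    rintro w ⟨hw, hw'⟩ hf
    rw [(h w hw).1] at hf
    simp [hf] at hw'
  rw [P.isClosed_region.closure_eq] at half
  have hball : Metric.ball z₀ ε ∈ 𝓝 z₀ := Metric.ball_mem_nhds _ hε
  have mk : ∀ σ : ℝ, σ = 1 ∨ σ = -1 →
      Metric.ball z₀ ε ∩ {z | 0 < σ * orient p q z} ⊆ interior P.region →
      Metric.ball z₀ ε ∩ {z | 0 < -σ * orient p q z} ⊆ (P.region)ᶜ →
      ∀ᶠ z in 𝓝 z₀, (z ∈ P.region ↔ 0 ≤ σ * orient p q z) ∧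
      (z ∈ interior P.region ↔ 0 < σ * orient p q z) := by
    intro σ hσ h1 h2
    filter_upwards [hball] with w hw
    have hσ0 : σ ≠ 0 := by rcases hσ with rfl | rfl <;> norm_num
    rcases lt_trichotomy 0 (σ * orient p q w) with h' | h' | h'
    · have := h1 ⟨hw, h'⟩
      simp [h', h'.le, this, interior_subset this]
    · have h0 : orient p q w = 0 := by
        rcases mul_eq_zero.1 h'.symm with h | h
        · exact absurd h hσ0
        · exact h
      have hs := (h w hw).2 h0
      simp only [← h', le_refl, iff_true, lt_irrefl, iff_false]
      exact ⟨P.openSide_subset_region i hs,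
        Set.disjoint_left.1 (P.disjoint_openSide_interior i) hs⟩
    · have := h2 ⟨hw, by simp only [mem_ofPred]; linarith⟩
      simp only [h'.not_ge, iff_false, h'.le.not_gt]
      exact ⟨this, fun h => this (interior_subset h)⟩
  rcases half 1 with hp | hp <;> rcases half (-1) with hm | hm
  -- If both half-discs were inside, the point would be interior, although it is on a side.
  · exfalso
    have : Metric.ball z₀ ε ⊆ P.region := by
      intro w hw
      rcases lt_trichotomy 0 (orient p q w) with h' | h' | h'
      · exact interior_subset (hp ⟨hw, by simpa using h'⟩)
      · exact P.openSide_subset_region i ((h w hw).2 h'.symm)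
      · exact interior_subset (hm ⟨hw, by simpa using h'⟩)
    exact Set.disjoint_left.1 (P.disjoint_openSide_interior i) hz
      (mem_interior_iff_mem_nhds.2 (mem_of_superset hball this))
  · exact ⟨1, .inl rfl, mk 1 (.inl rfl) hp hm⟩
  · exact ⟨-1, .inr rfl, mk (-1) (.inr rfl) hm (by simpa using hp)⟩
  -- If both half-discs were outside, the polygon near the point would be contained in a line.
  -- Removing the two points of that line at distance `ρ` would then separate `z₀` from the interior
  -- of the polygon, which contradicts the disc hypothesis.
  · exfalso
    have hline : ∀ w ∈ Metric.ball z₀ ε, w ∈ P.region → orient p q w = 0 := by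
      intro w hw hwR
      rcases lt_trichotomy 0 (orient p q w) with h' | h' | h'
      · exact (hp ⟨hw, by simpa using h'⟩ hwR).elim
      · exact h'.symm
      · exact (hm ⟨hw, by simpa using h'⟩ hwR).elim
    have hnoint : ∀ w ∈ Metric.ball z₀ ε, w ∉ interior P.region := by
      intro w hw hwI
      have := (h w hw).1.2 (hline w hw (interior_subset hwI))
      exact Set.disjoint_left.1 disjoint_interior_frontier hwI this
    set ρ := ε / 2 with hρ
    have hρ0 : 0 < ρ := by positivity
    set d := (ρ / ‖q - p‖) • (q - p) with hd
    have hcon := P.isPreconnected_region_diff_countable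
      (C := {z₀ + d, z₀ - d}) (Set.toFinite _).countable
    have hsplit : P.region \ {z₀ + d, z₀ - d} ⊆ Metric.ball z₀ ρ ∪ (Metric.closedBall z₀ ρ)ᶜ := by
      rintro w ⟨hwR, hw⟩
      by_contra hn
      simp only [mem_union, Metric.mem_ball, mem_compl_iff, Metric.mem_closedBall, not_or,
        not_lt, not_not] at hn
      have hdist : dist w z₀ = ρ := le_antisymm hn.2 hn.1
      have hw0 : orient p q w = 0 := hline w (by rw [Metric.mem_ball]; linarith) hwR
      have hz0 : orient p q z₀ = 0 := hline z₀ (Metric.mem_ball_self hε)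
        (P.openSide_subset_region i hz)
      obtain ⟨t, rfl⟩ := (orient_eq_zero_iff hpq).1 hw0
      obtain ⟨s, rfl⟩ := (orient_eq_zero_iff hpq).1 hz0
      have e : (1 - t) • p + t • q - ((1 - s) • p + s • q) = (t - s) • (q - p) := by
        simp only [Complex.real_smul]; push_cast; ring
      have hqp : 0 < ‖q - p‖ := norm_pos_iff.2 (sub_ne_zero.2 hpq.symm)
      rw [dist_eq_norm, e, norm_smul, Real.norm_eq_abs, ← eq_div_iff hqp.ne'] at hdist
      apply hw
      rcases abs_choice (t - s) with h1 | h1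
      · left
        rw [hd, ← hdist, h1, ← e]; ring
      · right
        rw [mem_singleton_iff, hd, ← hdist, h1, neg_smul, ← e]; ring
    have hdn : ‖d‖ = ρ := by
      have hqp : 0 < ‖q - p‖ := norm_pos_iff.2 (sub_ne_zero.2 hpq.symm)
      rw [hd, norm_smul, Real.norm_eq_abs, abs_of_pos (by positivity)]
      field_simp
    have hd0 : d ≠ 0 := by rw [← norm_pos_iff, hdn]; exact hρ0
    have hzmem : z₀ ∈ P.region \ {z₀ + d, z₀ - d} := by
      refine ⟨P.openSide_subset_region i hz, ?_⟩
      simp [hd0, eq_comm (a := z₀)]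
    obtain ⟨w, hw⟩ := P.interior_nonempty
    have hwb : w ∉ Metric.ball z₀ ε := fun hb => hnoint w hb hw
    have hwc : w ∉ Metric.closedBall z₀ ρ := fun hb => hwb
      (Metric.closedBall_subset_ball (by rw [hρ]; linarith) hb)
    have hwmem : w ∈ P.region \ {z₀ + d, z₀ - d} := by
      refine ⟨interior_subset hw, fun hw' => hwc ?_⟩
      rcases hw' with rfl | hw'
      · simp [hdn]
      · rw [mem_singleton_iff] at hw'
        simp [hw', hdn]
    rcases hcon.subset_or_subset Metric.isOpen_ball Metric.isClosed_closedBall.isOpen_compl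
      (Set.disjoint_left.2 fun x hx hx' => hx' (Metric.ball_subset_closedBall hx)) hsplit with h1 | h1
    · exact hwc (Metric.ball_subset_closedBall (h1 hwmem))
    · exact h1 hzmem (Metric.mem_closedBall_self hρ0.le)

end PlanarPolygon

/-! ### Half-planes as linear forms -/

/-- The area form with a fixed first vector. -/
def crossForm (e : ℂ) : ℂ →ₗ[ℝ] ℝ where
  toFun z := e.re * z.im - e.im * z.re
  map_add' x y := by simp only [Complex.add_re, Complex.add_im]; ring
  map_smul' a x := by
    simp only [Complex.smul_re, Complex.smul_im, smul_eq_mul, RingHom.id_apply]; ring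

theorem crossForm_apply (e z : ℂ) : crossForm e z = e.re * z.im - e.im * z.re := rfl

theorem orient_eq_crossForm (p q z : ℂ) : orient p q z = crossForm (q - p) (z - p) := rfl

theorem orient_eq_crossForm_sub {p q z₀ : ℂ} (h : orient p q z₀ = 0) (z : ℂ) :
    orient p q z = crossForm (q - p) (z - z₀) := by
  have : z - z₀ = (z - p) - (z₀ - p) := by ring
  rw [this, map_sub, ← orient_eq_crossForm, ← orient_eq_crossForm, h, sub_zero]

theorem crossForm_ne_zero {e : ℂ} (he : e ≠ 0) : crossForm e ≠ 0 := by
  intro h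
  have h1 := LinearMap.congr_fun h 1
  have h2 := LinearMap.congr_fun h Complex.I
  simp [crossForm_apply] at h1 h2
  exact he (Complex.ext h2 h1)

/-- Near `z₀`, the set `R` is the half-plane where `ℓ (z - z₀)` is nonnegative. -/
def IsHalfPlaneAt (R : Set ℂ) (z₀ : ℂ) (ℓ : ℂ →ₗ[ℝ] ℝ) : Prop :=
  ∀ᶠ z in 𝓝 z₀, (z ∈ R ↔ 0 ≤ ℓ (z - z₀)) ∧ (z ∈ interior R ↔ 0 < ℓ (z - z₀))

theorem PlanarPolygon.exists_isHalfPlaneAt {n : ℕ} (P : PlanarPolygon n) {i : ZMod n} {z₀ : ℂ}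
    (hz : z₀ ∈ P.openSide i) : ∃ σ : ℝ, σ ≠ 0 ∧
      IsHalfPlaneAt P.region z₀ (σ • crossForm (P.vert (i + 1) - P.vert i)) := by
  obtain ⟨σ, hσ, h⟩ := P.exists_halfPlane hz
  refine ⟨σ, by rcases hσ with rfl | rfl <;> norm_num, ?_⟩
  filter_upwards [h] with z hz'
  rwa [LinearMap.smul_apply, smul_eq_mul, ← orient_eq_crossForm_sub
    (orient_eq_zero_of_mem_segment (P.openSide_subset_side i hz))]

theorem tendsto_smul_nhdsGT_zero (ζ : ℂ) : Tendsto (fun t : ℝ => t • ζ) (𝓝[>] 0) (𝓝 0) := by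
  have : Continuous (fun t : ℝ => t • ζ) := by fun_prop
  have := this.tendsto 0
  rw [zero_smul] at this
  exact this.mono_left nhdsWithin_le_nhds

/-- By scaling, the disjointness near 0 holds everywhere. Applied to `ζ` and `-ζ` it shows that the
kernel of `ℓ'` lies in that of `ℓ`, so the forms are proportional, and the factor cannot be positive
or zero. -/
theorem LinearMap.exists_neg_smul_of_disjoint {ℓ ℓ' : ℂ →ₗ[ℝ] ℝ} (hℓ : ℓ ≠ 0) (hℓ' : ℓ' ≠ 0)
    (h : ∀ᶠ ζ in 𝓝 (0 : ℂ), ¬ (0 < ℓ ζ ∧ 0 ≤ ℓ' ζ)) : ∃ t : ℝ, 0 < t ∧ ℓ = -t • ℓ' := by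
  have hall : ∀ ζ, 0 ≤ ℓ' ζ → ℓ ζ ≤ 0 := by
    intro ζ h1
    by_contra! h2
    obtain ⟨t, ht, ht0⟩ :=
      (((tendsto_smul_nhdsGT_zero ζ).eventually h).and self_mem_nhdsWithin).exists
    have ht0 : 0 < t := ht0
    refine ht ?_
    simp only [map_smul, smul_eq_mul]
    constructor <;> positivity
  obtain ⟨u, hu⟩ : ∃ u, ℓ' u = 1 := by
    obtain ⟨w, hw⟩ : ∃ w, ℓ' w ≠ 0 := by
      by_contra! hn
      exact hℓ' (LinearMap.ext hn)
    exact ⟨(ℓ' w)⁻¹ • w, by rw [map_smul, smul_eq_mul, inv_mul_cancel₀ hw]⟩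
  have hker : ∀ ζ, ℓ' ζ = 0 → ℓ ζ = 0 := by
    intro ζ h0
    have h1 := hall ζ h0.ge
    have h2 := hall (-ζ) (by simp [h0])
    rw [map_neg] at h2
    linarith
  have heq : ∀ ζ, ℓ ζ = ℓ u * ℓ' ζ := by
    intro ζ
    have := hker (ζ - ℓ' ζ • u) (by rw [map_sub, map_smul, smul_eq_mul, hu]; ring)
    rw [map_sub, map_smul, smul_eq_mul] at this
    linarith
  have hu0 : ℓ u ≤ 0 := hall u (by simp [hu])
  refine ⟨-ℓ u, ?_, LinearMap.ext fun ζ => by simp [heq ζ]⟩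
  rw [neg_pos]
  refine lt_of_le_of_ne hu0 fun h0 => hℓ (LinearMap.ext fun ζ => ?_)
  rw [heq, h0]; simp

/-! ### Polygonal decompositions seen in charts -/

namespace DilationStructure

variable {X : Type*} [TopologicalSpace X] {D : DilationStructure X}

/-- The maps `map j` of the polygons `face j` form a straight line decomposition of the surface. -/
structure IsDecomposition (D : DilationStructure X) {ι : Type} {n : ι → ℕ}
    (face : ∀ j, PlanarPolygon (n j)) (map : ι → ℂ → X) : Prop where
  isPolygonMap : ∀ j, D.IsPolygonMap (face j) (map j)
  surjective : ∀ x, ∃ j, ∃ z ∈ (face j).region, map j z = x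
  interior_injective : ∀ j, ∀ z ∈ interior (face j).region, ∀ j', ∀ z' ∈ (face j').region,
    map j z = map j' z' → j = j' ∧ z = z'
  side_injective : ∀ j i, InjOn (map j) ((face j).openSide i)
  side_match : ∀ j i j' i',
    map j '' (face j).openSide i = map j' '' (face j').openSide i' ∨
    Disjoint (map j '' (face j).openSide i) (map j' '' (face j').openSide i')
  bdry_subset : D.bdry ⊆ ⋃ j, ⋃ i, map j '' (face j).side i

theorem Polygonation.isDecomposition (P : D.Polygonation) : D.IsDecomposition P.face P.map :=
  ⟨P.isPolygonMap, P.surjective, P.interior_injective, P.side_injective, P.side_match,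
    P.bdry_subset⟩

theorem exists_chart (D : DilationStructure X) {x : X} (hx : x ∉ D.sing) :
    ∃ c ∈ D.atlas, x ∈ c.source := by
  have : x ∈ ⋃ c ∈ D.atlas, c.source := by rw [D.cover]; exact hx
  simpa using this

theorem IsPolygonMap.map_notMem_sing {n : ℕ} {P : PlanarPolygon n} {F : ℂ → X}
    (hF : D.IsPolygonMap P F) {i : ZMod n} {z : ℂ} (hz : z ∈ P.openSide i) : F z ∉ D.sing :=
  fun h => P.notMem_range_vert hz ((hF.sing_iff z (P.openSide_subset_region i hz)).1 h)

/-- The shape of a polygon in a chart near a point of an open side. -/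
theorem IsPolygonMap.exists_scale {n : ℕ} {P : PlanarPolygon n} {F : ℂ → X}
    (hF : D.IsPolygonMap P F) {i : ZMod n} {z₀ : ℂ} (hz : z₀ ∈ P.openSide i)
    {c : PlaneChart X} (hc : c ∈ D.atlas) (hx : F z₀ ∈ c.source) {ℓ : ℂ →ₗ[ℝ] ℝ}
    (hℓ : IsHalfPlaneAt P.region z₀ ℓ) :
    ∃ a : ℝ, 0 < a ∧ ∀ᶠ ζ in 𝓝 (0 : ℂ), (z₀ + a⁻¹ • ζ ∈ P.region ↔ 0 ≤ ℓ ζ) ∧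
      (z₀ + a⁻¹ • ζ ∈ interior P.region ↔ 0 < ℓ ζ) ∧
      (0 ≤ ℓ ζ → F (z₀ + a⁻¹ • ζ) ∈ c.source ∧
        c.toFun (F (z₀ + a⁻¹ • ζ)) = c.toFun (F z₀) + ζ) := by
  have := P.neZero
  have hzR := P.openSide_subset_region i hz
  have hzV := P.notMem_range_vert hz
  obtain ⟨g, ⟨a, ha, b, hg⟩, hgev⟩ := hF.dilation z₀ ⟨hzR, hzV⟩ c hc hx
  have hopen : ∀ᶠ z in 𝓝[P.region] z₀, F z ∈ c.source :=
    (hF.continuousOn z₀ hzR).eventually ((D.isChart c hc).isOpen_source.mem_nhds hx)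
  have hV : ∀ᶠ z in 𝓝 z₀, z ∉ range P.vert :=
    ((Set.finite_range P.vert).isClosed.isOpen_compl).mem_nhds hzV
  rw [eventually_nhdsWithin_iff] at hgev hopen
  have htend : Tendsto (fun ζ : ℂ => z₀ + a⁻¹ • ζ) (𝓝 0) (𝓝 z₀) := by
    have : Continuous (fun ζ : ℂ => z₀ + a⁻¹ • ζ) := by fun_prop
    simpa using this.tendsto 0
  -- Here `a` is the ratio of the map read in the chart: a displacement `ζ` in the chart is the
  -- displacement `a⁻¹ • ζ` in the polygon.
  refine ⟨a, ha, ?_⟩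
  have hgz₀ := hgev.self_of_nhds ⟨hzR, hzV⟩
  filter_upwards [htend.eventually hℓ, htend.eventually hgev, htend.eventually hopen,
    htend.eventually hV] with ζ h1 h2 h3 h4
  have e : ℓ (z₀ + a⁻¹ • ζ - z₀) = a⁻¹ * ℓ ζ := by
    rw [add_sub_cancel_left, map_smul, smul_eq_mul]
  have ha' : 0 < a⁻¹ := inv_pos.2 ha
  rw [e, mul_nonneg_iff_of_pos_left ha', mul_pos_iff_of_pos_left ha'] at h1
  refine ⟨h1.1, h1.2, fun h => ?_⟩
  have hR := h1.1.2 h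
  refine ⟨h3 hR, ?_⟩
  rw [h2 ⟨hR, h4⟩, hgz₀, hg, hg]
  have : (a : ℂ) ≠ 0 := by exact_mod_cast ha.ne'
  simp only [id, Complex.real_smul, Complex.ofReal_inv]
  field_simp
  ring

variable {ι : Type} {n : ι → ℕ} {face : ∀ j, PlanarPolygon (n j)} {map : ι → ℂ → X}

theorem IsPolygonMap.eq_of_chart_eq {c : PlaneChart X} (hc : c ∈ D.atlas) {x y : X}
    (hx : x ∈ c.source) (hy : y ∈ c.source) (h : c.toFun x = c.toFun y) : x = y :=
  congrArg Subtype.val ((D.isChart c hc).isEmbedding.injective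
    (a₁ := ⟨x, hx⟩) (a₂ := ⟨y, hy⟩) h)

namespace IsDecomposition

theorem not_interior_of_openSide (hT : D.IsDecomposition face map) {j j' : ι} {i : ZMod (n j)}
    {z w : ℂ} (hz : z ∈ (face j).openSide i)
    (h : map j z = map j' w) : w ∉ interior (face j').region := by
  intro hw'
  obtain ⟨rfl, rfl⟩ := hT.interior_injective j' w hw' j z ((face j).openSide_subset_region i hz)
    h.symm
  exact Set.disjoint_left.1 ((face j').disjoint_openSide_interior i) hz hw'

theorem exists_openSide (hT : D.IsDecomposition face map) {j j' : ι} {i : ZMod (n j)}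
    {z w : ℂ} (hz : z ∈ (face j).openSide i) (hw : w ∈ (face j').region)
    (h : map j z = map j' w) : ∃ i', w ∈ (face j').openSide i' := by
  rcases (face j').mem_region_cases hw with h1 | h1 | h1
  · exact (hT.not_interior_of_openSide hz h h1).elim
  · have := ((hT.isPolygonMap j').sing_iff w hw).2 h1
    exact ((hT.isPolygonMap j).map_notMem_sing hz (h ▸ this)).elim
  · exact h1

/-- At a point of the surface which lies on two sides, the two polygons are on opposite sides. -/
theorem exists_opposite (hT : D.IsDecomposition face map) {j j' : ι} {i : ZMod (n j)}
    {i' : ZMod (n j')} (hne : (⟨j, i⟩ : Σ j, ZMod (n j)) ≠ ⟨j', i'⟩) {z z' : ℂ}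
    (hz : z ∈ (face j).openSide i) (hz' : z' ∈ (face j').openSide i')
    (h : map j z = map j' z') {ℓ ℓ' : ℂ →ₗ[ℝ] ℝ} (hℓ : IsHalfPlaneAt (face j).region z ℓ)
    (hℓ' : IsHalfPlaneAt (face j').region z' ℓ') (hℓ0 : ℓ ≠ 0) (hℓ0' : ℓ' ≠ 0) :
    ∃ t : ℝ, 0 < t ∧ ℓ = -t • ℓ' := by
  obtain ⟨c, hc, hx⟩ := D.exists_chart ((hT.isPolygonMap j).map_notMem_sing hz)
  obtain ⟨a, ha, h1⟩ := (hT.isPolygonMap j).exists_scale hz hc hx hℓ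
  obtain ⟨a', ha', h2⟩ := (hT.isPolygonMap j').exists_scale hz' hc (h ▸ hx) hℓ'
  refine LinearMap.exists_neg_smul_of_disjoint hℓ0 hℓ0' ?_
  -- When both sides belong to the same polygon, the points `z` and `z'` are still distinct, because
  -- distinct open sides are disjoint; nearby points stay distinct.
  have hsep : ∀ᶠ ζ in 𝓝 (0 : ℂ), ¬ (j = j' ∧ z + a⁻¹ • ζ = z' + a'⁻¹ • ζ) := by
    by_cases hj : j = j'
    · subst hj
      have hzz : z ≠ z' := by
        rintro rfl
        rw [(face j).eq_of_mem_openSide hz hz'] at hne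
        exact hne rfl
      have c1 : Continuous (fun ζ : ℂ => z + a⁻¹ • ζ) := by fun_prop
      have c2 : Continuous (fun ζ : ℂ => z' + a'⁻¹ • ζ) := by fun_prop
      have : ∀ᶠ ζ in 𝓝 (0 : ℂ), z + a⁻¹ • ζ ≠ z' + a'⁻¹ • ζ :=
        (isOpen_ne_fun c1 c2).mem_nhds (by simpa using hzz)
      filter_upwards [this] with ζ hζ
      exact fun hh => hζ hh.2
    · exact Eventually.of_forall fun ζ hh => hj hh.1
  -- A displacement in the open half-plane of one polygon and in the closed half-plane of the other
  -- would identify an interior point of the first with another point of a polygon.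
  filter_upwards [h1, h2, hsep] with ζ h1 h2 hsep
  rintro ⟨hp, hp'⟩
  refine hsep (hT.interior_injective j _ (h1.2.1.2 hp) j' _ (h2.1.2 hp') ?_)
  refine IsPolygonMap.eq_of_chart_eq hc (h1.2.2 hp.le).1 (h2.2.2 hp').1 ?_
  rw [(h1.2.2 hp.le).2, (h2.2.2 hp').2, h]

/-- The polygons are compact and finite in number, so the image of what is left outside the open
sets `U j` is closed, and it misses `x`. -/
theorem image_mem_nhds (hT : D.IsDecomposition face map) [T2Space X] [Finite ι] {x : X}
    {U : ι → Set ℂ} (hU : ∀ j, IsOpen (U j))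
    (h : ∀ j, ∀ z ∈ (face j).region, map j z = x → z ∈ U j) :
    (⋃ j, map j '' ((face j).region ∩ U j)) ∈ 𝓝 x := by
  have hcl : IsClosed (⋃ j, map j '' ((face j).region \ U j)) := by
    refine isClosed_iUnion_of_finite fun j => IsCompact.isClosed ?_
    exact ((face j).isCompact_region.diff (hU j)).image_of_continuousOn
      ((hT.isPolygonMap j).continuousOn.mono Set.sdiff_subset)
  refine mem_of_superset (hcl.isOpen_compl.mem_nhds ?_) ?_
  · simp only [mem_compl_iff, mem_iUnion, not_exists]
    rintro j ⟨z, ⟨hz, hzU⟩, rfl⟩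
    exact hzU (h j z hz rfl)
  · intro y hy
    obtain ⟨j, z, hz, rfl⟩ := hT.surjective y
    simp only [mem_compl_iff, mem_iUnion, not_exists] at hy
    have : z ∈ U j := by
      by_contra hn
      exact hy j ⟨z, ⟨hz, hn⟩, rfl⟩
    exact mem_iUnion.2 ⟨j, z, ⟨hz, this⟩, rfl⟩

theorem eq_of_map_eq (hT : D.IsDecomposition face map) {j : ι} {i : ZMod (n j)} {z w : ℂ}
    (hz : z ∈ (face j).openSide i) (hw : w ∈ (face j).openSide i) (h : map j z = map j w) : z = w :=
  hT.side_injective j i hz hw h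

/-- A point of an open side which is not on the boundary of the surface is on another side. -/
theorem exists_other_side (hT : D.IsDecomposition face map) [T2Space X] [Finite ι] {j : ι}
    {i : ZMod (n j)} {z : ℂ} (hz : z ∈ (face j).openSide i) (hb : map j z ∉ D.bdry) :
    ∃ (j' : ι) (i' : ZMod (n j')), (⟨j, i⟩ : Σ j, ZMod (n j)) ≠ ⟨j', i'⟩ ∧
      map j z ∈ map j' '' (face j').openSide i' := by
  -- If no other side passes through the point, `z` is its only preimage, so the image of a
  -- half-disc at `z` is a neighbourhood of it. A chart at a point off the boundary covers a full
  -- disc, hence `ℓ` would be nonnegative near 0.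
  by_contra! hcon
  obtain ⟨c, hc, hx⟩ := D.exists_chart ((hT.isPolygonMap j).map_notMem_sing hz)
  obtain ⟨σ, hσ, hℓ⟩ := (face j).exists_isHalfPlaneAt hz
  set ℓ := σ • crossForm ((face j).vert (i + 1) - (face j).vert i)
  have hℓ0 : ℓ ≠ 0 := smul_ne_zero hσ
    (crossForm_ne_zero (sub_ne_zero.2 ((face j).vert_ne_succ i).symm))
  obtain ⟨a, ha, h1⟩ := (hT.isPolygonMap j).exists_scale hz hc hx hℓ
  obtain ⟨ε, hε, hball⟩ := Metric.mem_nhds_iff.1 h1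
  have hN := hT.image_mem_nhds (x := map j z)
    (U := fun k => {w | k = j ∧ w ∈ Metric.ball z (ε * a⁻¹)}) (fun k => by
      by_cases hk : k = j
      · convert Metric.isOpen_ball (x := z) (ε := ε * a⁻¹) using 1
        ext w; simp [hk]
      · simp [hk]) (by
      intro k w hw hwx
      obtain ⟨i', hi'⟩ := hT.exists_openSide hz hw hwx.symm
      have hsame : (⟨j, i⟩ : Σ j, ZMod (n j)) = ⟨k, i'⟩ := by
        by_contra hne
        exact hcon k i' hne ⟨w, hi', hwx⟩
      obtain ⟨rfl, hii⟩ := Sigma.mk.inj_iff.1 hsame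
      obtain rfl := eq_of_heq hii
      have := hT.eq_of_map_eq hi' hz hwx
      subst this
      exact ⟨rfl, Metric.mem_ball_self (by positivity)⟩)
  have hemb := (D.isChart c hc).isEmbedding
  have hN' : (Subtype.val ⁻¹' (⋃ k, map k '' ((face k).region ∩
      {w | k = j ∧ w ∈ Metric.ball z (ε * a⁻¹)})) : Set c.source) ∈
      𝓝 (⟨map j z, hx⟩ : c.source) := continuous_subtype_val.continuousAt hN
  rw [hemb.isInducing.nhds_eq_comap, mem_comap] at hN'
  obtain ⟨V, hV, hVsub⟩ := hN'
  have hV : V ∈ 𝓝 (c.toFun (map j z)) := hV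
  have himg := (D.isChart c hc).interior_point _ hx hb
  have hpos : ∀ᶠ ζ in 𝓝 (0 : ℂ), 0 ≤ ℓ ζ := by
    have htend : Tendsto (fun ζ : ℂ => c.toFun (map j z) + ζ) (𝓝 0) (𝓝 (c.toFun (map j z))) := by
      have : Continuous (fun ζ : ℂ => c.toFun (map j z) + ζ) := by fun_prop
      simpa using this.tendsto 0
    filter_upwards [htend.eventually hV, htend.eventually himg] with ζ hζV hζ
    obtain ⟨y, hy, hyζ⟩ := hζ
    have hmem : (⟨y, hy⟩ : c.source) ∈ c.source.domRestrict c.toFun ⁻¹' V := by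
      show c.toFun y ∈ V
      rw [hyζ]; exact hζV
    have := hVsub hmem
    simp only [mem_preimage, mem_iUnion] at this
    obtain ⟨k, w, ⟨hwR, rfl, hwB⟩, hwy⟩ := this
    have hsm : a • (w - z) ∈ Metric.ball (0 : ℂ) ε := by
      rw [mem_ball_zero_iff, norm_smul, Real.norm_eq_abs, abs_of_pos ha]
      rw [mem_ball_iff_norm] at hwB
      calc a * ‖w - z‖ < a * (ε * a⁻¹) := by gcongr
        _ = ε := by field_simp
    have h3 := hball hsm
    have ew : z + a⁻¹ • a • (w - z) = w := by
      rw [smul_smul, inv_mul_cancel₀ ha.ne', one_smul]; ring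
    simp only [mem_ofPred, ew] at h3
    have h4 := h3.1.1 hwR
    have h5 := (h3.2.2 h4).2
    rw [hwy, hyζ] at h5
    rwa [← add_left_cancel h5] at h4
  refine hℓ0 (LinearMap.ext fun ζ => ?_)
  have key : ∀ ζ, 0 ≤ ℓ ζ := by
    intro ζ
    obtain ⟨t, ht, ht0⟩ :=
      (((tendsto_smul_nhdsGT_zero ζ).eventually hpos).and self_mem_nhdsWithin).exists
    rw [map_smul, smul_eq_mul] at ht
    exact (mul_nonneg_iff_of_pos_left ht0).1 ht
  have h1 := key ζ
  have h2 := key (-ζ)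
  rw [map_neg] at h2
  show ℓ ζ = 0
  linarith

/-- A point of an open side which is on the boundary of the surface is on no other side. -/
theorem notMem_other_side (hT : D.IsDecomposition face map) {j j' : ι}
    {i : ZMod (n j)} {i' : ZMod (n j')} (hne : (⟨j, i⟩ : Σ j, ZMod (n j)) ≠ ⟨j', i'⟩) {z : ℂ}
    (hz : z ∈ (face j).openSide i) (hb : map j z ∈ D.bdry) :
    map j z ∉ map j' '' (face j').openSide i' := by
  rintro ⟨z', hz', h⟩
  obtain ⟨c, hc, hx⟩ := D.exists_chart ((hT.isPolygonMap j).map_notMem_sing hz)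
  obtain ⟨σ, hσ, hℓ⟩ := (face j).exists_isHalfPlaneAt hz
  obtain ⟨σ', hσ', hℓ'⟩ := (face j').exists_isHalfPlaneAt hz'
  have hℓ0 := smul_ne_zero hσ
    (crossForm_ne_zero (sub_ne_zero.2 ((face j).vert_ne_succ i).symm))
  have hℓ0' := smul_ne_zero hσ'
    (crossForm_ne_zero (sub_ne_zero.2 ((face j').vert_ne_succ i').symm))
  obtain ⟨t, ht, htl⟩ := hT.exists_opposite hne hz hz' h.symm hℓ hℓ' hℓ0 hℓ0'
  obtain ⟨a, ha, h1⟩ := (hT.isPolygonMap j).exists_scale hz hc hx hℓ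
  obtain ⟨a', ha', h2⟩ := (hT.isPolygonMap j').exists_scale hz' hc (h ▸ hx) hℓ'
  obtain ⟨ν, hν, hhalf⟩ := (D.isChart c hc).boundary_point _ hx hb
  have htend : Tendsto (fun ζ : ℂ => c.toFun (map j z) + ζ) (𝓝 0) (𝓝 (c.toFun (map j z))) := by
    have : Continuous (fun ζ : ℂ => c.toFun (map j z) + ζ) := by fun_prop
    simpa using this.tendsto 0
  -- The two polygons cover opposite closed half-planes in the chart, hence a full disc, while a
  -- chart at a boundary point only covers the half-plane of `ν`. The displacement along `-ν` gives
  -- the contradiction.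
  have hpos : ∀ᶠ ζ in 𝓝 (0 : ℂ), 0 ≤ inner ℝ ν ζ := by
    filter_upwards [h1, h2, htend.eventually hhalf] with ζ h1 h2 h3
    rw [add_sub_cancel_left] at h3
    rw [← h3]
    by_cases hs : 0 ≤ (σ • crossForm ((face j).vert (i + 1) - (face j).vert i)) ζ
    · exact ⟨_, (h1.2.2 hs).1, (h1.2.2 hs).2⟩
    · have hs' : 0 ≤ (σ' • crossForm ((face j').vert (i' + 1) - (face j').vert i')) ζ := by
        rw [htl] at hs
        by_contra! hn
        apply hs
        rw [LinearMap.smul_apply, smul_eq_mul, neg_mul]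
        have := mul_neg_of_pos_of_neg ht hn
        linarith
      refine ⟨_, (h2.2.2 hs').1, ?_⟩
      rw [(h2.2.2 hs').2, h]
  obtain ⟨t, ht, ht0⟩ :=
    (((tendsto_smul_nhdsGT_zero (-ν)).eventually hpos).and self_mem_nhdsWithin).exists
  have ht0 : 0 < t := ht0
  rw [inner_smul_right, inner_neg_right, real_inner_self_eq_norm_sq] at ht
  have : 0 < t * ‖ν‖ ^ 2 := mul_pos ht0 (by positivity)
  linarith

end IsDecomposition

end DilationStructure

/-! ### Dilations, and the gluing of two sides by a dilation -/

namespace IsDilation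

theorem id : IsDilation id := ⟨1, one_pos, 0, fun z => by simp⟩

theorem comp {f g : ℂ → ℂ} (hf : IsDilation f) (hg : IsDilation g) :
    IsDilation fun z => f (g z) := by
  obtain ⟨a, ha, b, hf⟩ := hf
  obtain ⟨a', ha', b', hg⟩ := hg
  exact ⟨a * a', mul_pos ha ha', a * b' + b, fun z => by
    simp only [hf, hg]; push_cast; ring⟩

theorem exists_inverse {f : ℂ → ℂ} (hf : IsDilation f) :
    ∃ g, IsDilation g ∧ (∀ z, g (f z) = z) ∧ ∀ z, f (g z) = z := by
  obtain ⟨a, ha, b, hf⟩ := hf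
  have ha' : (a : ℂ) ≠ 0 := by exact_mod_cast ha.ne'
  refine ⟨fun z => ((a⁻¹ : ℝ) : ℂ) * z + -(b / a), ⟨a⁻¹, inv_pos.2 ha, _, fun z => rfl⟩,
    fun z => ?_, fun z => ?_⟩
  · simp only [hf]; push_cast; field_simp; ring
  · simp only [hf]; push_cast; field_simp; ring

theorem injective {f : ℂ → ℂ} (hf : IsDilation f) : Function.Injective f := by
  obtain ⟨g, -, h, -⟩ := hf.exists_inverse
  exact Function.LeftInverse.injective h

theorem continuous {f : ℂ → ℂ} (hf : IsDilation f) : Continuous f := by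
  obtain ⟨a, ha, b, hf⟩ := hf
  rw [show f = fun z => (a : ℂ) * z + b from funext hf]
  fun_prop

theorem combo {f : ℂ → ℂ} (hf : IsDilation f) (t : ℝ) (p q : ℂ) :
    f ((1 - t) • p + t • q) = (1 - t) • f p + t • f q := by
  obtain ⟨a, ha, b, hf⟩ := hf
  simp only [hf, Complex.real_smul]; push_cast; ring

theorem image_openSegment {f : ℂ → ℂ} (hf : IsDilation f) (p q : ℂ) :
    f '' openSegment ℝ p q = openSegment ℝ (f p) (f q) := by
  simp only [openSegment_eq_image, image_image, hf.combo]

theorem image_segment {f : ℂ → ℂ} (hf : IsDilation f) (p q : ℂ) :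
    f '' segment ℝ p q = segment ℝ (f p) (f q) := by
  simp only [segment_eq_image, image_image, hf.combo]

theorem eq_of_eq_of_eq {f g : ℂ → ℂ} (hf : IsDilation f) (hg : IsDilation g) {z w : ℂ}
    (hzw : z ≠ w) (hz : f z = g z) (hw : f w = g w) : f = g := by
  obtain ⟨a, ha, b, hf⟩ := hf
  obtain ⟨a', ha', b', hg⟩ := hg
  rw [hf, hg] at hz hw
  have : (a : ℂ) = a' := by
    have h : ((a : ℂ) - a') * (z - w) = 0 := by linear_combination hz - hw
    rcases mul_eq_zero.1 h with h | h
    · exact sub_eq_zero.1 h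
    · exact absurd (sub_eq_zero.1 h) hzw
  rw [this] at hz
  funext u
  rw [hf, hg, this, add_left_cancel hz]

end IsDilation

theorem exists_ne_mem_openSegment {p q z : ℂ} (hpq : p ≠ q) (hz : z ∈ openSegment ℝ p q)
    {Q : ℂ → Prop} (hQ : ∀ᶠ w in 𝓝 z, Q w) : ∃ w ∈ openSegment ℝ p q, w ≠ z ∧ Q w := by
  obtain ⟨ε, hε, h⟩ := exists_ball_line_subset_openSegment hpq hz
  have h1 := (tendsto_smul_nhdsGT_zero (q - p)).const_add z
  rw [add_zero] at h1
  obtain ⟨t, ht, ht0⟩ := ((h1.eventually (hQ.and (Metric.ball_mem_nhds z hε))).and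
    self_mem_nhdsWithin).exists
  have ht0 : 0 < t := ht0
  refine ⟨_, h _ ht.2 ?_, ?_, ht.1⟩
  · rw [orient_eq_crossForm_sub (orient_eq_zero_of_mem_segment
      (openSegment_subset_segment ℝ _ _ hz)), add_sub_cancel_left, map_smul, crossForm_apply]
    rw [mul_comm, sub_self, smul_zero]
  · intro e
    have : t • (q - p) = 0 := by simpa using e
    rcases smul_eq_zero.1 this with h | h
    · exact ht0.ne' h
    · exact hpq (sub_eq_zero.1 h).symm

theorem endpoints_eq_of_segment_eq {a b c d : ℂ} (hab : a ≠ b)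
    (h : segment ℝ a b = segment ℝ c d) : (a = c ∧ b = d) ∨ (a = d ∧ b = c) := by
  have ha : a ∈ segment ℝ c d := h ▸ left_mem_segment ℝ a b
  have hb : b ∈ segment ℝ c d := h ▸ right_mem_segment ℝ a b
  have hc : c ∈ segment ℝ a b := h ▸ left_mem_segment ℝ c d
  have hd : d ∈ segment ℝ a b := h ▸ right_mem_segment ℝ c d
  rw [segment_eq_image] at ha hb hc hd
  obtain ⟨s, ⟨hs0, hs1⟩, rfl⟩ := ha
  obtain ⟨t, ⟨ht0, ht1⟩, rfl⟩ := hb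
  obtain ⟨u, ⟨hu0, hu1⟩, hu⟩ := hc
  obtain ⟨v, ⟨hv0, hv1⟩, hv⟩ := hd
  have hcd : d - c ≠ 0 := by
    intro h0
    obtain rfl : d = c := sub_eq_zero.1 h0
    apply hab
    simp only [Complex.real_smul]; push_cast; ring
  have hu' : (1 - u) * s + u * t = 0 := by
    have : ((((1 - u) * s + u * t : ℝ) : ℂ)) * (d - c) = 0 := by
      simp only [Complex.real_smul] at hu
      push_cast at hu ⊢
      linear_combination hu
    rcases mul_eq_zero.1 this with h | h
    · exact_mod_cast h
    · exact absurd h hcd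
  have hv' : (1 - v) * s + v * t = 1 := by
    have : ((((1 - v) * s + v * t - 1 : ℝ) : ℂ)) * (d - c) = 0 := by
      simp only [Complex.real_smul] at hv
      push_cast at hv ⊢
      linear_combination hv
    rcases mul_eq_zero.1 this with h | h
    · have : (1 - v) * s + v * t - 1 = 0 := by exact_mod_cast h
      linarith
    · exact absurd h hcd
  have e1 : (1 - u) * s = 0 := by nlinarith [mul_nonneg (sub_nonneg.2 hu1) hs0, mul_nonneg hu0 ht0]
  have e2 : u * t = 0 := by linarith
  rcases mul_eq_zero.1 e1 with h1 | h1
  · have hu1 : u = 1 := by linarith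
    subst hu1
    have ht : t = 0 := by linarith
    subst ht
    have hs : s = 1 := by nlinarith
    subst hs
    right; simp
  · subst h1
    have ht : t = 1 := by nlinarith
    subst ht
    left; simp

namespace DilationStructure

variable {X : Type*} [TopologicalSpace X] {D : DilationStructure X}
variable {ι : Type} {n : ι → ℕ} {face : ∀ j, PlanarPolygon (n j)} {map : ι → ℂ → X}

namespace IsDecomposition

/-- In a chart both sides pass through the same point, and their polygons are opposite half-planes,
so both are carried by the same line. Following one polygon into the chart and the other back out is
the dilation centred there with ratio `a'⁻¹ * a`. -/
theorem exists_local_gluing (hT : D.IsDecomposition face map) {j j' : ι} {i : ZMod (n j)}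
    {i' : ZMod (n j')} (hne : (⟨j, i⟩ : Σ j, ZMod (n j)) ≠ ⟨j', i'⟩) {z z' : ℂ}
    (hz : z ∈ (face j).openSide i) (hz' : z' ∈ (face j').openSide i') (h : map j z = map j' z') :
    ∃ g, IsDilation g ∧ ∀ᶠ w in 𝓝 z, w ∈ (face j).openSide i →
      g w ∈ (face j').openSide i' ∧ map j' (g w) = map j w := by
  obtain ⟨c, hc, hx⟩ := D.exists_chart ((hT.isPolygonMap j).map_notMem_sing hz)
  obtain ⟨σ, hσ, hℓ⟩ := (face j).exists_isHalfPlaneAt hz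
  obtain ⟨σ', hσ', hℓ'⟩ := (face j').exists_isHalfPlaneAt hz'
  have hℓ0 := smul_ne_zero hσ
    (crossForm_ne_zero (sub_ne_zero.2 ((face j).vert_ne_succ i).symm))
  have hℓ0' := smul_ne_zero hσ'
    (crossForm_ne_zero (sub_ne_zero.2 ((face j').vert_ne_succ i').symm))
  obtain ⟨t, ht, htl⟩ := hT.exists_opposite hne hz hz' h hℓ hℓ' hℓ0 hℓ0'
  obtain ⟨a, ha, h1⟩ := (hT.isPolygonMap j).exists_scale hz hc hx hℓ
  obtain ⟨a', ha', h2⟩ := (hT.isPolygonMap j').exists_scale hz' hc (h ▸ hx) hℓ'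
  obtain ⟨ε, hε, hball⟩ := exists_ball_line_subset_openSegment ((face j').vert_ne_succ i') hz'
  have hg : IsDilation fun w => z' + a'⁻¹ • a • (w - z) :=
    ⟨a'⁻¹ * a, by positivity, z' - a'⁻¹ • a • z, fun w => by
      simp only [Complex.real_smul]; push_cast; ring⟩
  refine ⟨_, hg, ?_⟩
  have t1 : Tendsto (fun w => a • (w - z)) (𝓝 z) (𝓝 0) := by
    have : Continuous (fun w => a • (w - z)) := by fun_prop
    have h := this.tendsto z
    rwa [sub_self, smul_zero] at h
  have t2 : Tendsto (fun w => z' + a'⁻¹ • a • (w - z)) (𝓝 z) (𝓝 z') := by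
    have h := hg.continuous.tendsto z
    simpa using h
  filter_upwards [t1.eventually h1, t1.eventually h2, t2.eventually (Metric.ball_mem_nhds z' hε)]
    with w h1 h2 h3 hw
  have hw0 : (σ • crossForm ((face j).vert (i + 1) - (face j).vert i)) (a • (w - z)) = 0 := by
    rw [map_smul, LinearMap.smul_apply, ← orient_eq_crossForm_sub (orient_eq_zero_of_mem_segment
      ((face j).openSide_subset_side i hz)), orient_eq_zero_of_mem_segment
      ((face j).openSide_subset_side i hw), smul_zero, smul_zero]
  have hw0' : (σ' • crossForm ((face j').vert (i' + 1) - (face j').vert i')) (a • (w - z)) = 0 := by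
    rw [htl, LinearMap.smul_apply, smul_eq_mul, mul_eq_zero] at hw0
    rcases hw0 with h | h
    · linarith
    · exact h
  have e1 := h1.2.2 hw0.ge
  have e2 := h2.2.2 hw0'.ge
  rw [smul_smul, inv_mul_cancel₀ ha.ne', one_smul, add_sub_cancel] at e1
  constructor
  · refine hball _ h3 ?_
    rw [orient_eq_crossForm_sub (orient_eq_zero_of_mem_segment
      ((face j').openSide_subset_side i' hz')), add_sub_cancel_left, map_smul]
    rw [LinearMap.smul_apply, smul_eq_mul, mul_eq_zero] at hw0'
    rw [hw0'.resolve_left hσ', smul_zero]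
  · refine IsPolygonMap.eq_of_chart_eq hc e2.1 e1.1 ?_
    rw [e1.2, e2.2, h]

/-- Two sides with the same image are identified by a dilation. -/
theorem exists_gluing (hT : D.IsDecomposition face map) {j j' : ι} {i : ZMod (n j)}
    {i' : ZMod (n j')} (he : map j '' (face j).openSide i = map j' '' (face j').openSide i') :
    ∃ g, IsDilation g ∧ g '' (face j).openSide i = (face j').openSide i' ∧
      ∀ w ∈ (face j).openSide i, map j' (g w) = map j w := by
  by_cases hne : (⟨j, i⟩ : Σ j, ZMod (n j)) = ⟨j', i'⟩
  · obtain ⟨rfl, hii⟩ := Sigma.mk.inj_iff.1 hne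
    obtain rfl := eq_of_heq hii
    exact ⟨id, IsDilation.id, image_id _, fun _ _ => rfl⟩
  set S := (face j).openSide i with hS
  set S' := (face j').openSide i' with hS'
  have hpq := (face j).vert_ne_succ i
  have hloc : ∀ z ∈ S, ∃ g, IsDilation g ∧ ∀ᶠ w in 𝓝 z, w ∈ S → g w ∈ S' ∧
      map j' (g w) = map j w := by
    intro z hz
    have : map j z ∈ map j' '' S' := he ▸ mem_image_of_mem _ hz
    obtain ⟨z', hz', h⟩ := this
    exact hT.exists_local_gluing hne hz hz' h.symm
  have hmid : (1 - (1 / 2 : ℝ)) • (face j).vert i + (1 / 2 : ℝ) • (face j).vert (i + 1) ∈ S := by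
    rw [hS, PlanarPolygon.openSide, openSegment_eq_image]
    exact ⟨1 / 2, ⟨by norm_num, by norm_num⟩, rfl⟩
  obtain ⟨g, hg, hgev⟩ := hloc _ hmid
  -- A dilation is determined by two points and the map is injective on the target side, so two
  -- local gluings that overlap coincide. Connectedness of the side then propagates one of them to
  -- the whole side.
  have hglob : ∀ z ∈ S, ∀ᶠ w in 𝓝 z, w ∈ S → g w ∈ S' ∧ map j' (g w) = map j w := by
    have hpre : IsPreconnected S := (convex_openSegment _ _).isPreconnected
    by_contra hcon
    simp only [not_forall] at hcon
    obtain ⟨z₁, hz₁, hn⟩ := hcon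
    obtain ⟨g₁, hg₁, hgev₁⟩ := hloc z₁ hz₁
    have hopen : ∀ f : ℂ → ℂ,
        IsOpen {z | ∀ᶠ w in 𝓝 z, w ∈ S → f w ∈ S' ∧ map j' (f w) = map j w} := fun f =>
      isOpen_iff_mem_nhds.2 fun z hz => eventually_eventually_nhds.2 hz
    have hopen' : IsOpen {z | ∃ f, IsDilation f ∧ f ≠ g ∧
        ∀ᶠ w in 𝓝 z, w ∈ S → f w ∈ S' ∧ map j' (f w) = map j w} := by
      refine isOpen_iff_mem_nhds.2 fun z hz => ?_
      obtain ⟨f, hf, hfg, hfe⟩ := hz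
      filter_upwards [eventually_eventually_nhds.2 hfe] with w hw
      exact ⟨f, hf, hfg, hw⟩
    obtain ⟨z, hzS, hz1, f, hf, hfg, hz2⟩ := hpre _ _ (hopen g) hopen' (fun z hz => by
      obtain ⟨f, hf, hfe⟩ := hloc z hz
      by_cases hfg : f = g
      · exact .inl (hfg ▸ hfe)
      · exact .inr ⟨f, hf, hfg, hfe⟩) ⟨_, hmid, hgev⟩
      ⟨z₁, hz₁, g₁, hg₁, fun e => hn (e ▸ hgev₁), hgev₁⟩
    have hz1 : ∀ᶠ w in 𝓝 z, w ∈ S → g w ∈ S' ∧ map j' (g w) = map j w := hz1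
    obtain ⟨w, hwS, hwz, hw1, hw2⟩ := exists_ne_mem_openSegment hpq hzS (hz1.and hz2)
    have a1 := hw1 hwS
    have a2 := hw2 hwS
    have b1 := hz1.self_of_nhds hzS
    have b2 := hz2.self_of_nhds hzS
    exact hfg (hf.eq_of_eq_of_eq hg hwz
      (hT.side_injective j' i' a2.1 a1.1 (a2.2.trans a1.2.symm))
      (hT.side_injective j' i' b2.1 b1.1 (b2.2.trans b1.2.symm)))
  have hmaps : ∀ z ∈ S, g z ∈ S' ∧ map j' (g z) = map j z := fun z hz =>
    (hglob z hz).self_of_nhds hz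
  refine ⟨g, hg, Subset.antisymm ?_ ?_, fun w hw => (hmaps w hw).2⟩
  · rintro _ ⟨z, hz, rfl⟩
    exact (hmaps z hz).1
  · intro w hw
    have : map j' w ∈ map j '' S := he ▸ mem_image_of_mem _ hw
    obtain ⟨z, hz, hzw⟩ := this
    exact ⟨z, hz, hT.side_injective j' i' (hmaps z hz).1 hw ((hmaps z hz).2.trans hzw)⟩

end IsDecomposition

/-- The image of the endpoints of a side under a dilation onto another side. -/
theorem _root_.PlanarPolygon.gluing_endpoints {n m : ℕ} (P : PlanarPolygon n) (Q : PlanarPolygon m)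
    {i : ZMod n} {k : ZMod m} {g : ℂ → ℂ} (hg : IsDilation g)
    (h : g '' P.openSide i = Q.openSide k) :
    (g (P.vert i) = Q.vert k ∧ g (P.vert (i + 1)) = Q.vert (k + 1)) ∨
    (g (P.vert i) = Q.vert (k + 1) ∧ g (P.vert (i + 1)) = Q.vert k) := by
  refine endpoints_eq_of_segment_eq (fun e => P.vert_ne_succ i (hg.injective e)) ?_
  rw [PlanarPolygon.openSide, PlanarPolygon.openSide, hg.image_openSegment] at h
  rw [← closure_openSegment, h, closure_openSegment]

end DilationStructure

/-! ### Circle-valued maps on the one-holed torus -/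

/-- The difference of two real lifts of the same circle-valued map takes its values in a fibre of
the covering, which is discrete. -/
theorem sub_eq_sub_of_coe_addCircle_eq {Y : Type*} [TopologicalSpace Y] {S : Set Y}
    (hS : IsPreconnected S) {f g : Y → ℝ} (hf : ContinuousOn f S) (hg : ContinuousOn g S)
    (h : ∀ y ∈ S, (f y : AddCircle (1 : ℝ)) = g y) {x y : Y} (hx : x ∈ S) (hy : y ∈ S) :
    f x - g x = f y - g y :=
  (AddCircle.isCoveringMap_coe (1 : ℝ)).constOn_of_comp hS (hf.sub hg) (fun a ha a' ha' => by
    rw [Pi.sub_apply, Pi.sub_apply, AddCircle.coe_sub, AddCircle.coe_sub, h a ha, h a' ha',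
      sub_self, sub_self]) hx hy

theorem exists_int_of_coe_addCircle_eq {x y : ℝ} (h : (x : AddCircle (1 : ℝ)) = y) :
    ∃ n : ℤ, x = y + n := by
  rw [← sub_eq_zero, ← AddCircle.coe_sub, AddCircle.coe_eq_zero_iff] at h
  obtain ⟨n, hn⟩ := h
  exact ⟨n, by rw [zsmul_one] at hn; linarith⟩

theorem coe_addCircle_add_int (x : ℝ) (n : ℤ) :
    ((x + n : ℝ) : AddCircle (1 : ℝ)) = x := by
  rw [AddCircle.coe_add, add_eq_left, AddCircle.coe_eq_zero_iff]
  exact ⟨n, by simp⟩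

/-- A continuous function on a compact space descends to a Hausdorff quotient. -/
theorem exists_continuousMap_of_surjective {K Y Z : Type*} [TopologicalSpace K] [CompactSpace K]
    [TopologicalSpace Y] [T2Space Y] [TopologicalSpace Z] {q : K → Y} (hq : Continuous q)
    (hs : Function.Surjective q) {φ : K → Z} (hφ : Continuous φ)
    (h : ∀ a b, q a = q b → φ a = φ b) : ∃ g : C(Y, Z), ∀ a, g (q a) = φ a := by
  have hquot : IsQuotientMap q := hq.isClosedMap.isQuotientMap hq hs
  have hr := hs.hasRightInverse.choose_spec
  refine ⟨⟨fun y => φ (hs.hasRightInverse.choose y), ?_⟩, fun a => h _ _ (hr _)⟩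
  rw [hquot.continuous_iff]
  convert hφ using 1
  funext a
  exact h _ _ (hr _)

namespace OneHoledTorus

instance : T2Space OneHoledTorus := inferInstanceAs (T2Space
    {p : Circle × Circle // (p.1 : ℂ).re ≤ 0 ∨ (p.2 : ℂ).re ≤ 0})

theorem _root_.Circle.re_exp (t : ℝ) : (Circle.exp t : ℂ).re = Real.cos t := by
  rw [Circle.coe_exp, Complex.exp_ofReal_mul_I_re]

theorem cos_nonpos {a : ℝ} (ha : a ∈ Icc (Real.pi / 2) (3 * Real.pi / 2)) : Real.cos a ≤ 0 :=
  Real.cos_nonpos_of_pi_div_two_le_of_le ha.1 (by linarith [ha.2])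

theorem mem_Icc_of_cos_nonpos {t : ℝ} (ht : t ∈ Icc 0 (2 * Real.pi)) (h : Real.cos t ≤ 0) :
    t ∈ Icc (Real.pi / 2) (3 * Real.pi / 2) := by
  have hpi := Real.pi_pos
  constructor
  · by_contra! hlt
    have := Real.cos_pos_of_mem_Ioo (x := t) ⟨by linarith [ht.1], hlt⟩
    linarith
  · by_contra! hlt
    have := Real.cos_pos_of_mem_Ioo (x := t - 2 * Real.pi) ⟨by linarith, by linarith [ht.2]⟩
    rw [Real.cos_sub_two_pi] at this
    linarith

theorem exists_angle (z : Circle) : ∃ t ∈ Icc 0 (2 * Real.pi), Circle.exp t = z := by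
  by_cases h : 0 ≤ Complex.arg z
  · exact ⟨Complex.arg z, ⟨h, by linarith [Complex.arg_le_pi z, Real.pi_pos]⟩, Circle.exp_arg z⟩
  · refine ⟨Complex.arg z + 2 * Real.pi, ⟨by linarith [Complex.neg_pi_lt_arg z, Real.pi_pos],
      by linarith⟩, ?_⟩
    rw [Circle.exp_add_two_pi, Circle.exp_arg]

/-- The retraction of the line to the angles of the left half of the circle. -/
noncomputable def leftAngle (a : ℝ) : ℝ := max (Real.pi / 2) (min a (3 * Real.pi / 2))

theorem leftAngle_mem (a : ℝ) : leftAngle a ∈ Icc (Real.pi / 2) (3 * Real.pi / 2) :=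
  ⟨le_max_left _ _, max_le (by linarith [Real.pi_pos]) (min_le_right _ _)⟩

theorem leftAngle_eq {a : ℝ} (ha : a ∈ Icc (Real.pi / 2) (3 * Real.pi / 2)) : leftAngle a = a := by
  rw [leftAngle, min_eq_left ha.2, max_eq_right ha.1]

theorem continuous_leftAngle : Continuous leftAngle := by unfold leftAngle; fun_prop

/-- The universal cover of the annulus where the first coordinate is on the left. -/
noncomputable def coverFst (p : ℝ × ℝ) : OneHoledTorus :=
  ⟨(Circle.exp (leftAngle p.1), Circle.exp p.2), .inl (by
    rw [Circle.re_exp]; exact cos_nonpos (leftAngle_mem _))⟩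

/-- The universal cover of the annulus where the second coordinate is on the left. -/
noncomputable def coverSnd (p : ℝ × ℝ) : OneHoledTorus :=
  ⟨(Circle.exp p.2, Circle.exp (leftAngle p.1)), .inr (by
    rw [Circle.re_exp]; exact cos_nonpos (leftAngle_mem _))⟩

theorem continuous_coverFst : Continuous coverFst := by
  refine Continuous.subtype_mk ?_ _
  exact (Circle.exp.continuous.comp (continuous_leftAngle.comp continuous_fst)).prodMk
    (Circle.exp.continuous.comp continuous_snd)

theorem continuous_coverSnd : Continuous coverSnd := by
  refine Continuous.subtype_mk ?_ _
  exact (Circle.exp.continuous.comp continuous_snd).prodMk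
    (Circle.exp.continuous.comp (continuous_leftAngle.comp continuous_fst))

theorem ext_of_eq {x y : OneHoledTorus} (h1 : x.1.1 = y.1.1) (h2 : x.1.2 = y.1.2) : x = y :=
  Subtype.ext (Prod.ext h1 h2)

theorem coverFst_add (a t : ℝ) : coverFst (a, t + 2 * Real.pi) = coverFst (a, t) := by
  exact ext_of_eq rfl (Circle.exp_add_two_pi t)

theorem coverSnd_add (a t : ℝ) : coverSnd (a, t + 2 * Real.pi) = coverSnd (a, t) := by
  exact ext_of_eq (Circle.exp_add_two_pi t) rfl

/-- A lift of the composition of `h` with `c`, with its increment along the second factor. -/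
def IsLift (c : ℝ × ℝ → OneHoledTorus) (h : OneHoledTorus → AddCircle (1 : ℝ)) (d : ℤ)
    (φ : ℝ × ℝ → ℝ) : Prop :=
  Continuous φ ∧ (∀ p, (φ p : AddCircle (1 : ℝ)) = h (c p)) ∧
    ∀ a t, φ (a, t + 2 * Real.pi) = φ (a, t) + d

/-- The plane is simply connected, so the composition lifts. Translation by a period gives another
lift, which differs from the first one by an integer constant, the winding number `d`. -/
theorem exists_isLift {c : ℝ × ℝ → OneHoledTorus} (hc : Continuous c)
    (hper : ∀ a t, c (a, t + 2 * Real.pi) = c (a, t)) (h : C(OneHoledTorus, AddCircle (1 : ℝ))) :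
    ∃ d φ, IsLift c h d φ := by
  obtain ⟨e₀, he₀⟩ := QuotientAddGroup.mk_surjective (h (c 0))
  obtain ⟨F, ⟨-, hF⟩, -⟩ := (AddCircle.isCoveringMap_coe (1 : ℝ)).existsUnique_continuousMap_lifts
    (h.comp ⟨c, hc⟩) 0 e₀ he₀
  have hF' : ∀ p, (F p : AddCircle (1 : ℝ)) = h (c p) := fun p => congrFun hF p
  obtain ⟨d, hd⟩ := exists_int_of_coe_addCircle_eq (x := F (0, 0 + 2 * Real.pi)) (y := F (0, 0))
    (by rw [hF', hF', hper])
  refine ⟨d, F, F.continuous, hF', fun a t => ?_⟩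
  have hshift : Continuous fun p : ℝ × ℝ => F (p.1, p.2 + 2 * Real.pi) :=
    F.continuous.comp (by fun_prop)
  have := sub_eq_sub_of_coe_addCircle_eq (isPreconnected_univ (α := ℝ × ℝ))
    (f := fun p => F (p.1, p.2 + 2 * Real.pi)) (g := F) hshift.continuousOn
    F.continuous.continuousOn (fun p _ => by rw [hF', hF', hper]) (mem_univ (a, t))
    (mem_univ (0, 0))
  simp only at this
  linarith

theorem IsLift.sum {c : ℝ × ℝ → OneHoledTorus} {κ : Type*} (s : Finset κ) (k : κ → ℤ)
    {h : κ → OneHoledTorus → AddCircle (1 : ℝ)} {d : κ → ℤ} {φ : κ → ℝ × ℝ → ℝ}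
    (H : ∀ i, IsLift c (h i) (d i) (φ i)) :
    IsLift c (fun x => ∑ i ∈ s, k i • h i x) (∑ i ∈ s, k i * d i)
      (fun p => ∑ i ∈ s, k i * φ i p) := by
  refine ⟨?_, fun p => ?_, fun a t => ?_⟩
  · exact continuous_finsetSum _ fun i _ => continuous_const.mul (H i).1
  · induction s using Finset.cons_induction with
    | empty => simp
    | cons i s his ih =>
      simp only [Finset.sum_cons] at ih ⊢
      rw [AddCircle.coe_add, ih, ← (H i).2.1,
        ← AddCircle.coe_zsmul, zsmul_eq_mul]
  · simp only [(H _).2.2, mul_add, Finset.sum_add_distrib]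
    push_cast
    rfl

theorem IsLift.periodic {c : ℝ × ℝ → OneHoledTorus} {h : OneHoledTorus → AddCircle (1 : ℝ)}
    {φ : ℝ × ℝ → ℝ} (H : IsLift c h 0 φ) (a t : ℝ) (m : ℤ) :
    φ (a, t + m * (2 * Real.pi)) = φ (a, t) := by
  have : Function.Periodic (fun t => φ (a, t)) (2 * Real.pi) := fun t => by
    simpa using H.2.2 a t
  exact this.int_mul m t

/-- The torus with a hole is the union of two annuli, whose intersection is a square. Zero winding
numbers make the lifts descend to the annuli; on the connected square they differ by an integer
constant `k`, and adding `k` to one of them makes them match. -/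
theorem exists_real_lift {h : OneHoledTorus → AddCircle (1 : ℝ)} {φ ψ : ℝ × ℝ → ℝ}
    (Hφ : IsLift coverFst h 0 φ) (Hψ : IsLift coverSnd h 0 ψ) :
    ∃ g : C(OneHoledTorus, ℝ), ∀ x, (g x : AddCircle (1 : ℝ)) = h x := by
  set I := Icc (Real.pi / 2) (3 * Real.pi / 2)
  set J := Icc 0 (2 * Real.pi)
  have hpi := Real.pi_pos
  have hswap : ∀ a ∈ I, ∀ t ∈ I, coverFst (a, t) = coverSnd (t, a) := by
    intro a ha t ht
    exact ext_of_eq (congrArg Circle.exp (leftAngle_eq ha))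
      (congrArg Circle.exp (leftAngle_eq ht).symm)
  have hpI : Real.pi ∈ I := ⟨by linarith, by linarith⟩
  obtain ⟨k, hk⟩ := exists_int_of_coe_addCircle_eq (x := φ (Real.pi, Real.pi))
    (y := ψ (Real.pi, Real.pi)) (by rw [Hφ.2.1, Hψ.2.1, hswap _ hpI _ hpI])
  have hagree : ∀ a ∈ I, ∀ t ∈ I, φ (a, t) = ψ (t, a) + k := by
    intro a ha t ht
    have hsw : Continuous fun p : ℝ × ℝ => ψ (p.2, p.1) := Hψ.1.comp (by fun_prop)
    have := sub_eq_sub_of_coe_addCircle_eq (S := I ×ˢ I)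
      ((convex_Icc _ _).prod (convex_Icc _ _)).isPreconnected (f := φ)
      (g := fun p => ψ (p.2, p.1)) Hφ.1.continuousOn hsw.continuousOn (fun p hp => by
        rw [Hφ.2.1, Hψ.2.1, ← hswap _ hp.1 _ hp.2]) (x := (a, t)) (y := (Real.pi, Real.pi))
        ⟨ha, ht⟩ ⟨hpI, hpI⟩
    simp only at this
    linarith
  have hinj : ∀ a ∈ I, ∀ a' ∈ I, Circle.exp a = Circle.exp a' → a = a' := fun a ha a' ha' e =>
    Circle.exp_injOn_Icc (a := Real.pi / 2) (b := 3 * Real.pi / 2) (by linarith) ha ha' e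
  -- A point common to both annuli has both coordinates in the left half of the circle, where angles
  -- are unique.
  have hcross : ∀ (a b : I) (t u : J), coverFst (a, t) = coverSnd (b, u) →
      φ (a, t) = ψ (b, u) + k := by
    rintro ⟨a, ha⟩ ⟨b, hb⟩ ⟨t, ht⟩ ⟨u, hu⟩ e
    have e1 : Circle.exp a = Circle.exp u := by
      simpa [coverFst, coverSnd, leftAngle_eq ha, leftAngle_eq hb] using
        congrArg (fun x : OneHoledTorus => x.1.1) e
    have e2 : Circle.exp t = Circle.exp b := by
      simpa [coverFst, coverSnd, leftAngle_eq ha, leftAngle_eq hb] using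
        congrArg (fun x : OneHoledTorus => x.1.2) e
    have hu' : u ∈ I := mem_Icc_of_cos_nonpos hu (by
      rw [← Circle.re_exp, ← e1, Circle.re_exp]; exact cos_nonpos ha)
    have ht' : t ∈ I := mem_Icc_of_cos_nonpos ht (by
      rw [← Circle.re_exp, e2, Circle.re_exp]; exact cos_nonpos hb)
    obtain rfl := hinj _ ha _ hu' e1
    obtain rfl := hinj _ ht' _ hb e2
    exact hagree _ ha _ ht'
  -- Two compact rectangles suffice to cover the torus, which is therefore a quotient of their
  -- disjoint union; a continuous function on the torus is one on the rectangles that respects `q`.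
  let q : (I × J) ⊕ (I × J) → OneHoledTorus :=
    Sum.elim (fun p => coverFst (p.1, p.2)) (fun p => coverSnd (p.1, p.2))
  let f : (I × J) ⊕ (I × J) → ℝ := Sum.elim (fun p => φ (p.1, p.2)) (fun p => ψ (p.1, p.2) + k)
  have hincl : Continuous fun p : I × J => ((p.1 : ℝ), (p.2 : ℝ)) := by fun_prop
  have hq : Continuous q := (continuous_coverFst.comp hincl).sumElim
    (continuous_coverSnd.comp hincl)
  have hf : Continuous f := (Hφ.1.comp hincl).sumElim ((Hψ.1.comp hincl).add continuous_const)
  have hs : Function.Surjective q := by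
    rintro ⟨⟨z, w⟩, h | h⟩
    · obtain ⟨a, ha, rfl⟩ := exists_angle z
      obtain ⟨t, ht, rfl⟩ := exists_angle w
      have ha' : a ∈ I := mem_Icc_of_cos_nonpos ha (by rwa [← Circle.re_exp])
      refine ⟨.inl (⟨a, ha'⟩, ⟨t, ht⟩), ?_⟩
      exact ext_of_eq (congrArg Circle.exp (leftAngle_eq ha')) rfl
    · obtain ⟨a, ha, rfl⟩ := exists_angle w
      obtain ⟨t, ht, rfl⟩ := exists_angle z
      have ha' : a ∈ I := mem_Icc_of_cos_nonpos ha (by rwa [← Circle.re_exp])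
      refine ⟨.inr (⟨a, ha'⟩, ⟨t, ht⟩), ?_⟩
      exact ext_of_eq rfl (congrArg Circle.exp (leftAngle_eq ha'))
  obtain ⟨g, hg⟩ := exists_continuousMap_of_surjective hq hs hf (by
    rintro (⟨⟨a, ha⟩, ⟨t, ht⟩⟩ | ⟨⟨a, ha⟩, ⟨t, ht⟩⟩) (⟨⟨b, hb⟩, ⟨u, hu⟩⟩ | ⟨⟨b, hb⟩, ⟨u, hu⟩⟩) e
    · change coverFst (a, t) = coverFst (b, u) at e
      have e1 : Circle.exp a = Circle.exp b := by
        simpa [coverFst, leftAngle_eq ha, leftAngle_eq hb] using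
          congrArg (fun x : OneHoledTorus => x.1.1) e
      have e2 : Circle.exp t = Circle.exp u := by
        simpa [coverFst] using congrArg (fun x : OneHoledTorus => x.1.2) e
      obtain rfl := hinj _ ha _ hb e1
      obtain ⟨m, rfl⟩ := Circle.exp_eq_exp.1 e2
      exact Hφ.periodic _ _ _
    · exact hcross ⟨a, ha⟩ ⟨b, hb⟩ ⟨t, ht⟩ ⟨u, hu⟩ e
    · exact (hcross ⟨b, hb⟩ ⟨a, ha⟩ ⟨u, hu⟩ ⟨t, ht⟩ e.symm).symm
    · change coverSnd (a, t) = coverSnd (b, u) at e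
      have e1 : Circle.exp a = Circle.exp b := by
        simpa [coverSnd, leftAngle_eq ha, leftAngle_eq hb] using
          congrArg (fun x : OneHoledTorus => x.1.2) e
      have e2 : Circle.exp t = Circle.exp u := by
        simpa [coverSnd] using congrArg (fun x : OneHoledTorus => x.1.1) e
      obtain rfl := hinj _ ha _ hb e1
      obtain ⟨m, rfl⟩ := Circle.exp_eq_exp.1 e2
      exact congrArg (· + (k : ℝ)) (Hψ.periodic _ _ _))
  refine ⟨g, fun x => ?_⟩
  obtain ⟨p, rfl⟩ := hs x
  rw [hg]
  rcases p with p | p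
  · exact Hφ.2.1 _
  · show ((ψ (p.1, p.2) + k : ℝ) : AddCircle (1 : ℝ)) = _
    rw [coe_addCircle_add_int]
    exact Hψ.2.1 _

/-- Any three circle-valued maps on the one-holed torus satisfy a nontrivial integral relation
modulo real-valued maps. -/
theorem exists_relation (h : Fin 3 → C(OneHoledTorus, AddCircle (1 : ℝ))) :
    ∃ k : Fin 3 → ℤ, k ≠ 0 ∧ ∃ g : C(OneHoledTorus, ℝ),
      ∀ x, (g x : AddCircle (1 : ℝ)) = ∑ i, k i • h i x := by
  choose d φ hφ using fun i => exists_isLift continuous_coverFst coverFst_add (h i)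
  choose d' ψ hψ using fun i => exists_isLift continuous_coverSnd coverSnd_add (h i)
  -- The two winding numbers of each map form a vector of ℤ², and three such vectors are dependent.
  have hdep : ¬ LinearIndependent ℤ (fun i => (d i, d' i)) := by
    intro hli
    have := hli.fintype_card_le_finrank
    simp at this
  rw [Fintype.not_linearIndependent_iff] at hdep
  obtain ⟨k, hk, i, hi⟩ := hdep
  refine ⟨k, fun h0 => hi (by rw [h0]; rfl), ?_⟩
  have h1 : ∑ i, k i * d i = 0 := by simpa [Prod.fst_sum] using congrArg Prod.fst hk
  have h2 : ∑ i, k i * d' i = 0 := by simpa [Prod.snd_sum] using congrArg Prod.snd hk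
  have H1 := IsLift.sum Finset.univ k hφ
  have H2 := IsLift.sum Finset.univ k hψ
  rw [h1] at H1
  rw [h2] at H2
  exact exists_real_lift H1 H2

end OneHoledTorus

/-! ### The boundary circle of the one-holed torus -/

namespace OneHoledTorus

/-- The sup norm on the plane. -/
def boxNorm (z : ℂ) : ℝ := max |z.re| |z.im|

theorem boxNorm_pos {z : ℂ} (hz : z ≠ 0) : 0 < boxNorm z := by
  rw [boxNorm, lt_max_iff, abs_pos, abs_pos]
  by_contra! h
  exact hz (Complex.ext h.1 h.2)

theorem boxNorm_smul {r : ℝ} (hr : 0 ≤ r) (z : ℂ) : boxNorm (r • z) = r * boxNorm z := by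
  rw [boxNorm, Complex.smul_re, Complex.smul_im, smul_eq_mul, smul_eq_mul, abs_mul, abs_mul,
    abs_of_nonneg hr, boxNorm, mul_max_of_nonneg _ _ hr]

theorem continuous_boxNorm : Continuous boxNorm := by unfold boxNorm; fun_prop

/-- The exponential map from the square `[-1, 1]²` to the right quarter of the torus. -/
noncomputable def boxExp (z : ℂ) : Circle × Circle :=
  (Circle.exp (Real.pi / 2 * z.re), Circle.exp (Real.pi / 2 * z.im))

theorem continuous_boxExp : Continuous boxExp :=
  (Circle.exp.continuous.comp (by fun_prop)).prodMk (Circle.exp.continuous.comp (by fun_prop))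

theorem boxExp_injective {z w : ℂ} (hz : boxNorm z ≤ 1) (hw : boxNorm w ≤ 1)
    (h : boxExp z = boxExp w) : z = w := by
  have hpi := Real.pi_pos
  have aux : ∀ s t : ℝ, |s| ≤ 1 → |t| ≤ 1 →
      Circle.exp (Real.pi / 2 * s) = Circle.exp (Real.pi / 2 * t) → s = t := by
    intro s t hs ht e
    rw [abs_le] at hs ht
    have := Circle.exp_injOn_Icc (a := -(Real.pi / 2)) (b := Real.pi / 2) (by linarith)
      (x₁ := Real.pi / 2 * s) (x₂ := Real.pi / 2 * t) ⟨by nlinarith, by nlinarith⟩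
      ⟨by nlinarith, by nlinarith⟩ e
    exact mul_left_cancel₀ (by positivity) this
  rw [boxNorm, max_le_iff] at hz hw
  exact Complex.ext (aux _ _ hz.1 hw.1 (congrArg Prod.fst h))
    (aux _ _ hz.2 hw.2 (congrArg Prod.snd h))

/-- With angles measured in units of π/2, the boundary conditions bound both angles by 1 in absolute
value, and belonging to the surface forces at least one of them to have absolute value 1. -/
theorem mem_boundary_iff (x : OneHoledTorus) :
    x ∈ boundary ↔ ∃ z, boxNorm z = 1 ∧ x.1 = boxExp z := by
  have hpi := Real.pi_pos
  constructor
  · rintro ⟨h1, h2⟩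
    set α := Complex.arg (x.1.1 : ℂ)
    set β := Complex.arg (x.1.2 : ℂ)
    have hα : |α| ≤ Real.pi / 2 := Complex.abs_arg_le_pi_div_two_iff.2 h1
    have hβ : |β| ≤ Real.pi / 2 := Complex.abs_arg_le_pi_div_two_iff.2 h2
    have hαβ : Real.pi / 2 ≤ |α| ∨ Real.pi / 2 ≤ |β| := by
      rcases x.2 with h | h
      · refine .inl (not_lt.1 fun hlt => ?_)
        rcases Complex.abs_arg_lt_pi_div_two_iff.1 hlt with h' | h'
        · exact absurd h' (not_lt.2 h)
        · exact Circle.coe_ne_zero _ h'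
      · refine .inr (not_lt.1 fun hlt => ?_)
        rcases Complex.abs_arg_lt_pi_div_two_iff.1 hlt with h' | h'
        · exact absurd h' (not_lt.2 h)
        · exact Circle.coe_ne_zero _ h'
    have hmax : max |α| |β| = Real.pi / 2 := le_antisymm (max_le hα hβ) (le_max_iff.2 hαβ)
    refine ⟨(2 / Real.pi) • ⟨α, β⟩, ?_, ?_⟩
    · rw [boxNorm_smul (by positivity), boxNorm, hmax]
      field_simp
    · refine Prod.ext ?_ ?_
      · rw [boxExp, Complex.smul_re, smul_eq_mul, ← mul_assoc,
          show Real.pi / 2 * (2 / Real.pi) = 1 by field_simp, one_mul]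
        exact (Circle.exp_arg _).symm
      · rw [boxExp, Complex.smul_im, smul_eq_mul, ← mul_assoc,
          show Real.pi / 2 * (2 / Real.pi) = 1 by field_simp, one_mul]
        exact (Circle.exp_arg _).symm
  · rintro ⟨z, hz, hx⟩
    have hle := max_le_iff.1 hz.le
    have aux : ∀ s : ℝ, |s| ≤ 1 → 0 ≤ Real.cos (Real.pi / 2 * s) := by
      intro s hs
      rw [abs_le] at hs
      exact Real.cos_nonneg_of_mem_Icc ⟨by nlinarith, by nlinarith⟩
    constructor
    · rw [hx, boxExp, Circle.re_exp]; exact aux _ hle.1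
    · rw [hx, boxExp, Circle.re_exp]; exact aux _ hle.2

theorem re_boxExp_nonpos {z : ℂ} (hz : boxNorm z = 1) :
    ((boxExp z).1 : ℂ).re ≤ 0 ∨ ((boxExp z).2 : ℂ).re ≤ 0 := by
  have aux : ∀ s : ℝ, |s| = 1 → Real.cos (Real.pi / 2 * s) ≤ 0 := by
    intro s hs
    rcases eq_or_eq_neg_of_abs_eq hs with rfl | rfl <;> simp
  have h : |z.re| = 1 ∨ |z.im| = 1 := by
    rcases max_choice |z.re| |z.im| with h | h
    · exact .inl (h ▸ hz)
    · exact .inr (h ▸ hz)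
  rcases h with h | h
  · left; rw [boxExp, Circle.re_exp]; exact aux _ h
  · right; rw [boxExp, Circle.re_exp]; exact aux _ h

/-- A circle without a point is the radial projection of a slit plane. The factor `-p₀` rotates the
slit plane so that the missing ray is the one through `p₀`. -/
theorem isPreconnected_boundary_diff {p : OneHoledTorus} (hp : p ∈ boundary) :
    IsPreconnected (boundary \ {p}) := by
  obtain ⟨p₀, hp₀, hpe⟩ := (mem_boundary_iff p).1 hp
  have hp₀' : p₀ ≠ 0 := by
    rintro rfl
    simp [boxNorm] at hp₀
  have hne : ∀ u ∈ Complex.slitPlane, -p₀ * u ≠ 0 := fun u hu =>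
    mul_ne_zero (neg_ne_zero.2 hp₀') (Complex.slitPlane_ne_zero hu)
  have hN : ∀ u ∈ Complex.slitPlane, boxNorm ((boxNorm (-p₀ * u))⁻¹ • (-p₀ * u)) = 1 := by
    intro u hu
    have := boxNorm_pos (hne u hu)
    rw [boxNorm_smul (by positivity), inv_mul_cancel₀ this.ne']
  have hpre : IsPreconnected
      ((fun u : ℂ => boxExp ((boxNorm (-p₀ * u))⁻¹ • (-p₀ * u))) '' Complex.slitPlane) := by
    refine IsPreconnected.image ?_ _ ?_
    · exact (Complex.starConvex_one_slitPlane.isPathConnected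
        Complex.one_mem_slitPlane).isConnected.isPreconnected
    · have h1 : ContinuousOn (fun u => (boxNorm (-p₀ * u))⁻¹) Complex.slitPlane :=
        ContinuousOn.inv₀ (continuous_boxNorm.comp (by fun_prop)).continuousOn
          fun u hu => (boxNorm_pos (hne u hu)).ne'
      have h2 : ContinuousOn (fun u => -p₀ * u) Complex.slitPlane := by fun_prop
      exact continuous_boxExp.comp_continuousOn (h1.smul h2)
  have hind : IsInducing (fun x : OneHoledTorus => x.1) := IsInducing.subtypeVal
  rw [← hind.isPreconnected_image]
  convert hpre using 1
  ext y
  constructor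
  · rintro ⟨x, ⟨hx, hxp⟩, rfl⟩
    obtain ⟨q, hq, hxq⟩ := (mem_boundary_iff x).1 hx
    have hcanc : -p₀ * (-q / p₀) = q := by field_simp
    refine ⟨-q / p₀, ?_, ?_⟩
    · rw [Complex.mem_slitPlane_iff_not_le_zero]
      intro hle
      obtain ⟨r, hr, hr'⟩ : ∃ r : ℝ, 0 ≤ r ∧ -q / p₀ = -(r : ℂ) := by
        rw [Complex.le_def] at hle
        refine ⟨-(-q / p₀).re, by simpa using hle.1, Complex.ext (by simp) (by simpa using hle.2)⟩
      have hqr : q = r • p₀ := by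
        rw [← hcanc, hr', Complex.real_smul]; ring
      rw [hqr, boxNorm_smul hr, hp₀, mul_one] at hq
      subst hq
      rw [one_smul] at hqr
      exact hxp (Subtype.ext (by rw [hxq, hpe, hqr]))
    · simp only [hcanc, hq, inv_one, one_smul]
      exact hxq.symm
  · rintro ⟨u, hu, rfl⟩
    refine ⟨⟨_, re_boxExp_nonpos (hN u hu)⟩, ⟨(mem_boundary_iff _).2 ⟨_, hN u hu, rfl⟩, ?_⟩, rfl⟩
    intro hcon
    have hcon := congrArg (fun x : OneHoledTorus => x.1) (mem_singleton_iff.1 hcon)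
    simp only [hpe] at hcon
    have h := boxExp_injective (hN u hu).le hp₀.le hcon
    have hr := boxNorm_pos (hne u hu)
    set r := boxNorm (-p₀ * u)
    have hu' : u = ((-r : ℝ) : ℂ) := by
      rw [Complex.real_smul] at h
      have hr0 : (r : ℂ) ≠ 0 := by exact_mod_cast hr.ne'
      push_cast at h ⊢
      field_simp at h
      linear_combination -h
    rw [hu', Complex.ofReal_mem_slitPlane] at hu
    linarith

theorem exists_ne_mem_boundary (p : OneHoledTorus) : ∃ q ∈ boundary, q ≠ p := by
  have h1 : boxNorm 1 = 1 := by simp [boxNorm]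
  have h2 : boxNorm Complex.I = 1 := by simp [boxNorm]
  let q₁ : OneHoledTorus := ⟨_, re_boxExp_nonpos h1⟩
  let q₂ : OneHoledTorus := ⟨_, re_boxExp_nonpos h2⟩
  by_cases h : q₁ = p
  · refine ⟨q₂, (mem_boundary_iff _).2 ⟨_, h2, rfl⟩, fun h' => ?_⟩
    have := boxExp_injective h1.le h2.le (congrArg (fun x : OneHoledTorus => x.1) (h.trans h'.symm))
    simpa using congrArg Complex.re this
  · exact ⟨q₁, (mem_boundary_iff _).2 ⟨_, h1, rfl⟩, h⟩

end OneHoledTorus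

/-! ### The boundary of the surface is a single side -/

namespace DilationStructure

variable {X : Type*} [TopologicalSpace X] {D : DilationStructure X}

/-- What is used of the topology of a torus with one boundary component and of a dilation structure
with one singularity on it. -/
structure IsTorusWithBoundarySingularity (D : DilationStructure X) (s : X) : Prop where
  t2 : T2Space X
  mem_bdry : s ∈ D.bdry
  sing_eq : D.sing = {s}
  isPreconnected : IsPreconnected (D.bdry \ {s})
  exists_ne : ∃ x ∈ D.bdry, x ≠ s
  exists_relation : ∀ h : Fin 3 → C(X, AddCircle (1 : ℝ)), ∃ k : Fin 3 → ℤ, k ≠ 0 ∧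
    ∃ g : C(X, ℝ), ∀ x, (g x : AddCircle (1 : ℝ)) = ∑ i, k i • h i x

theorem InD111.exists_isTorus (h : D.InD111) : ∃ s, D.IsTorusWithBoundarySingularity s := by
  obtain ⟨e, he⟩ := h.torus
  obtain ⟨s, hs, hsing⟩ := h.one_singularity
  have hb : D.bdry \ {s} = e.symm '' (OneHoledTorus.boundary \ {e s}) := by
    ext x
    constructor
    · rintro ⟨hx, hxs⟩
      exact ⟨e x, ⟨(he x).1 hx, fun h => hxs (e.injective h)⟩, by simp⟩
    · rintro ⟨y, ⟨hy, hys⟩, rfl⟩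
      refine ⟨(he _).2 (by simpa using hy), ?_⟩
      rintro rfl
      simp at hys
  refine ⟨s, e.isEmbedding.t2Space, hs, hsing, ?_, ?_, ?_⟩
  · rw [hb]
    exact (OneHoledTorus.isPreconnected_boundary_diff ((he s).1 hs)).image _
      e.symm.continuous.continuousOn
  · obtain ⟨q, hq, hne⟩ := OneHoledTorus.exists_ne_mem_boundary (e s)
    refine ⟨e.symm q, (he _).2 (by simpa using hq), ?_⟩
    rintro rfl
    simp at hne
  · intro h
    obtain ⟨k, hk, g, hg⟩ := OneHoledTorus.exists_relation
      fun i => (h i).comp ⟨e.symm, e.symm.continuous⟩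
    refine ⟨k, hk, g.comp ⟨e, e.continuous⟩, fun x => ?_⟩
    simpa using hg (e x)

variable {ι : Type} {n : ι → ℕ} {face : ∀ j, PlanarPolygon (n j)} {map : ι → ℂ → X}

namespace IsDecomposition

/-- A point of the open side off the boundary also lies on another side, which then has the same
image. So that other side passes through `x` too, which is impossible on the boundary. -/
theorem openSide_subset_bdry (hT : D.IsDecomposition face map) [T2Space X] [Finite ι] {j : ι}
    {i : ZMod (n j)} {x : X} (hx : x ∈ map j '' (face j).openSide i) (hb : x ∈ D.bdry) :
    map j '' (face j).openSide i ⊆ D.bdry := by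
  rintro _ ⟨z', hz', rfl⟩
  by_contra hb'
  obtain ⟨j', i', hne, hmem⟩ := hT.exists_other_side hz' hb'
  obtain ⟨z, hz, rfl⟩ := hx
  refine hT.notMem_other_side hne hz hb ?_
  rcases hT.side_match j i j' i' with h | h
  · rw [← h]; exact mem_image_of_mem _ hz
  · exact (Set.disjoint_left.1 h (mem_image_of_mem _ hz') hmem).elim

theorem map_vert (hT : D.IsDecomposition face map) {s : X} (hs : D.sing = {s}) (j : ι)
    (i : ZMod (n j)) : map j ((face j).vert i) = s := by
  have := ((hT.isPolygonMap j).sing_iff _ ((face j).vert_mem_region i)).2 ⟨i, rfl⟩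
  rw [hs] at this
  exact this

theorem mem_openSide_of_mem_side (hT : D.IsDecomposition face map) {s : X} (hs : D.sing = {s})
    {j : ι} {i : ZMod (n j)} {x : X} (hx : x ∈ map j '' (face j).side i) (hxs : x ≠ s) :
    x ∈ map j '' (face j).openSide i := by
  obtain ⟨z, hz, rfl⟩ := hx
  rw [PlanarPolygon.side_eq] at hz
  rcases hz with rfl | rfl | hz
  · exact (hxs (hT.map_vert hs _ _)).elim
  · exact (hxs (hT.map_vert hs _ _)).elim
  · exact mem_image_of_mem _ hz

/-- The boundary is the image of a single side. -/
theorem exists_boundary_side (hT : D.IsDecomposition face map) [Finite ι] {s : X}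
    (hD : D.IsTorusWithBoundarySingularity s) :
    ∃ (j : ι) (i : ZMod (n j)), map j '' (face j).side i = D.bdry ∧
      map j '' (face j).openSide i ⊆ D.bdry ∧
      ∀ (j' : ι) (i' : ZMod (n j')), (⟨j', i'⟩ : Σ j, ZMod (n j)) ≠ ⟨j, i⟩ →
        Disjoint (map j' '' (face j').openSide i') D.bdry := by
  have := hD.t2
  have hcl : ∀ j i, IsClosed (map j '' (face j).side i) := by
    intro j i
    have hc : IsCompact ((face j).side i) := by
      rw [PlanarPolygon.side, segment_eq_image]
      exact isCompact_Icc.image (by fun_prop)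
    exact (hc.image_of_continuousOn ((hT.isPolygonMap j).continuousOn.mono
      ((face j).side_subset_region i))).isClosed
  have hcov : ∀ x ∈ D.bdry, x ≠ s → ∃ h : Σ j, ZMod (n j),
      x ∈ map h.1 '' (face h.1).openSide h.2 := by
    intro x hx hxs
    have := hT.bdry_subset hx
    simp only [mem_iUnion] at this
    obtain ⟨j, i, hji⟩ := this
    exact ⟨⟨j, i⟩, hT.mem_openSide_of_mem_side hD.sing_eq hji hxs⟩
  have : Finite (Σ j, ZMod (n j)) := by
    have : ∀ j, Finite (ZMod (n j)) := fun j => by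
      have := (face j).neZero
      infer_instance
    infer_instance
  obtain ⟨x, hx, hxs⟩ := hD.exists_ne
  obtain ⟨⟨j, i⟩, hji⟩ := hcov x hx hxs
  have huniq : ∀ (j' : ι) (i' : ZMod (n j')), (⟨j', i'⟩ : Σ j, ZMod (n j)) ≠ ⟨j, i⟩ →
        Disjoint (map j' '' (face j').openSide i') D.bdry := by
    intro j' i' hne
    rw [Set.disjoint_left]
    intro y hy hyb
    have hys : y ≠ s := by
      rintro rfl
      obtain ⟨z, hz, rfl⟩ := hy
      exact (hT.isPolygonMap j').map_notMem_sing hz (by rw [hD.sing_eq]; rfl)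
    -- The boundary without its singularity is connected and covered by finitely many closed sides.
    -- If two sides were needed, a point other than `s` would be on both, hence on two open sides,
    -- which a boundary point cannot be.
    have hpre := isPreconnected_closed_iff.1 hD.isPreconnected (map j '' (face j).side i)
      (⋃ h ∈ {h : Σ j, ZMod (n j) | h ≠ ⟨j, i⟩}, map h.1 '' (face h.1).side h.2) (hcl j i)
      ((Set.toFinite _).isClosed_biUnion fun h _ => hcl h.1 h.2) (by
        rintro w ⟨hw, hws⟩
        obtain ⟨h, hh⟩ := hcov w hw hws
        by_cases e : h = ⟨j, i⟩
        · subst e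
          exact .inl (image_mono ((face j).openSide_subset_side i) hh)
        · exact .inr (mem_biUnion (show h ∈ {h : Σ j, ZMod (n j) | h ≠ ⟨j, i⟩} from e)
            (image_mono ((face h.1).openSide_subset_side h.2) hh)))
      ⟨x, ⟨hx, hxs⟩, image_mono ((face j).openSide_subset_side i) hji⟩
      ⟨y, ⟨hyb, hys⟩, mem_biUnion (show (⟨j', i'⟩ : Σ j, ZMod (n j)) ∈
        {h : Σ j, ZMod (n j) | h ≠ ⟨j, i⟩} from hne)
        (image_mono ((face j').openSide_subset_side i') hy)⟩
    obtain ⟨w, ⟨hwb, hws⟩, hw1, hw2⟩ := hpre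
    simp only [mem_iUnion] at hw2
    obtain ⟨h, hh, hw2⟩ := hw2
    have hw1 := hT.mem_openSide_of_mem_side hD.sing_eq hw1 hws
    have hw2 := hT.mem_openSide_of_mem_side hD.sing_eq hw2 hws
    obtain ⟨z, hz, rfl⟩ := hw1
    exact hT.notMem_other_side (Ne.symm hh) hz hwb hw2
  refine ⟨j, i, Subset.antisymm ?_ ?_, hT.openSide_subset_bdry hji hx, huniq⟩
  · intro y hy
    by_cases hys : y = s
    · rw [hys]; exact hD.mem_bdry
    · exact hT.openSide_subset_bdry hji hx (hT.mem_openSide_of_mem_side hD.sing_eq hy hys)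
  · intro y hy
    by_cases hys : y = s
    · exact ⟨_, left_mem_segment ℝ _ _, (hT.map_vert hD.sing_eq j i).trans hys.symm⟩
    · obtain ⟨h, hh⟩ := hcov y hy hys
      by_cases e : h = ⟨j, i⟩
      · subst e
        exact image_mono ((face j).openSide_subset_side i) hh
      · exact (Set.disjoint_left.1 (huniq h.1 h.2 e) hh hy).elim

end IsDecomposition

end DilationStructure

/-! ### Cocycles on the sides and their circle-valued maps -/

/-- The potential is the partial sum from 0; the condition on the total sum is what closes it up at
the last index. -/
theorem ZMod.exists_potential {n : ℕ} [NeZero n] (w : ZMod n → ℤ) (hw : ∑ i, w i = 0) :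
    ∃ u : ZMod n → ℤ, ∀ i, u (i + 1) = u i + w i := by
  refine ⟨fun i => ∑ m ∈ Finset.range i.val, w (m : ZMod n), fun i => ?_⟩
  have hi : w i = w ((i.val : ℕ) : ZMod n) := by rw [ZMod.natCast_rightInverse i]
  rw [hi, ← Finset.sum_range_succ]
  by_cases h : i.val + 1 < n
  · have h1 : i + 1 = ((i.val + 1 : ℕ) : ZMod n) := by
      rw [Nat.cast_add, ZMod.natCast_rightInverse i, Nat.cast_one]
    have h2 : (i + 1).val = i.val + 1 := by rw [h1, ZMod.val_cast_of_lt h]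
    simp only [h2]
  · have h1 : i.val + 1 = n := by have := ZMod.val_lt i; omega
    have h2 : i + 1 = 0 := by
      rw [← ZMod.natCast_rightInverse i]
      have : ((i.val + 1 : ℕ) : ZMod n) = 0 := by rw [h1]; exact ZMod.natCast_self n
      exact_mod_cast this
    simp only [h2]
    rw [ZMod.val_zero, Finset.sum_range_zero, h1, ← hw]
    obtain ⟨k, rfl⟩ : ∃ k, n = k + 1 := ⟨i.val, h1.symm⟩
    rw [← Fin.sum_univ_eq_sum_range (fun m => w (m : ZMod (k + 1)))]
    refine Finset.sum_congr rfl fun x _ => ?_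
    congr 1
    exact (ZMod.natCast_rightInverse (n := k + 1) x).symm

/-- A continuous function on the plane which is affine on the sides of a polygon, with given values
at the vertices. -/
theorem PlanarPolygon.exists_function {n : ℕ} (P : PlanarPolygon n) (u : ZMod n → ℝ) :
    ∃ φ : C(ℂ, ℝ), ∀ i, ∀ t ∈ Icc (0 : ℝ) 1,
      φ ((1 - t) • P.vert i + t • P.vert (i + 1)) = (1 - t) * u i + t * u (i + 1) := by
  have := P.neZero
  -- On side `i` the distance to its first endpoint is proportional to the parameter, so this
  -- interpolates the values at the endpoints by a function that is continuous on the whole plane.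
  let val : ZMod n → ℂ → ℝ := fun i z =>
    u i + (u (i + 1) - u i) * (‖z - P.vert i‖ / ‖P.vert (i + 1) - P.vert i‖)
  have hval : ∀ i, ∀ t ∈ Icc (0 : ℝ) 1,
      val i ((1 - t) • P.vert i + t • P.vert (i + 1)) = (1 - t) * u i + t * u (i + 1) := by
    intro i t ht
    have e : (1 - t) • P.vert i + t • P.vert (i + 1) - P.vert i =
        t • (P.vert (i + 1) - P.vert i) := by
      simp only [Complex.real_smul]; push_cast; ring
    have hne : ‖P.vert (i + 1) - P.vert i‖ ≠ 0 :=
      norm_ne_zero_iff.2 (sub_ne_zero.2 (P.vert_ne_succ i).symm)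
    simp only [val, e, norm_smul, Real.norm_eq_abs, abs_of_nonneg ht.1]
    field_simp
    ring
  have hvert : ∀ i k, P.vert k ∈ P.side i → val i (P.vert k) = u k := by
    intro i k hk
    rw [P.side_eq] at hk
    rcases hk with hk | hk | hk
    · obtain rfl := P.vert_injective hk
      simp [val]
    · obtain rfl := P.vert_injective hk
      have hne : ‖P.vert (i + 1) - P.vert i‖ ≠ 0 :=
        norm_ne_zero_iff.2 (sub_ne_zero.2 (P.vert_ne_succ i).symm)
      simp only [val]
      rw [div_self hne]; ring
    · exact (P.vert_notMem i k hk).elim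
  have hcons : ∀ i i' z, z ∈ P.side i → z ∈ P.side i' → val i z = val i' z := by
    intro i i' z hz hz'
    by_cases hk : z ∈ range P.vert
    · obtain ⟨k, rfl⟩ := hk
      rw [hvert i k hz, hvert i' k hz']
    · have aux : ∀ i, z ∈ P.side i → z ∈ P.openSide i := by
        intro i hi
        rw [P.side_eq] at hi
        rcases hi with rfl | rfl | h
        · exact (hk ⟨_, rfl⟩).elim
        · exact (hk ⟨_, rfl⟩).elim
        · exact h
      rw [P.eq_of_mem_openSide (aux i hz) (aux i' hz')]
  classical
  let ψ : ℂ → ℝ := fun z => if h : ∃ i, z ∈ P.side i then val h.choose z else 0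
  have hψ : ∀ i, ∀ z ∈ P.side i, ψ z = val i z := by
    intro i z hz
    have h : ∃ i, z ∈ P.side i := ⟨i, hz⟩
    simp only [ψ, h, ↓reduceDIte]
    exact hcons _ _ _ h.choose_spec hz
  have hcl : ∀ i, IsClosed (P.side i) := by
    intro i
    have : IsCompact (P.side i) := by
      rw [side, segment_eq_image]
      exact isCompact_Icc.image (by fun_prop)
    exact this.isClosed
  have hcont : ContinuousOn ψ (⋃ i, P.side i) := by
    refine (locallyFinite_of_finite _).continuousOn_iUnion hcl fun i => ?_
    have hv : Continuous (val i) := by simp only [val]; fun_prop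
    exact hv.continuousOn.congr (hψ i)
  -- The Tietze extension theorem, from the closed union of the sides to the plane.
  obtain ⟨φ, hφ⟩ := ContinuousMap.exists_restrict_eq (isClosed_iUnion_of_finite hcl)
    (⟨_, hcont.domRestrict⟩ : C((⋃ i, P.side i : Set ℂ), ℝ))
  refine ⟨φ, fun i t ht => ?_⟩
  have hmem : (1 - t) • P.vert i + t • P.vert (i + 1) ∈ P.side i := by
    rw [side, segment_eq_image]
    exact ⟨t, ht, rfl⟩
  have := congrArg (fun f : C((⋃ i, P.side i : Set ℂ), ℝ) => f ⟨_, mem_iUnion.2 ⟨i, hmem⟩⟩) hφ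
  have h2 : φ ((1 - t) • P.vert i + t • P.vert (i + 1)) =
      ψ ((1 - t) • P.vert i + t • P.vert (i + 1)) := this
  rw [h2, hψ i _ hmem, hval i t ht]

namespace DilationStructure

variable {X : Type*} [TopologicalSpace X] {D : DilationStructure X}
variable {ι : Type} {n : ι → ℕ} {face : ∀ j, PlanarPolygon (n j)} {map : ι → ℂ → X}

/-- The open edge of the surface which is the image of a side. -/
def edge (face : ∀ j, PlanarPolygon (n j)) (map : ι → ℂ → X) (h : Σ j, ZMod (n j)) : Set X :=
  map h.1 '' (face h.1).openSide h.2

/-- The side of a polygon as a vector. -/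
def sideVector (face : ∀ j, PlanarPolygon (n j)) (h : Σ j, ZMod (n j)) : ℂ :=
  (face h.1).vert (h.2 + 1) - (face h.1).vert h.2

theorem sideVector_ne_zero (face : ∀ j, PlanarPolygon (n j)) (h : Σ j, ZMod (n j)) :
    sideVector face h ≠ 0 := sub_ne_zero.2 ((face h.1).vert_ne_succ h.2).symm

open Classical in
/-- The relative direction of two parallel sides. -/
noncomputable def relSign (face : ∀ j, PlanarPolygon (n j)) (h h' : Σ j, ZMod (n j)) : ℤ :=
  if ∃ a : ℝ, 0 < a ∧ sideVector face h' = a • sideVector face h then 1 else -1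

theorem relSign_of_pos {h h' : Σ j, ZMod (n j)} {a : ℝ} (ha : 0 < a)
    (e : sideVector face h' = a • sideVector face h) : relSign face h h' = 1 :=
  if_pos ⟨a, ha, e⟩

theorem relSign_of_neg {h h' : Σ j, ZMod (n j)} {a : ℝ} (ha : 0 < a)
    (e : sideVector face h' = -(a • sideVector face h)) : relSign face h h' = -1 := by
  refine if_neg ?_
  rintro ⟨b, hb, e'⟩
  have : (a + b) • sideVector face h = 0 := by
    rw [add_smul, ← e', e]; simp
  rcases smul_eq_zero.1 this with h1 | h1
  · linarith
  · exact sideVector_ne_zero face h h1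

/-- Integral weights on the sides which agree on identified sides, and with sum zero on polygons. -/
structure IsCocycle (face : ∀ j, PlanarPolygon (n j)) (map : ι → ℂ → X)
    (w : (Σ j, ZMod (n j)) → ℤ) : Prop where
  eq_of_edge_eq : ∀ h h', edge face map h = edge face map h' → w h = relSign face h h' * w h'
  sum_eq_zero : ∀ (j : ι) (s : Finset (ZMod (n j))), (∀ i, i ∈ s) → ∑ i ∈ s, w ⟨j, i⟩ = 0

namespace IsDecomposition

theorem edge_eq_of_mem (hT : D.IsDecomposition face map) {h h' : Σ j, ZMod (n j)} {x : X}
    (hx : x ∈ edge face map h) (hx' : x ∈ edge face map h') :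
    edge face map h = edge face map h' := by
  rcases hT.side_match h.1 h.2 h'.1 h'.2 with e | e
  · exact e
  · exact (Set.disjoint_left.1 e hx hx').elim

/-- The dilation that identifies two sides, with its effect on the endpoints. -/
theorem exists_gluing_endpoints (hT : D.IsDecomposition face map) {h h' : Σ j, ZMod (n j)}
    (he : edge face map h = edge face map h') :
    ∃ g, IsDilation g ∧ g '' (face h.1).openSide h.2 = (face h'.1).openSide h'.2 ∧
      (∀ z ∈ (face h.1).openSide h.2, map h'.1 (g z) = map h.1 z) ∧
      ((g ((face h.1).vert h.2) = (face h'.1).vert h'.2 ∧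
        g ((face h.1).vert (h.2 + 1)) = (face h'.1).vert (h'.2 + 1) ∧ relSign face h h' = 1) ∨
      (g ((face h.1).vert h.2) = (face h'.1).vert (h'.2 + 1) ∧
        g ((face h.1).vert (h.2 + 1)) = (face h'.1).vert h'.2 ∧ relSign face h h' = -1)) := by
  obtain ⟨g, hg, himg, hmap⟩ := hT.exists_gluing he
  refine ⟨g, hg, himg, hmap, ?_⟩
  have hend := PlanarPolygon.gluing_endpoints _ _ hg himg
  obtain ⟨a, ha, b, hgab⟩ := hg
  have hd : g ((face h.1).vert (h.2 + 1)) - g ((face h.1).vert h.2) =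
      a • sideVector face h := by
    rw [hgab, hgab, sideVector, Complex.real_smul]; ring
  rcases hend with ⟨h1, h2⟩ | ⟨h1, h2⟩
  · refine .inl ⟨h1, h2, relSign_of_pos ha ?_⟩
    rw [← hd, h1, h2, sideVector]
  · refine .inr ⟨h1, h2, relSign_of_neg ha ?_⟩
    rw [← hd, h1, h2, sideVector]; ring

/-- The weights around each face have an integral potential at the vertices, extended affinely along
the sides and then continuously. Modulo 1 all the vertices have value 0, and glued sides carry
affine functions with the same increment in corresponding directions, so they differ by an integer.
Hence the functions modulo 1 descend to the surface. -/
theorem exists_circleMap [Finite ι] [T2Space X] (hT : D.IsDecomposition face map)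
    {w : (Σ j, ZMod (n j)) → ℤ} (hw : IsCocycle face map w) :
    ∃ (φ : ι → C(ℂ, ℝ)) (f : C(X, AddCircle (1 : ℝ))),
      (∀ j, ∀ z ∈ (face j).region, f (map j z) = (φ j z : AddCircle (1 : ℝ))) ∧
      ∀ j i, φ j ((face j).vert (i + 1)) - φ j ((face j).vert i) = w ⟨j, i⟩ := by
  have hu : ∀ j, ∃ u : ZMod (n j) → ℤ, ∀ i, u (i + 1) = u i + w ⟨j, i⟩ := by
    intro j
    have := (face j).neZero
    exact ZMod.exists_potential (fun i => w ⟨j, i⟩)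
      (hw.sum_eq_zero j Finset.univ fun i => Finset.mem_univ i)
  choose u hu using hu
  choose φ hφ using fun j => (face j).exists_function fun i => (u j i : ℝ)
  have hvert : ∀ j i, φ j ((face j).vert i) = u j i := by
    intro j i
    simpa using hφ j i 0 ⟨le_rfl, zero_le_one⟩
  let q : (Σ j, (face j).region) → X := fun p => map p.1 p.2
  have hq : Continuous q := continuous_sigma fun j =>
    ((hT.isPolygonMap j).continuousOn).domRestrict
  have hs : Function.Surjective q := by
    intro x
    obtain ⟨j, z, hz, rfl⟩ := hT.surjective x
    exact ⟨⟨j, z, hz⟩, rfl⟩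
  have : ∀ j, CompactSpace (face j).region := fun j =>
    isCompact_iff_compactSpace.1 (face j).isCompact_region
  have hc : Continuous fun p : (Σ j, (face j).region) => (φ p.1 p.2 : AddCircle (1 : ℝ)) :=
    continuous_sigma fun j => (AddCircle.continuous_mk' (1 : ℝ)).comp
      ((φ j).continuous.comp continuous_subtype_val)
  obtain ⟨f, hf⟩ := exists_continuousMap_of_surjective hq hs hc (by
    rintro ⟨j, z, hz⟩ ⟨j', z', hz'⟩ (e : map j z = map j' z')
    show (φ j z : AddCircle (1 : ℝ)) = φ j' z'
    rcases (face j).mem_region_cases hz with hi | hv | ⟨i, hi⟩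
    · obtain ⟨rfl, rfl⟩ := hT.interior_injective j z hi j' z' hz' e
      rfl
    · have hv' : z' ∈ range (face j').vert := by
        rw [← (hT.isPolygonMap j').sing_iff z' hz', ← e, (hT.isPolygonMap j).sing_iff z hz]
        exact hv
      obtain ⟨i, rfl⟩ := hv
      obtain ⟨i', rfl⟩ := hv'
      have aux : ∀ m : ℤ, ((m : ℝ) : AddCircle (1 : ℝ)) = 0 := fun m =>
        AddCircle.coe_eq_zero_iff _ |>.2 ⟨m, by simp⟩
      rw [hvert, hvert, aux, aux]
    · obtain ⟨i', hi'⟩ := hT.exists_openSide hi hz' e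
      have hedge : edge face map ⟨j, i⟩ = edge face map ⟨j', i'⟩ :=
        hT.edge_eq_of_mem (x := map j z) ⟨z, hi, rfl⟩ ⟨z', hi', e.symm⟩
      obtain ⟨g, hg, himg, hmap, hend⟩ := hT.exists_gluing_endpoints hedge
      have hgz : z' = g z := hT.side_injective j' i' hi' (himg ▸ mem_image_of_mem g hi)
        (by rw [hmap z hi, e])
      have hww := hw.eq_of_edge_eq _ _ hedge
      have hi2 := hi
      rw [PlanarPolygon.openSide, openSegment_eq_image] at hi2
      obtain ⟨t, ⟨ht0, ht1⟩, rfl⟩ := hi2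
      simp only [] at hgz
      rw [hg.combo] at hgz
      have e1 := hφ j i t ⟨ht0.le, ht1.le⟩
      have c1 : (u j (i + 1) : ℝ) = u j i + w ⟨j, i⟩ := by exact_mod_cast hu j i
      have c2 : (u j' (i' + 1) : ℝ) = u j' i' + w ⟨j', i'⟩ := by exact_mod_cast hu j' i'
      rcases hend with ⟨h1, h2, h3⟩ | ⟨h1, h2, h3⟩
      · simp only at h1 h2
        rw [h1, h2] at hgz
        have e2 := hφ j' i' t ⟨ht0.le, ht1.le⟩
        rw [h3, one_mul] at hww
        have : φ j ((1 - t) • (face j).vert i + t • (face j).vert (i + 1)) = φ j' z' +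
            ((u j i - u j' i' : ℤ) : ℝ) := by
          rw [e1, hgz, e2, c1, c2, hww]; push_cast; ring
        rw [this, coe_addCircle_add_int]
      · simp only at h1 h2
        rw [h1, h2] at hgz
        -- The gluing reverses the side, so the parameter `t` on one side is `1 - t` on the other.
        have e2 := hφ j' i' (1 - t) ⟨by linarith, by linarith⟩
        rw [sub_sub_cancel, add_comm] at e2
        rw [h3, neg_one_mul] at hww
        have : φ j ((1 - t) • (face j).vert i + t • (face j).vert (i + 1)) = φ j' z' +
            ((u j i - u j' i' - w ⟨j', i'⟩ : ℤ) : ℝ) := by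
          rw [e1, hgz, e2, c1, c2, hww]; push_cast; ring
        rw [this, coe_addCircle_add_int])
  refine ⟨φ, f, fun j z hz => hf ⟨j, z, hz⟩, fun j i => ?_⟩
  rw [hvert, hvert, hu]
  push_cast
  ring

/-- Three integral cocycles on a decomposition of the torus satisfy a linear relation. -/
theorem cocycle_relation [Finite ι] {s : X} (hT : D.IsDecomposition face map)
    (hD : D.IsTorusWithBoundarySingularity s) (w : Fin 3 → (Σ j, ZMod (n j)) → ℤ)
    (hw : ∀ a, IsCocycle face map (w a)) :
    ∃ k : Fin 3 → ℤ, k ≠ 0 ∧ ∑ a, k a • w a = 0 := by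
  have := hD.t2
  choose φ f hf hφ using fun a => hT.exists_circleMap (hw a)
  obtain ⟨k, hk, g, hg⟩ := hD.exists_relation f
  refine ⟨k, hk, funext fun ⟨j, i⟩ => ?_⟩
  have hpre : IsPreconnected (face j).region := by
    simpa using (face j).isPreconnected_region_diff_countable Set.countable_empty
  have key := sub_eq_sub_of_coe_addCircle_eq hpre (f := fun z => ∑ a, (k a : ℝ) * φ a j z)
    (g := fun z => g (map j z))
    (by fun_prop)
    (g.continuous.comp_continuousOn (hT.isPolygonMap j).continuousOn) (by
      intro z hz
      rw [hg]
      simp only [hf _ j z hz]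
      have : ∀ S : Finset (Fin 3), ((∑ a ∈ S, (k a : ℝ) * φ a j z : ℝ) : AddCircle (1 : ℝ)) =
          ∑ a ∈ S, k a • (φ a j z : AddCircle (1 : ℝ)) := by
        intro S
        induction S using Finset.cons_induction with
        | empty => simp
        | cons a S ha ih =>
          simp only [Finset.sum_cons, AddCircle.coe_add, ih]
          rw [← AddCircle.coe_zsmul, zsmul_eq_mul]
      exact this _) ((face j).vert_mem_region (i + 1)) ((face j).vert_mem_region i)
  -- The combination of potentials and the real function `g` differ by a constant on the face. All
  -- vertices go to `s`, so `g` takes equal values at both ends of a side, and the combination of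
  -- the weights of the side vanishes.
  simp only [hT.map_vert hD.sing_eq] at key
  have key2 : ∑ a, (k a : ℝ) * (w a ⟨j, i⟩ : ℝ) = 0 := by
    have : ∑ a, (k a : ℝ) * φ a j ((face j).vert (i + 1)) =
        ∑ a, (k a : ℝ) * φ a j ((face j).vert i) := by linarith
    rw [← sub_eq_zero, ← Finset.sum_sub_distrib] at this
    simp only [← mul_sub, hφ] at this
    exact this
  have key3 : ∑ a, k a * w a ⟨j, i⟩ = 0 := by exact_mod_cast key2
  simpa using key3

end IsDecomposition

end DilationStructure

/-! ### Counting faces and sides -/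

/-- An involution of a finite type with exactly one fixed point comes with a set of representatives
of the other orbits. -/
theorem exists_representatives {H : Type*} [Fintype H] (p : H → H) (hp : ∀ h, p (p h) = h)
    (h₀ : H) (hfix : ∀ h, p h = h ↔ h = h₀) :
    ∃ P : Finset H, Fintype.card H = 2 * P.card + 1 ∧ ∀ h, h ≠ h₀ → h ∈ P ∨ p h ∈ P := by
  classical
  let e := Fintype.equivFin H
  -- After an enumeration, the representative of a pair is its smaller element.
  refine ⟨Finset.univ.filter fun h => e h < e (p h), ?_, fun h hh => ?_⟩
  · have h1 : (Finset.univ.filter fun h => e (p h) < e h).card =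
        (Finset.univ.filter fun h => e h < e (p h)).card := by
      refine Finset.card_bij (fun h _ => p h) (fun h hh => ?_) (fun a _ b _ hab => ?_)
        (fun b hb => ⟨p b, ?_, hp b⟩)
      · simpa [hp] using hh
      · rw [← hp a, hab, hp]
      · simpa [hp] using hb
    have h2 : (Finset.univ : Finset H) = (Finset.univ.filter fun h => e h < e (p h)) ∪
        ((Finset.univ.filter fun h => e (p h) < e h) ∪ {h₀}) := by
      ext h
      simp only [Finset.mem_univ, Finset.mem_union, Finset.mem_filter, true_and,
        Finset.mem_singleton, true_iff]
      rcases lt_trichotomy (e h) (e (p h)) with h' | h' | h'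
      · exact .inl h'
      · exact .inr (.inr ((hfix h).1 (e.injective h').symm))
      · exact .inr (.inl h')
    have h3 := congrArg Finset.card h2
    rw [Finset.card_union_of_disjoint, Finset.card_union_of_disjoint, h1,
      Finset.card_singleton, Finset.card_univ] at h3
    · omega
    · simp [(hfix h₀).2 rfl]
    · rw [Finset.disjoint_left]
      intro h hh hh'
      simp only [Finset.mem_filter, Finset.mem_univ, true_and, Finset.mem_union,
        Finset.mem_singleton] at hh hh'
      rcases hh' with h' | rfl
      · exact lt_asymm hh h'
      · rw [(hfix h).2 rfl] at hh
        exact lt_irrefl _ hh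
  · simp only [Finset.mem_filter, Finset.mem_univ, true_and, hp]
    refine lt_or_gt_of_ne fun h' => hh ((hfix h).1 (e.injective h').symm)

namespace DilationStructure

variable {X : Type*} [TopologicalSpace X] {D : DilationStructure X}
variable {ι : Type} {n : ι → ℕ} {face : ∀ j, PlanarPolygon (n j)} {map : ι → ℂ → X}

theorem relSign_self (h : Σ j, ZMod (n j)) : relSign face h h = 1 :=
  relSign_of_pos one_pos (one_smul _ _).symm

theorem relSign_comm (h h' : Σ j, ZMod (n j)) : relSign face h h' = relSign face h' h := by
  unfold relSign
  congr 1
  refine propext ⟨?_, ?_⟩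
  all_goals
    rintro ⟨a, ha, e⟩
    refine ⟨a⁻¹, inv_pos.2 ha, ?_⟩
    rw [e, smul_smul, inv_mul_cancel₀ ha.ne', one_smul]

theorem relSign_mul_self (h h' : Σ j, ZMod (n j)) :
    relSign face h h' * relSign face h h' = 1 := by
  unfold relSign
  split_ifs <;> norm_num

omit [TopologicalSpace X] in
theorem edge_nonempty (h : Σ j, ZMod (n j)) : (edge face map h).Nonempty := by
  refine ⟨map h.1 _, (1 - (1 / 2 : ℝ)) • (face h.1).vert h.2 +
    (1 / 2 : ℝ) • (face h.1).vert (h.2 + 1), ?_, rfl⟩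
  rw [PlanarPolygon.openSide, openSegment_eq_image]
  exact ⟨1 / 2, ⟨by norm_num, by norm_num⟩, rfl⟩

namespace IsDecomposition

/-- Three sides along the same edge would give three half-planes that are pairwise opposite, but the
opposite of the opposite is the half-plane itself. -/
theorem eq_of_edge_eq (hT : D.IsDecomposition face map) {h h₁ h₂ : Σ j, ZMod (n j)}
    (e₁ : edge face map h₁ = edge face map h) (e₂ : edge face map h₂ = edge face map h)
    (hn₁ : h₁ ≠ h) (hn₂ : h₂ ≠ h) : h₁ = h₂ := by
  by_contra hne
  obtain ⟨x, hx⟩ := edge_nonempty (face := face) (map := map) h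
  have hx1 := e₁ ▸ hx
  have hx2 := e₂ ▸ hx
  obtain ⟨z, hz, rfl⟩ := hx
  obtain ⟨z₁, hz₁, hx1⟩ := hx1
  obtain ⟨z₂, hz₂, hx2⟩ := hx2
  obtain ⟨σ, hσ, hℓ⟩ := (face h.1).exists_isHalfPlaneAt hz
  obtain ⟨σ₁, hσ₁, hℓ₁⟩ := (face h₁.1).exists_isHalfPlaneAt hz₁
  obtain ⟨σ₂, hσ₂, hℓ₂⟩ := (face h₂.1).exists_isHalfPlaneAt hz₂
  have n0 := smul_ne_zero hσ (crossForm_ne_zero (sideVector_ne_zero face h))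
  have n1 := smul_ne_zero hσ₁ (crossForm_ne_zero (sideVector_ne_zero face h₁))
  have n2 := smul_ne_zero hσ₂ (crossForm_ne_zero (sideVector_ne_zero face h₂))
  obtain ⟨t, ht, e⟩ := hT.exists_opposite hn₁.symm hz hz₁ hx1.symm hℓ hℓ₁ n0 n1
  obtain ⟨t', ht', e'⟩ := hT.exists_opposite hn₂.symm hz hz₂ hx2.symm hℓ hℓ₂ n0 n2
  obtain ⟨t'', ht'', e''⟩ := hT.exists_opposite hne hz₁ hz₂ (hx1.trans hx2.symm) hℓ₁ hℓ₂ n1 n2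
  rw [e', e''] at e
  replace e : -t' • σ₂ • crossForm (sideVector face h₂) =
    -t • -t'' • σ₂ • crossForm (sideVector face h₂) := e
  refine n2 (LinearMap.ext fun w => ?_)
  have h0 := LinearMap.congr_fun e w
  simp only [LinearMap.smul_apply, smul_eq_mul, LinearMap.zero_apply] at h0 ⊢
  have h1 : (t' + t * t'') * (σ₂ * crossForm (sideVector face h₂) w) = 0 := by linear_combination -h0
  exact (mul_eq_zero.1 h1).resolve_left (by positivity)

/-- A side is the boundary of the surface, or it is identified with exactly one other side. -/
theorem exists_partner [Finite ι] {s : X} (hT : D.IsDecomposition face map)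
    (hD : D.IsTorusWithBoundarySingularity s) :
    ∃ (h₀ : Σ j, ZMod (n j)) (p : (Σ j, ZMod (n j)) → (Σ j, ZMod (n j))),
      map h₀.1 '' (face h₀.1).side h₀.2 = D.bdry ∧ (∀ h, p (p h) = h) ∧
      (∀ h, p h = h ↔ h = h₀) ∧ (∀ h, edge face map (p h) = edge face map h) ∧
      ∀ h h', edge face map h' = edge face map h → h' = h ∨ h' = p h := by
  classical
  have := hD.t2
  obtain ⟨j₀, i₀, hb, hsub, hdisj⟩ := hT.exists_boundary_side hD
  have hex : ∀ h : Σ j, ZMod (n j), h ≠ ⟨j₀, i₀⟩ → ∃ h', h' ≠ h ∧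
      edge face map h' = edge face map h := by
    intro h hh
    obtain ⟨x, hx⟩ := edge_nonempty (face := face) (map := map) h
    have hx0 := hx
    obtain ⟨z, hz, rfl⟩ := hx
    obtain ⟨j', i', hne, hmem⟩ := hT.exists_other_side hz
      (Set.disjoint_left.1 (hdisj h.1 h.2 hh) hx0)
    exact ⟨⟨j', i'⟩, hne.symm, (hT.edge_eq_of_mem (h' := ⟨j', i'⟩) hx0 hmem).symm⟩
  choose! q hq using hex
  have hne0 : ∀ h, h ≠ (⟨j₀, i₀⟩ : Σ j, ZMod (n j)) →
      edge face map h ≠ edge face map ⟨j₀, i₀⟩ := by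
    intro h hh e
    obtain ⟨x, hx⟩ := edge_nonempty (face := face) (map := map) h
    have hx' : x ∈ edge face map ⟨j₀, i₀⟩ := e ▸ hx
    exact Set.disjoint_left.1 (hdisj h.1 h.2 hh) hx (hsub hx')
  have hq0 : ∀ h, h ≠ ⟨j₀, i₀⟩ → q h ≠ ⟨j₀, i₀⟩ := fun h hh e =>
    hne0 h hh (by rw [← e]; exact (hq h hh).2.symm)
  have hmain : ∀ h h', edge face map h' = edge face map h → h' = h ∨
      h' = if h = ⟨j₀, i₀⟩ then h else q h := by
    intro h h' e
    by_cases hh : h' = h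
    · exact .inl hh
    · right
      by_cases h0 : h = ⟨j₀, i₀⟩
      · subst h0
        exact (hne0 h' hh e).elim
      · rw [if_neg h0]
        exact hT.eq_of_edge_eq e (hq h h0).2 hh (hq h h0).1
  refine ⟨⟨j₀, i₀⟩, fun h => if h = ⟨j₀, i₀⟩ then h else q h, hb, fun h => ?_, fun h => ?_,
    fun h => ?_, hmain⟩
  · by_cases h0 : h = ⟨j₀, i₀⟩
    · simp [h0]
    · simp only [if_neg h0, if_neg (hq0 h h0)]
      by_contra hne
      exact hne (hT.eq_of_edge_eq (hq _ (hq0 h h0)).2 (hq h h0).2.symm (hq _ (hq0 h h0)).1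
        (hq h h0).1.symm)
  · by_cases h0 : h = ⟨j₀, i₀⟩
    · simp [h0]
    · simp [h0, (hq h h0).1]
  · by_cases h0 : h = ⟨j₀, i₀⟩
    · simp [h0]
    · simp only [if_neg h0]
      exact (hq h h0).2

/-- The count of sides and faces that comes from the Euler characteristic of the torus. -/
theorem sum_numSides_le [Fintype ι] {s : X} (hT : D.IsDecomposition face map)
    (hD : D.IsTorusWithBoundarySingularity s) : ∑ j, n j ≤ 3 + 2 * Fintype.card ι := by
  classical
  have hz : ∀ j, NeZero (n j) := fun j => (face j).neZero
  obtain ⟨h₀, p, -, hpp, hfix, hedge, huniq⟩ := hT.exists_partner hD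
  obtain ⟨P, hcard, hP⟩ := exists_representatives p hpp h₀ hfix
  have hH : Fintype.card (Σ j, ZMod (n j)) = ∑ j, n j := by
    rw [Fintype.card_sigma]
    exact Finset.sum_congr rfl fun j _ => ZMod.card (n j)
  -- One equation for each glued pair and one for each face; their common solutions are cocycles, so
  -- the kernel has rank at most 2. With 2P + 1 unknowns this gives 2P + 1 ≤ P + F + 2.
  let L : ((Σ j, ZMod (n j)) → ℤ) →ₗ[ℤ] (P → ℤ) × (ι → ℤ) :=
    { toFun := fun w => (fun h => w h - relSign face h.1 (p h) * w (p h), fun j => ∑ i, w ⟨j, i⟩)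
      map_add' := fun w w' => by
        refine Prod.ext (funext fun h => ?_) (funext fun j => ?_)
        · simp only [Pi.add_apply, Prod.fst_add]; ring
        · simp only [Pi.add_apply, Prod.snd_add, Finset.sum_add_distrib]
      map_smul' := fun c w => by
        refine Prod.ext (funext fun h => ?_) (funext fun j => ?_)
        · simp only [Pi.smul_apply, Prod.smul_fst, smul_eq_mul, RingHom.id_apply]; ring
        · simp only [Pi.smul_apply, Prod.smul_snd, smul_eq_mul, RingHom.id_apply,
            Finset.mul_sum] }
  have hker : ∀ w, L w = 0 → IsCocycle face map w := by
    intro w hw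
    have h1 : ∀ h ∈ P, w h = relSign face h (p h) * w (p h) := by
      intro h hh
      have := congrFun (congrArg Prod.fst hw) ⟨h, hh⟩
      exact sub_eq_zero.1 this
    refine ⟨fun h h' e => ?_, fun j S hS => ?_⟩
    · rcases huniq h h' e.symm with rfl | rfl
      · rw [relSign_self, one_mul]
      · by_cases h0 : h = h₀
        · rw [(hfix h).2 h0, relSign_self, one_mul]
        · rcases hP h h0 with hm | hm
          · exact h1 h hm
          · have := h1 _ hm
            rw [hpp] at this
            rw [this, relSign_comm (p h) h, ← mul_assoc, relSign_mul_self, one_mul]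
    · have := congrFun (congrArg Prod.snd hw) j
      have hS' : S = Finset.univ := Finset.eq_univ_iff_forall.2 hS
      rw [hS']
      exact this
  have hk : Module.finrank ℤ (LinearMap.ker L) ≤ 2 := by
    by_contra! hlt
    obtain ⟨f, hf⟩ := exists_linearIndependent_of_le_finrank (R := ℤ) (n := 3) hlt
    obtain ⟨k, hk, hrel⟩ := hT.cocycle_relation hD (fun a => (f a : _ → ℤ))
      fun a => hker _ (LinearMap.mem_ker.1 (f a).2)
    refine hk (funext (Fintype.linearIndependent_iff.1 hf k ?_))
    apply Subtype.ext
    simpa using hrel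
  have h1 := Submodule.finrank_quotient_add_finrank (LinearMap.ker L)
  have h2 : Module.finrank ℤ (((Σ j, ZMod (n j)) → ℤ) ⧸ LinearMap.ker L) ≤
      P.card + Fintype.card ι := by
    rw [L.quotKerEquivRange.finrank_eq]
    refine (Submodule.finrank_le _).trans ?_
    simp
  rw [Module.finrank_fintype_fun_eq_card, hcard] at h1
  rw [← hH, hcard]
  omega

/-- The F - 1 other faces have at least three sides each, which leaves at most 6 - F sides for this
one. -/
theorem numSides_le [Fintype ι] {s : X} (hT : D.IsDecomposition face map)
    (hD : D.IsTorusWithBoundarySingularity s) (j : ι) : n j ≤ 5 := by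
  classical
  have h := hT.sum_numSides_le hD
  have h1 : ∑ k ∈ Finset.univ.erase j, 3 ≤ ∑ k ∈ Finset.univ.erase j, n k :=
    Finset.sum_le_sum fun k _ => (face k).three_le
  rw [Finset.sum_const, Finset.card_erase_of_mem (Finset.mem_univ j), Finset.card_univ,
    smul_eq_mul] at h1
  have h2 := Finset.add_sum_erase Finset.univ n (Finset.mem_univ j)
  have h3 : 0 < Fintype.card ι := Fintype.card_pos_iff.2 ⟨j⟩
  omega

end IsDecomposition

end DilationStructure

/-! ### Fan triangulations of polygons with at most five sides: sign patterns -/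

theorem sign_orient_of_mem_openSegment {a m c : ℂ} (h : m ∈ openSegment ℝ a c) (x : ℂ) :
    SignType.sign (orient a m x) = SignType.sign (orient a c x) ∧
      SignType.sign (orient m c x) = SignType.sign (orient a c x) := by
  rw [openSegment_eq_image] at h
  obtain ⟨t, ⟨h0, h1⟩, rfl⟩ := h
  have e1 : orient a ((1 - t) • a + t • c) x = t * orient a c x := by
    simp only [orient, Complex.sub_re, Complex.sub_im, Complex.add_re, Complex.add_im,
      Complex.real_smul, Complex.mul_re, Complex.mul_im, Complex.ofReal_re, Complex.ofReal_im]
    ring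
  have e2 : orient ((1 - t) • a + t • c) c x = (1 - t) * orient a c x := by
    simp only [orient, Complex.sub_re, Complex.sub_im, Complex.add_re, Complex.add_im,
      Complex.real_smul, Complex.mul_re, Complex.mul_im, Complex.ofReal_re, Complex.ofReal_im]
    ring
  rw [e1, e2, sign_mul, sign_mul, sign_pos h0, sign_pos (sub_pos.2 h1), one_mul]
  exact ⟨rfl, rfl⟩

/-- Each segment has its ends strictly on opposite sides of the line of the other. The crossing
point divides a segment in the ratio of the signed areas at its ends, which gives the parameters `p
/ (p - q)`. -/
theorem not_disjoint_openSegment {a b c d : ℂ} (h₁ : orient a b c * orient a b d < 0)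
    (h₂ : orient c d a * orient c d b < 0) :
    ¬Disjoint (openSegment ℝ a b) (openSegment ℝ c d) := by
  have key : ∀ p q : ℝ, p * q < 0 → 0 < p / (p - q) ∧ p / (p - q) < 1 := by
    intro p q h
    rcases mul_neg_iff.1 h with ⟨hp, hq⟩ | ⟨hp, hq⟩
    · have : 0 < p - q := by linarith
      exact ⟨div_pos hp this, (div_lt_one this).2 (by linarith)⟩
    · have : p - q < 0 := by linarith
      exact ⟨div_pos_of_neg_of_neg hp this, (div_lt_one_of_neg this).2 (by linarith)⟩
  have hne1 : orient a b c - orient a b d ≠ 0 := fun h => by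
    rw [sub_eq_zero.1 h] at h₁; nlinarith [mul_self_nonneg (orient a b d)]
  have hne2 : orient c d a - orient c d b ≠ 0 := fun h => by
    rw [sub_eq_zero.1 h] at h₂; nlinarith [mul_self_nonneg (orient c d b)]
  rw [Set.not_disjoint_iff]
  refine ⟨(1 - orient c d a / (orient c d a - orient c d b)) • a +
    (orient c d a / (orient c d a - orient c d b)) • b, ?_, ?_⟩
  · rw [openSegment_eq_image]
    exact ⟨_, key _ _ h₂, rfl⟩
  · rw [openSegment_eq_image]
    refine ⟨_, key _ _ h₁, ?_⟩
    apply Complex.ext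
    all_goals
      simp only [Complex.add_re, Complex.add_im, Complex.real_smul, Complex.mul_re,
        Complex.mul_im, Complex.ofReal_re, Complex.ofReal_im]
      field_simp
      simp only [orient, Complex.sub_re, Complex.sub_im]
      ring

/-- The Plücker relation between the four vectors from `a` in the plane. It is the constraint on the
signs of five points that does not come from simplicity of the polygon. -/
theorem orient_grassmann (a b c d e : ℂ) : orient a b c * orient a d e +
    -(orient a b d * orient a c e) + orient a b e * orient a c d = 0 := by
  simp only [orient, Complex.sub_re, Complex.sub_im]
  ring

/-- The sign condition for three numbers whose sum is zero. -/
def SignType.Balanced (a b c : SignType) : Prop :=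
  (a = 1 ∨ b = 1 ∨ c = 1) ↔ (a = -1 ∨ b = -1 ∨ c = -1)

instance (a b c : SignType) : Decidable (SignType.Balanced a b c) :=
  inferInstanceAs (Decidable (_ ↔ _))

theorem SignType.balanced_sign {a b c : ℝ} (h : a + b + c = 0) :
    SignType.Balanced (SignType.sign a) (SignType.sign b) (SignType.sign c) := by
  simp only [SignType.Balanced, sign_eq_one_iff, sign_eq_neg_one_iff]
  constructor
  · intro h'
    by_contra! hh
    rcases h' with h' | h' | h' <;> linarith
  · intro h'
    by_contra! hh
    rcases h' with h' | h' | h' <;> linarith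

namespace PlanarPolygon

variable {n : ℕ} (P : PlanarPolygon n)

/-- A vertex on the line of side `i` cannot be inside this side, so it is beyond one of the two
endpoints. -/
theorem mem_openSegment_of_orient_eq_zero {i k : ZMod n} (hi : k ≠ i) (hi' : k ≠ i + 1)
    (h : orient (P.vert i) (P.vert (i + 1)) (P.vert k) = 0) :
    P.vert i ∈ openSegment ℝ (P.vert (i + 1)) (P.vert k) ∨
      P.vert (i + 1) ∈ openSegment ℝ (P.vert i) (P.vert k) := by
  obtain ⟨t, ht⟩ := (orient_eq_zero_iff (P.vert_ne_succ i)).1 h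
  have h0 : t ≠ 0 := by
    rintro rfl
    exact hi (P.vert_injective (by simpa using ht))
  have h1 : t ≠ 1 := by
    rintro rfl
    exact hi' (P.vert_injective (by simpa using ht))
  rcases lt_or_gt_of_ne h0 with hneg | hpos
  · left
    refine ⟨-t / (1 - t), 1 / (1 - t), ?_, ?_, ?_, ?_⟩
    · exact div_pos (by linarith) (by linarith)
    · exact div_pos (by linarith) (by linarith)
    · field_simp [show 1 - t ≠ 0 by linarith]
      ring
    · have hne : 1 - t ≠ 0 := by linarith
      rw [ht, smul_add, smul_smul, smul_smul, div_mul_cancel₀ _ hne, one_smul, add_left_comm,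
        ← add_smul, div_mul_eq_mul_div, one_mul, ← add_div, neg_add_cancel, zero_div, zero_smul,
        add_zero]
  · rcases lt_or_gt_of_ne h1 with hlt | hgt
    · refine (P.vert_notMem i k ?_).elim
      rw [openSegment_eq_image]
      exact ⟨t, ⟨hpos, hlt⟩, ht.symm⟩
    · right
      refine ⟨(t - 1) / t, 1 / t, div_pos (by linarith) hpos, div_pos one_pos hpos, ?_, ?_⟩
      · field_simp
        ring
      · rw [ht, smul_add, smul_smul, smul_smul, ← add_assoc, ← add_smul, div_mul_eq_mul_div,
          one_mul, ← add_div, div_mul_cancel₀ _ h0, one_smul]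
        simp

/-- In a collinear corner the other possibility would put the first vertex inside side `i + 1`. So
flat corners have angle π, and the boundary never turns back on itself. -/
theorem succ_mem_openSegment (i : ZMod n)
    (h : orient (P.vert i) (P.vert (i + 1)) (P.vert (i + 2)) = 0) :
    P.vert (i + 1) ∈ openSegment ℝ (P.vert i) (P.vert (i + 2)) := by
  have h2 : i + 2 = i + 1 + 1 := by ring
  refine (P.mem_openSegment_of_orient_eq_zero ?_ ?_ h).resolve_left ?_
  · intro e
    exact ZMod.two_ne_zero_of_three_le P.three_le (by simpa using e)
  · intro e
    rw [h2] at e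
    exact ZMod.one_ne_zero_of_three_le P.three_le (by simpa using e)
  · rw [h2]
    exact P.vert_notMem (i + 1) i

/-- A vertex of largest modulus cannot be inside a segment between two other vertices, so the corner
there is not flat. This excludes the zero sign pattern in the finite searches. -/
theorem exists_orient_ne_zero : ∃ i, orient (P.vert i) (P.vert (i + 1)) (P.vert (i + 2)) ≠ 0 := by
  by_contra! h
  have := P.neZero
  obtain ⟨i, -, hi⟩ := Finset.exists_max_image Finset.univ (fun i => ‖P.vert i‖) Finset.univ_nonempty
  have h1 := P.succ_mem_openSegment (i - 1) (h _)
  have hne : P.vert (i - 1) ≠ P.vert (i - 1 + 2) := fun e => by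
    have := P.vert_injective e
    exact ZMod.two_ne_zero_of_three_le P.three_le (by simpa using this.symm)
  have h2 := openSegment_subset_ball_of_ne (z := (0 : ℂ)) (r := ‖P.vert i‖)
    (by simpa using hi (i - 1) (Finset.mem_univ _))
    (by simpa using hi (i - 1 + 2) (Finset.mem_univ _)) hne h1
  simp at h2

end PlanarPolygon

/-- Sign patterns of simple quadrangles. -/
theorem SignType.exists_fan_four (c : ZMod 4 → SignType)
    (hbal : ((c 0 = 1 ∨ c 2 = 1) ∨ (c 1 = -1 ∨ c 3 = -1)) ↔
      ((c 0 = -1 ∨ c 2 = -1) ∨ (c 1 = 1 ∨ c 3 = 1)))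
    (hcross : ∀ i, ¬(c i * c (i + 3) = -1 ∧ c (i + 2) * c (i + 1) = -1))
    (hz : ∀ i, c i = 0 → c (i + 3) = c (i + 2) ∧ c (i + 1) = c (i + 2)) (hne : ∃ i, c i ≠ 0) :
    ∃ k, (c k = 1 ∧ c (k + 2) = 1) ∨ (c k = -1 ∧ c (k + 2) = -1) := by
  revert c
  decide +kernel

set_option synthInstance.maxHeartbeats 2000000 in
set_option synthInstance.maxSize 5000 in
set_option maxRecDepth 10000 in
set_option maxHeartbeats 1000000 in
/-- Sign patterns of simple pentagons, with the cyclic symmetry written out. -/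
theorem SignType.exists_balanced_fan :
    ∀ c0 : SignType, ∀ c1 : SignType, ∀ c2 : SignType, ∀ c3 : SignType, ∀ c4 : SignType, ¬(c0 =
    0 ∧ c1 = 0 ∧ c2 = 0 ∧ c3 = 0 ∧ c4 = 0) → ∀ d0 : SignType, ∀ d2 : SignType, ¬(c0 * d0 = -1 ∧
    d2 * c1 = -1) → (c0 = 0 → d0 = d2 ∧ c1 = d2) → (c1 = 0 → c0 = d0 ∧ d2 = d0) → ∀ d4 :
    SignType, SignType.Balanced (c0 * c3) (-(d0 * d4)) (c4 * d2) → ¬(c2 * d2 = -1 ∧ d4 * c3 =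
    -1) → (c2 = 0 → d2 = d4 ∧ c3 = d4) → (d2 = 0 → (c2 = c3 ∧ d4 = c3 ∧ -c1 = d0 ∧ c0 = d0) ∨
    (c2 = -d4 ∧ -c3 = -d4 ∧ c1 = c0 ∧ d0 = c0)) → (c3 = 0 → c2 = d2 ∧ d4 = d2) → ∀ d1 :
    SignType, SignType.Balanced (c2 * c0) (-(d2 * d1)) (c1 * d4) → ¬(c4 * d4 = -1 ∧ d1 * c0 =
    -1) → (c0 = 0 → c4 = d4 ∧ d1 = d4) → (c4 = 0 → d4 = d1 ∧ c0 = d1) → (d4 = 0 → (c4 = c0 ∧ d1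
    = c0 ∧ -c3 = d2 ∧ c2 = d2) ∨ (c4 = -d1 ∧ -c0 = -d1 ∧ c3 = c2 ∧ d2 = c2)) → ∀ d3 : SignType,
    SignType.Balanced (c1 * c4) (-(d1 * d0)) (c0 * d3) → SignType.Balanced (c3 * c1) (-(d3 *
    d2)) (c2 * d0) → SignType.Balanced (c4 * c2) (-(d4 * d3)) (c3 * d1) → ¬(c1 * d1 = -1 ∧ d3 *
    c2 = -1) → ¬(c3 * d3 = -1 ∧ d0 * c4 = -1) → (d0 = 0 → (c0 = c1 ∧ d2 = c1 ∧ -c4 = d3 ∧ c3 =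
    d3) ∨ (c0 = -d2 ∧ -c1 = -d2 ∧ c4 = c3 ∧ d3 = c3)) → (c1 = 0 → d1 = d3 ∧ c2 = d3) → (d1 = 0 →
    (c1 = c2 ∧ d3 = c2 ∧ -c0 = d4 ∧ c4 = d4) ∨ (c1 = -d3 ∧ -c2 = -d3 ∧ c0 = c4 ∧ d4 = c4)) → (c2
    = 0 → c1 = d1 ∧ d3 = d1) → (c3 = 0 → d3 = d0 ∧ c4 = d0) → (d3 = 0 → (c3 = c4 ∧ d0 = c4 ∧ -c2
    = d1 ∧ c1 = d1) ∨ (c3 = -d0 ∧ -c4 = -d0 ∧ c2 = c1 ∧ d1 = c1)) → (c4 = 0 → c3 = d3 ∧ d0 = d3)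
    → (c0 = 1 ∧ d2 = 1 ∧ c3 = 1 ∧ (d0 ≠ -1 ∨ d4 ≠ -1 ∨ c4 ≠ 1)) ∨ (c0 = -1 ∧ d2 = -1 ∧ c3 = -1 ∧
    (d0 ≠ 1 ∨ d4 ≠ 1 ∨ c4 ≠ -1)) ∨ (c1 = 1 ∧ d3 = 1 ∧ c4 = 1 ∧ (d1 ≠ -1 ∨ d0 ≠ -1 ∨ c0 ≠ 1)) ∨
    (c1 = -1 ∧ d3 = -1 ∧ c4 = -1 ∧ (d1 ≠ 1 ∨ d0 ≠ 1 ∨ c0 ≠ -1)) ∨ (c2 = 1 ∧ d4 = 1 ∧ c0 = 1 ∧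
    (d2 ≠ -1 ∨ d1 ≠ -1 ∨ c1 ≠ 1)) ∨ (c2 = -1 ∧ d4 = -1 ∧ c0 = -1 ∧ (d2 ≠ 1 ∨ d1 ≠ 1 ∨ c1 ≠ -1))
    ∨ (c3 = 1 ∧ d0 = 1 ∧ c1 = 1 ∧ (d3 ≠ -1 ∨ d2 ≠ -1 ∨ c2 ≠ 1)) ∨ (c3 = -1 ∧ d0 = -1 ∧ c1 = -1 ∧
    (d3 ≠ 1 ∨ d2 ≠ 1 ∨ c2 ≠ -1)) ∨ (c4 = 1 ∧ d1 = 1 ∧ c2 = 1 ∧ (d4 ≠ -1 ∨ d3 ≠ -1 ∨ c3 ≠ 1)) ∨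
    (c4 = -1 ∧ d1 = -1 ∧ c2 = -1 ∧ (d4 ≠ 1 ∨ d3 ≠ 1 ∨ c3 ≠ -1)) := by
  -- The constraints are interleaved with the quantifiers, so that the search among the signs of the
  -- ten triangles drops a partial choice as soon as it violates one of them.
  decide +kernel

/-- Here `c i` and `d i` stand for the signs of the triangles `(i, i+1, i+2)` and `(i, i+1, i+3)`,
which account for all ten triples up to rotation. The hypotheses express the Plücker relations, that
sides two apart do not cross, and the possible positions of collinear vertices. The vertex `k` found
has three fan triangles of the same sign; the last disjunction excludes that they turn around it by
more than 2π and overlap. -/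
theorem SignType.exists_fan_five (c d : ZMod 5 → SignType)
    (hgp : ∀ i, SignType.Balanced (c i * c (i + 3)) (-(d i * d (i + 4))) (c (i + 4) * d (i + 2)))
    (hcross : ∀ i, ¬(c i * d i = -1 ∧ d (i + 2) * c (i + 1) = -1))
    (hz₁ : ∀ i, c i = 0 → d i = d (i + 2) ∧ c (i + 1) = d (i + 2))
    (hz₂ : ∀ i, c i = 0 → c (i + 4) = d (i + 4) ∧ d (i + 1) = d (i + 4))
    (hz₃ : ∀ i, d i = 0 →
      (c i = c (i + 1) ∧ d (i + 2) = c (i + 1) ∧ -c (i + 4) = d (i + 3) ∧ c (i + 3) = d (i + 3)) ∨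
      (c i = -d (i + 2) ∧ -c (i + 1) = -d (i + 2) ∧ c (i + 4) = c (i + 3) ∧ d (i + 3) = c (i + 3)))
    (hne : ∃ i, c i ≠ 0) :
    ∃ k, (c k = 1 ∧ d (k + 2) = 1 ∧ c (k + 3) = 1 ∧ (d k ≠ -1 ∨ d (k + 4) ≠ -1 ∨ c (k + 4) ≠ 1)) ∨
      (c k = -1 ∧ d (k + 2) = -1 ∧ c (k + 3) = -1 ∧
        (d k ≠ 1 ∨ d (k + 4) ≠ 1 ∨ c (k + 4) ≠ -1)) := by
  have hne' : ¬(c 0 = 0 ∧ c 1 = 0 ∧ c 2 = 0 ∧ c 3 = 0 ∧ c 4 = 0) := by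
    rintro ⟨h0, h1, h2, h3, h4⟩
    obtain ⟨i, hi⟩ := hne
    fin_cases i
    exacts [hi h0, hi h1, hi h2, hi h3, hi h4]
  have h := SignType.exists_balanced_fan (c 0) (c 1) (c 2) (c 3) (c 4) hne' (d 0) (d 2) (hcross 0)
    (hz₁ 0) (hz₂ 1) (d 4) (hgp 0) (hcross 2) (hz₁ 2) (hz₃ 2) (hz₂ 3) (d 1) (hgp 2) (hcross 4)
    (hz₂ 0) (hz₁ 4) (hz₃ 4) (d 3) (hgp 1) (hgp 3) (hgp 4) (hcross 1) (hcross 3) (hz₃ 0) (hz₁ 1)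
    (hz₃ 1) (hz₂ 2) (hz₁ 3) (hz₃ 3) (hz₂ 4)
  rcases h with h | h | h | h | h | h | h | h | h | h
  exacts [⟨0, .inl h⟩, ⟨0, .inr h⟩, ⟨1, .inl h⟩, ⟨1, .inr h⟩, ⟨2, .inl h⟩, ⟨2, .inr h⟩,
    ⟨3, .inl h⟩, ⟨3, .inr h⟩, ⟨4, .inl h⟩, ⟨4, .inr h⟩]

theorem orient_swap_right (a b c : ℂ) : orient a c b = -orient a b c := by
  simp only [orient, Complex.sub_re, Complex.sub_im]
  ring

namespace PlanarPolygon

variable {n : ℕ} (P : PlanarPolygon n)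

/-- The sequence `p` runs through the vertices of `P`, in cyclic order and in one of the two
directions, and the diagonals from `p 0` cut `P` into positively oriented triangles whose interiors
are separated by lines through `p 0`. -/
structure IsFan (p : ℕ → ℂ) : Prop where
  mem_range : ∀ l, p l ∈ range P.vert
  exists_eq : ∀ i, ∃ l < n, P.vert i = p l
  injOn : ∀ l < n, ∀ l' < n, p l = p l' → l = l'
  periodic : p n = p 0
  side : ∀ l, ∃ t, openSegment ℝ (p l) (p (l + 1)) = P.openSide t
  exists_side : ∀ t, ∃ l < n, openSegment ℝ (p l) (p (l + 1)) = P.openSide t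
  pos : ∀ i < n - 2, 0 < orient (p 0) (p (i + 1)) (p (i + 2))
  separated : ∀ i < n - 2, ∀ j < n - 2, i < j → ∃ w : ℂ →ₗ[ℝ] ℝ, w ≠ 0 ∧
    0 ≤ w (p (i + 1) - p 0) ∧ 0 ≤ w (p (i + 2) - p 0) ∧
    w (p (j + 1) - p 0) ≤ 0 ∧ w (p (j + 2) - p 0) ≤ 0
  diagonal : ∀ k, 2 ≤ k → k < n - 1 → ∀ i < n - 2, k ≠ i + 1 → k ≠ i + 2 → ∃ w : ℂ →ₗ[ℝ] ℝ,
    0 ≤ w (p (i + 1) - p 0) ∧ 0 ≤ w (p (i + 2) - p 0) ∧ w (p k - p 0) < 0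

/-- Only linear algebra at `p 0` is needed: triangles that are adjacent in the fan are separated by
their common diagonal. With at most five sides the only pair that is not adjacent is the first and
third triangles of a pentagon, and `hfar` says that the total angle at `p 0` is at most 2π. The sign
`s` is the direction in which the vertices are read. -/
theorem isFan_of_orient (hn : n ≤ 5) (k s : ZMod n) (hs : s = 1 ∨ s = -1) {p : ℕ → ℂ}
    (hp : ∀ l : ℕ, p l = P.vert (k + s * l))
    (hpos : ∀ i < n - 2, 0 < orient (p 0) (p (i + 1)) (p (i + 2)))
    (hfar : n = 5 → 0 ≤ orient (p 0) (p 1) (p 3) ∨ 0 ≤ orient (p 0) (p 2) (p 4) ∨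
      orient (p 0) (p 1) (p 4) ≤ 0) : P.IsFan p := by
  have := P.neZero
  have hss : s * s = 1 := by rcases hs with rfl | rfl <;> ring
  have hside : ∀ l : ℕ, openSegment ℝ (p l) (p (l + 1)) =
      P.openSide (if s = 1 then k + s * l else k + s * (l + 1)) := by
    intro l
    rw [hp, hp, openSide]
    split_ifs with h
    · rw [h]
      push_cast
      congr 2
      ring
    · rw [hs.resolve_left h, openSegment_symm]
      push_cast
      congr 2
      ring
  have hsolve : ∀ i : ZMod n, ∃ l < n, k + s * ((l : ℕ) : ZMod n) = i := fun i =>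
    ⟨(s * (i - k)).val, ZMod.val_lt _, by
      rw [ZMod.natCast_val, ZMod.cast_id', id, ← mul_assoc, hss]; ring⟩
  refine ⟨fun l => ⟨_, (hp l).symm⟩, fun i => ?_, fun l hl l' hl' e => ?_, ?_,
    fun l => ⟨_, hside l⟩, fun t => ?_, hpos, fun i hi j hj hij => ?_, fun k hk hk' i hi h1 h2 => ?_⟩
  · obtain ⟨l, hl, e⟩ := hsolve i
    exact ⟨l, hl, by rw [hp, e]⟩
  · rw [hp, hp] at e
    have e1 := P.vert_injective e
    have e2 : (l : ZMod n) = l' := by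
      linear_combination s * e1 - (l : ZMod n) * hss + (l' : ZMod n) * hss
    rw [ZMod.natCast_eq_natCast_iff', Nat.mod_eq_of_lt hl, Nat.mod_eq_of_lt hl'] at e2
    exact e2
  · rw [hp, hp]; simp
  · obtain ⟨l, hl, e⟩ := hsolve (if s = 1 then t else t - s)
    refine ⟨l, hl, ?_⟩
    rw [hside]
    congr 1
    split_ifs with h
    · rw [e, if_pos h]
    · rw [mul_add, ← add_assoc, e, if_neg h]
      ring
  · rcases Nat.lt_or_ge (i + 1) j with hlt | hge
    · have hn5 : n = 5 := by omega
      obtain rfl : i = 0 := by omega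
      obtain rfl : j = 2 := by omega
      have p0 := hpos 0 (by omega)
      have p1 := hpos 1 (by omega)
      have p2 := hpos 2 (by omega)
      simp only [zero_add, Nat.reduceAdd] at p0 p1 p2 ⊢
      -- The separating line goes through `p 3`, `p 2` or `p 1`, according to the alternative of
      -- `hfar` that holds.
      by_cases c1 : 0 ≤ orient (p 0) (p 1) (p 3)
      · refine ⟨-crossForm (p 3 - p 0), neg_ne_zero.2 (crossForm_ne_zero ?_), ?_⟩
        · rintro e
          rw [sub_eq_zero.1 e] at p1
          simp at p1
        · simp only [LinearMap.neg_apply, ← orient_eq_crossForm, orient_self_right]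
          rw [orient_swap_right _ (p 1), orient_swap_right _ (p 2)]
          refine ⟨?_, ?_, ?_, ?_⟩ <;> linarith
      · by_cases c2 : 0 ≤ orient (p 0) (p 2) (p 4)
        · refine ⟨-crossForm (p 2 - p 0), neg_ne_zero.2 (crossForm_ne_zero ?_), ?_⟩
          · rintro e
            rw [sub_eq_zero.1 e] at p1
            simp at p1
          · simp only [LinearMap.neg_apply, ← orient_eq_crossForm, orient_self_right]
            rw [orient_swap_right _ (p 1)]
            refine ⟨?_, ?_, ?_, ?_⟩ <;> linarith
        · have c3 := ((hfar hn5).resolve_left c1).resolve_left c2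
          refine ⟨crossForm (p 1 - p 0), crossForm_ne_zero ?_, ?_⟩
          · rintro e
            rw [sub_eq_zero.1 e] at p0
            simp at p0
          · simp only [← orient_eq_crossForm, orient_self_right]
            refine ⟨?_, ?_, ?_, ?_⟩ <;> linarith
    · obtain rfl : j = i + 1 := by omega
      have p0 := hpos i hi
      have p1 := hpos (i + 1) hj
      refine ⟨-crossForm (p (i + 2) - p 0), neg_ne_zero.2 (crossForm_ne_zero ?_), ?_⟩
      · rintro e
        rw [sub_eq_zero.1 e] at p0
        simp at p0
      · simp only [LinearMap.neg_apply, ← orient_eq_crossForm, orient_self_right]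
        rw [orient_swap_right _ (p (i + 1))]
        have e1 : i + 1 + 1 = i + 2 := rfl
        rw [e1] at p1 ⊢
        refine ⟨?_, ?_, ?_, ?_⟩ <;> linarith
  -- In a pentagon at most, a diagonal that is not a side of triangle `i` is the next one or the
  -- previous one, and the sides of the neighbouring triangle give the sign.
  · have hcase : k = i + 3 ∨ k = i := by omega
    rcases hcase with rfl | rfl
    · have p0 := hpos i hi
      have p1 := hpos (i + 1) (by omega)
      refine ⟨-crossForm (p (i + 2) - p 0), ?_⟩
      simp only [LinearMap.neg_apply, ← orient_eq_crossForm, orient_self_right]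
      rw [orient_swap_right _ (p (i + 1))]
      have e1 : i + 1 + 1 = i + 2 := rfl
      have e2 : i + 1 + 2 = i + 3 := rfl
      rw [e1, e2] at p1
      refine ⟨?_, ?_, ?_⟩ <;> linarith
    · have p0 := hpos k hi
      have p1 := hpos (k - 1) (by omega)
      have e1 : k - 1 + 1 = k := by omega
      have e2 : k - 1 + 2 = k + 1 := by omega
      rw [e1, e2] at p1
      refine ⟨crossForm (p (k + 1) - p 0), ?_⟩
      simp only [← orient_eq_crossForm, orient_self_right]
      rw [orient_swap_right _ (p k) (p (k + 1))]
      refine ⟨?_, ?_, ?_⟩ <;> linarith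

theorem exists_isFan_three (P : PlanarPolygon 3) : ∃ p, P.IsFan p := by
  obtain ⟨k, hk⟩ := P.exists_orient_ne_zero
  rcases lt_or_gt_of_ne hk with h | h
  · refine ⟨_, P.isFan_of_orient (by norm_num) k (-1) (.inr rfl) (fun l => rfl) ?_ (by norm_num)⟩
    intro i hi
    obtain rfl : i = 0 := by omega
    have e1 : ∀ k : ZMod 3, k + -1 = k + 2 := by decide
    have e2 : ∀ k : ZMod 3, k + -2 = k + 1 := by decide
    simp only [Nat.cast_zero, mul_zero, add_zero, zero_add, Nat.cast_one, mul_one, Nat.cast_ofNat,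
      neg_one_mul, e1, e2]
    rw [orient_swap_right]
    linarith
  · refine ⟨_, P.isFan_of_orient (by norm_num) k 1 (.inl rfl) (fun l => rfl) ?_ (by norm_num)⟩
    intro i hi
    obtain rfl : i = 0 := by omega
    simpa using h

/-- The diagonal from `k` to `k + 2` leaves the corners at `k + 1` and `k + 3`, so a fan from `k`
only needs these two to have the same sign. -/
theorem exists_isFan_four (P : PlanarPolygon 4) : ∃ p, P.IsFan p := by
  have hB : ∀ k, orient (P.vert k) (P.vert (k + 2)) (P.vert (k + 3)) =
      orient (P.vert (k + 2)) (P.vert (k + 2 + 1)) (P.vert (k + 2 + 2)) := by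
    intro k
    have e1 : k + 2 + 1 = k + 3 := by ring
    have e2 : k + 2 + 2 = k := by revert k; decide
    rw [e1, e2]
    exact (orient_rotate _ _ _).symm
  have hC : ∀ k, orient (P.vert k) (P.vert (k + 1)) (P.vert (k + 3)) =
      orient (P.vert (k + 3)) (P.vert (k + 3 + 1)) (P.vert (k + 3 + 2)) := by
    intro k
    have e1 : k + 3 + 1 = k := by revert k; decide
    have e2 : k + 3 + 2 = k + 1 := by revert k; decide
    rw [e1, e2]
    exact orient_rotate _ _ _
  have hA : ∀ k, orient (P.vert (k + 1)) (P.vert (k + 2)) (P.vert (k + 3)) =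
      orient (P.vert (k + 1)) (P.vert (k + 1 + 1)) (P.vert (k + 1 + 2)) := by
    intro k
    have e1 : k + 1 + 1 = k + 2 := by ring
    have e2 : k + 1 + 2 = k + 3 := by ring
    rw [e1, e2]
  obtain ⟨k, hk⟩ := SignType.exists_fan_four
    (fun i => SignType.sign (orient (P.vert i) (P.vert (i + 1)) (P.vert (i + 2)))) (by
      -- Both diagonals cut the same signed area into two triangles.
      have e : orient (P.vert 0) (P.vert 1) (P.vert 2) + orient (P.vert 2) (P.vert 3) (P.vert 0) =
          orient (P.vert 1) (P.vert 2) (P.vert 3) + orient (P.vert 3) (P.vert 0) (P.vert 1) := by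
        simp only [orient, Complex.sub_re, Complex.sub_im]
        ring
      simp only [sign_eq_one_iff, sign_eq_neg_one_iff]
      change (0 < orient (P.vert 0) (P.vert 1) (P.vert 2) ∨
        0 < orient (P.vert 2) (P.vert 3) (P.vert 0)) ∨
        (orient (P.vert 1) (P.vert 2) (P.vert 3) < 0 ∨
        orient (P.vert 3) (P.vert 0) (P.vert 1) < 0) ↔
        (orient (P.vert 0) (P.vert 1) (P.vert 2) < 0 ∨
        orient (P.vert 2) (P.vert 3) (P.vert 0) < 0) ∨
        (0 < orient (P.vert 1) (P.vert 2) (P.vert 3) ∨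
        0 < orient (P.vert 3) (P.vert 0) (P.vert 1))
      constructor
      all_goals
        intro h
        by_contra! h'
        rcases h with (h | h) | h | h <;> linarith [h'.1.1, h'.1.2, h'.2.1, h'.2.2]) (fun i h => by
      rw [← sign_mul, ← sign_mul, sign_eq_neg_one_iff, sign_eq_neg_one_iff, ← hB, ← hC, ← hA] at h
      have e : i + 2 + 1 = i + 3 := by ring
      refine not_disjoint_openSegment (a := P.vert i) (b := P.vert (i + 1)) (c := P.vert (i + 2))
        (d := P.vert (i + 3)) h.1 (by
          rw [orient_rotate (P.vert i) (P.vert (i + 2)), orient_rotate (P.vert (i + 1)) (P.vert (i + 2))]; exact h.2) ?_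
      rw [← e]
      refine P.side_disjoint i (i + 2) fun e => ?_
      clear h
      revert i
      decide) (fun i h => by
      have := sign_orient_of_mem_openSegment (P.succ_mem_openSegment i (sign_eq_zero_iff.1 h))
        (P.vert (i + 3))
      rwa [hB, hC, hA] at this) (by
      simpa only [ne_eq, sign_eq_zero_iff] using P.exists_orient_ne_zero)
  simp only [sign_eq_one_iff, sign_eq_neg_one_iff, ← hB] at hk
  rcases hk with h | h
  · refine ⟨_, P.isFan_of_orient (by norm_num) k 1 (.inl rfl) (fun l => rfl) ?_ (by norm_num)⟩
    intro i hi
    have hi' : i = 0 ∨ i = 1 := by omega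
    rcases hi' with rfl | rfl
    · simpa using h.1
    · simpa using h.2
  · refine ⟨_, P.isFan_of_orient (by norm_num) k (-1) (.inr rfl) (fun l => rfl) ?_ (by norm_num)⟩
    intro i hi
    have e1 : ∀ k : ZMod 4, k + -1 = k + 3 := by decide
    have e2 : ∀ k : ZMod 4, k + -2 = k + 2 := by decide
    have e3 : ∀ k : ZMod 4, k + -3 = k + 1 := by decide
    have hi' : i = 0 ∨ i = 1 := by omega
    rcases hi' with rfl | rfl
    · norm_num [e1, e2]
      rw [orient_swap_right]
      linarith
    · norm_num [e3, e2]
      rw [orient_swap_right]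
      linarith

theorem exists_isFan_five (P : PlanarPolygon 5) : ∃ p, P.IsFan p := by
  set v := P.vert with hv
  let c : ZMod 5 → SignType := fun i => SignType.sign (orient (v i) (v (i + 1)) (v (i + 2)))
  let d : ZMod 5 → SignType := fun i => SignType.sign (orient (v i) (v (i + 1)) (v (i + 3)))
  have hA : ∀ k, SignType.sign (orient (v k) (v (k + 1)) (v (k + 2))) = c k := fun k => rfl
  have hD : ∀ k, SignType.sign (orient (v k) (v (k + 1)) (v (k + 3))) = d k := fun k => rfl
  have hB : ∀ k, SignType.sign (orient (v k) (v (k + 2)) (v (k + 3))) = d (k + 2) := fun k => by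
    have e1 : k + 2 + 1 = k + 3 := by ring
    have e2 : k + 2 + 3 = k := by revert k; decide
    simp only [d, e1, e2]
    rw [← orient_rotate (v k)]
  have hC : ∀ k, SignType.sign (orient (v k) (v (k + 3)) (v (k + 4))) = c (k + 3) := fun k => by
    have e1 : k + 3 + 1 = k + 4 := by ring
    have e2 : k + 3 + 2 = k := by revert k; decide
    simp only [c, e1, e2]
    rw [← orient_rotate (v k)]
  have hE : ∀ k, SignType.sign (orient (v k) (v (k + 2)) (v (k + 4))) = d (k + 4) := fun k => by
    have e1 : k + 4 + 1 = k := by revert k; decide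
    have e2 : k + 4 + 3 = k + 2 := by revert k; decide
    simp only [d, e1, e2]
    rw [orient_rotate (v (k + 4))]
  have hF : ∀ k, SignType.sign (orient (v k) (v (k + 1)) (v (k + 4))) = c (k + 4) := fun k => by
    have e1 : k + 4 + 1 = k := by revert k; decide
    have e2 : k + 4 + 2 = k + 1 := by revert k; decide
    simp only [c, e1, e2]
    rw [orient_rotate (v (k + 4))]
  have h11 : ∀ i : ZMod 5, i + 1 + 1 = i + 2 := fun i => by ring
  have h12 : ∀ i : ZMod 5, i + 1 + 2 = i + 3 := fun i => by ring
  have h13 : ∀ i : ZMod 5, i + 1 + 3 = i + 4 := fun i => by ring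
  have hA1 : ∀ k, SignType.sign (orient (v (k + 1)) (v (k + 2)) (v (k + 3))) = c (k + 1) :=
    fun k => by rw [← hA, h11, h12]
  have hD1 : ∀ k, SignType.sign (orient (v (k + 1)) (v (k + 2)) (v (k + 4))) = d (k + 1) :=
    fun k => by rw [← hD, h11, h13]
  have hB1 : ∀ k, SignType.sign (orient (v (k + 1)) (v (k + 3)) (v (k + 4))) = d (k + 3) :=
    fun k => by rw [← h12, ← hB, h12, h13]
  obtain ⟨k, hk⟩ := SignType.exists_fan_five c d (fun i => by
      have h := SignType.balanced_sign (orient_grassmann (v i) (v (i + 1)) (v (i + 2)) (v (i + 3))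
        (v (i + 4)))
      rwa [Left.sign_neg, sign_mul, sign_mul, sign_mul, hA, hC, hD, hE, hF, hB] at h)
    (fun i h => by
      rw [← hA, ← hD, ← hB, ← hA1, ← sign_mul, ← sign_mul, sign_eq_neg_one_iff,
        sign_eq_neg_one_iff] at h
      have e : i + 2 + 1 = i + 3 := by ring
      refine not_disjoint_openSegment (a := v i) (b := v (i + 1)) (c := v (i + 2))
        (d := v (i + 3)) h.1 (by
          rw [orient_rotate (v i) (v (i + 2)), orient_rotate (v (i + 1)) (v (i + 2))]; exact h.2) ?_
      rw [← e]
      refine P.side_disjoint i (i + 2) fun e => ?_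
      clear h
      revert i
      decide)
    (fun i h => by
      have := sign_orient_of_mem_openSegment (P.succ_mem_openSegment i (sign_eq_zero_iff.1 h))
        (v (i + 3))
      rwa [← hv, hD, hB, hA1] at this)
    (fun i h => by
      have := sign_orient_of_mem_openSegment (P.succ_mem_openSegment i (sign_eq_zero_iff.1 h))
        (v (i + 4))
      rwa [← hv, hF, hE, hD1] at this)
    (fun i h => by
      rcases P.mem_openSegment_of_orient_eq_zero (i := i) (k := i + 3) (by clear h; revert i; decide)
        (by clear h; revert i; decide) (sign_eq_zero_iff.1 h) with h | h
      · left
        have h1 := sign_orient_of_mem_openSegment h (v (i + 2))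
        have h2 := sign_orient_of_mem_openSegment h (v (i + 4))
        rw [← hv, orient_swap (v i) (v (i + 1)), orient_swap_right (v i) (v (i + 2)) (v (i + 3)),
          orient_swap_right (v (i + 1)) (v (i + 2)) (v (i + 3)), Left.sign_neg, Left.sign_neg, Left.sign_neg,
          hA, hB, hA1, neg_inj, neg_inj] at h1
        rw [← hv, orient_swap (v i) (v (i + 1)), Left.sign_neg, hF, hC, hB1] at h2
        exact ⟨h1.1, h1.2, h2.1, h2.2⟩
      · right
        have h1 := sign_orient_of_mem_openSegment h (v (i + 2))
        have h2 := sign_orient_of_mem_openSegment h (v (i + 4))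
        rw [← hv, orient_swap_right (v i) (v (i + 2)) (v (i + 3)),
          orient_swap_right (v (i + 1)) (v (i + 2)) (v (i + 3)), Left.sign_neg, Left.sign_neg,
          hA, hB, hA1] at h1
        rw [← hv, hF, hC, hB1] at h2
        exact ⟨h1.1, h1.2, h2.1, h2.2⟩)
    (by simpa only [ne_eq, c, sign_eq_zero_iff] using P.exists_orient_ne_zero)
  rw [← hA, ← hB, ← hC, ← hD, ← hE, ← hF] at hk
  simp only [ne_eq, sign_eq_one_iff, sign_eq_neg_one_iff, not_lt] at hk
  rcases hk with h | h
  · refine ⟨_, P.isFan_of_orient (by norm_num) k 1 (.inl rfl) (fun l => rfl) ?_ fun _ => ?_⟩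
    · intro i hi
      have hi' : i = 0 ∨ i = 1 ∨ i = 2 := by omega
      rcases hi' with rfl | rfl | rfl
      · simpa using h.1
      · simpa using h.2.1
      · simpa using h.2.2.1
    · simpa using h.2.2.2
  -- Negative signs mean that the polygon is numbered clockwise, so the vertices are read backwards.
  · have e1 : ∀ k : ZMod 5, k + -1 = k + 4 := by decide
    have e2 : ∀ k : ZMod 5, k + -2 = k + 3 := by decide
    have e3 : ∀ k : ZMod 5, k + -3 = k + 2 := by decide
    have e4 : ∀ k : ZMod 5, k + -4 = k + 1 := by decide
    obtain ⟨h1, h2, h3, h4⟩ := h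
    refine ⟨_, P.isFan_of_orient (by norm_num) k (-1) (.inr rfl) (fun l => rfl) ?_ fun _ => ?_⟩
    · intro i hi
      have hi' : i = 0 ∨ i = 1 ∨ i = 2 := by omega
      rcases hi' with rfl | rfl | rfl
      · norm_num [e1, e2]
        rw [orient_swap_right]
        linarith
      · norm_num [e2, e3]
        rw [orient_swap_right]
        linarith
      · norm_num [e3, e4]
        rw [orient_swap_right]
        linarith
    · norm_num [e1, e2, e3, e4]
      rw [orient_swap_right _ (v (k + 2)), orient_swap_right _ (v (k + 1)) (v (k + 3)),
        orient_swap_right _ (v (k + 1)) (v (k + 4))]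
      rcases h4 with h4 | h4 | h4
      · right; left; linarith
      · left; linarith
      · right; right; linarith

theorem exists_isFan {n : ℕ} (P : PlanarPolygon n) (hn : n ≤ 5) : ∃ p, P.IsFan p := by
  have hn' : n = 3 ∨ n = 4 ∨ n = 5 := by have := P.three_le; omega
  rcases hn' with rfl | rfl | rfl
  exacts [P.exists_isFan_three, P.exists_isFan_four, P.exists_isFan_five]

end PlanarPolygon

/-! ### Triangles, and why a fan fills exactly the polygon -/

/-- The vertices of the triangle `a b c`. -/
def triangleVert (a b c : ℂ) : ZMod 3 → ℂ := ![a, b, c]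

theorem isConvexCycle_triangleVert {a b c : ℂ} (h : 0 < orient a b c) :
    IsConvexCycle (triangleVert a b c) := by
  intro i k hk hk'
  fin_cases i <;> fin_cases k
  all_goals first | exact absurd rfl hk | exact absurd rfl hk' | skip
  · exact h
  · exact (orient_rotate a b c).symm ▸ h
  · exact (orient_rotate c a b) ▸ h

namespace PlanarPolygon

/-- The positively oriented triangle `a b c`. -/
def triangle (a b c : ℂ) (h : 0 < orient a b c) : PlanarPolygon 3 :=
  (isConvexCycle_triangleVert h).polygon le_rfl

section Triangle

variable {a b c : ℂ} (h : 0 < orient a b c)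

theorem triangle_openSide_zero : (triangle a b c h).openSide 0 = openSegment ℝ a b := rfl

theorem triangle_openSide_one : (triangle a b c h).openSide 1 = openSegment ℝ b c := rfl

theorem triangle_openSide_two : (triangle a b c h).openSide 2 = openSegment ℝ c a := rfl

theorem triangle_side_zero : (triangle a b c h).side 0 = segment ℝ a b := rfl

theorem triangle_side_one : (triangle a b c h).side 1 = segment ℝ b c := rfl

theorem triangle_side_two : (triangle a b c h).side 2 = segment ℝ c a := rfl

theorem convex_triangle : Convex ℝ (triangle a b c h).region := convex_leftRegion _

theorem mem_triangle {z : ℂ} : z ∈ (triangle a b c h).region ↔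
    0 ≤ orient a b z ∧ 0 ≤ orient b c z ∧ 0 ≤ orient c a z := by
  constructor
  · intro hz
    exact ⟨hz 0, hz 1, hz 2⟩
  · rintro ⟨h0, h1, h2⟩ i
    fin_cases i
    exacts [h0, h1, h2]

theorem mem_interior_triangle {z : ℂ} : z ∈ interior (triangle a b c h).region ↔
    0 < orient a b z ∧ 0 < orient b c z ∧ 0 < orient c a z := by
  refine ((isConvexCycle_triangleVert h).mem_interior_iff le_rfl).trans ?_
  constructor
  · intro hz
    exact ⟨hz 0, hz 1, hz 2⟩
  · rintro ⟨h0, h1, h2⟩ i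
    fin_cases i
    exacts [h0, h1, h2]

theorem orient_smul_sub (a b c z : ℂ) :
    orient a b c • (z - a) = orient c a z • (b - a) + orient a b z • (c - a) := by
  apply Complex.ext
  all_goals
    simp only [orient, Complex.add_re, Complex.add_im, Complex.real_smul, Complex.mul_re,
      Complex.mul_im, Complex.ofReal_re, Complex.ofReal_im, Complex.sub_re, Complex.sub_im]
    ring

/-- The linear coordinates on a triangle. -/
theorem map_sub_triangle (w : ℂ →ₗ[ℝ] ℝ) (z : ℂ) :
    orient a b c * w (z - a) = orient c a z * w (b - a) + orient a b z * w (c - a) := by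
  have := congrArg w (orient_smul_sub a b c z)
  simpa only [map_smul, map_add, smul_eq_mul] using this

theorem vert_mem_triangle : a ∈ (triangle a b c h).region ∧ b ∈ (triangle a b c h).region ∧
    c ∈ (triangle a b c h).region :=
  ⟨(triangle a b c h).vert_mem_region 0, (triangle a b c h).vert_mem_region 1,
    (triangle a b c h).vert_mem_region 2⟩

theorem range_triangle_vert : range (triangle a b c h).vert = {a, b, c} := by
  ext z
  constructor
  · rintro ⟨i, rfl⟩
    fin_cases i
    exacts [.inl rfl, .inr (.inl rfl), .inr (.inr rfl)]
  · rintro (rfl | rfl | rfl)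
    exacts [⟨0, rfl⟩, ⟨1, rfl⟩, ⟨2, rfl⟩]

theorem triangle_subset_closure_interior :
    (triangle a b c h).region ⊆ closure (interior (triangle a b c h).region) := by
  rw [(convex_triangle h).closure_interior_eq_closure_of_nonempty_interior
    (triangle a b c h).interior_nonempty]
  exact subset_closure

/-- Two triangles with a common vertex that are separated by a line through that vertex. -/
theorem disjoint_interior_triangle {b' c' : ℂ} (h' : 0 < orient a b' c') {w : ℂ →ₗ[ℝ] ℝ}
    (hw : w ≠ 0) (hb : 0 ≤ w (b - a)) (hc : 0 ≤ w (c - a)) (hb' : w (b' - a) ≤ 0)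
    (hc' : w (c' - a) ≤ 0) :
    Disjoint (interior (triangle a b c h).region) (triangle a b' c' h').region := by
  rw [Set.disjoint_left]
  intro z hz hz'
  obtain ⟨h1, -, h3⟩ := (mem_interior_triangle h).1 hz
  obtain ⟨h1', -, h3'⟩ := (mem_triangle h').1 hz'
  have e := map_sub_triangle (a := a) (b := b) (c := c) w z
  have e' := map_sub_triangle (a := a) (b := b') (c := c') w z
  have h4 : w (z - a) ≤ 0 := by
    -- The coordinates of a point in a triangle are nonnegative, so `w` is nonpositive on the second
    -- triangle; being nonnegative on the first one with positive coordinates, it then vanishes on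
    -- both of its edge vectors at `a`, hence everywhere.
    by_contra! hlt
    nlinarith [mul_pos h' hlt]
  have h5 : orient a b c * w (z - a) ≤ 0 := mul_nonpos_of_nonneg_of_nonpos h.le h4
  have h6 : w (b - a) = 0 := by
    by_contra hne
    have := lt_of_le_of_ne hb (Ne.symm hne)
    nlinarith [mul_pos h3 this, mul_nonneg h1.le hc]
  have h7 : w (c - a) = 0 := by
    by_contra hne
    have := lt_of_le_of_ne hc (Ne.symm hne)
    nlinarith [mul_pos h1 this, mul_nonneg h3.le hb]
  refine hw (LinearMap.ext fun y => ?_)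
  have e0 := map_sub_triangle (a := a) (b := b) (c := c) w (y + a)
  rw [h6, h7, mul_zero, mul_zero, add_zero, add_sub_cancel_right] at e0
  simpa [h.ne'] using e0

end Triangle

namespace IsFan

variable {n : ℕ} {P : PlanarPolygon n} {p : ℕ → ℂ} (hp : P.IsFan p)

/-- The triangles of a fan. -/
def face (i : Fin (n - 2)) : PlanarPolygon 3 :=
  triangle (p 0) (p (i + 1)) (p (i + 2)) (hp.pos i i.2)

include hp in
theorem side_eq_segment (t : ZMod n) : ∃ l < n, P.openSide t = openSegment ℝ (p l) (p (l + 1)) ∧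
    P.side t = segment ℝ (p l) (p (l + 1)) := by
  obtain ⟨l, hl, e⟩ := hp.exists_side t
  refine ⟨l, hl, e.symm, ?_⟩
  rw [← closure_openSegment, e, PlanarPolygon.openSide, closure_openSegment]
  rfl

/-- Every side of the polygon is a side of some triangle of the fan. -/
theorem exists_face_side (t : ZMod n) : ∃ i s, (hp.face i).openSide s = P.openSide t ∧
    (hp.face i).side s = P.side t := by
  obtain ⟨l, hl, e, e'⟩ := hp.side_eq_segment t
  rw [e, e']
  have h3 := P.three_le
  rcases Nat.eq_zero_or_pos l with rfl | hpos
  · exact ⟨⟨0, by omega⟩, 0, rfl, rfl⟩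
  · rcases Nat.lt_or_ge l (n - 1) with hlt | hge
    · refine ⟨⟨l - 1, by omega⟩, 1, ?_, ?_⟩
      all_goals
        simp only [face, triangle_openSide_one, triangle_side_one]
        rw [show l - 1 + 1 = l by omega, show l - 1 + 2 = l + 1 by omega]
    · obtain rfl : l = n - 1 := by omega
      refine ⟨⟨n - 3, by omega⟩, 2, ?_, ?_⟩
      all_goals
        simp only [face, triangle_openSide_two, triangle_side_two]
        rw [show n - 3 + 2 = n - 1 by omega, show n - 1 + 1 = n by omega, hp.periodic]

theorem frontier_subset : frontier P.region ⊆ ⋃ i, (hp.face i).region := by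
  rw [P.frontier_region]
  refine iUnion_subset fun t => ?_
  obtain ⟨i, s, -, e⟩ := hp.exists_face_side t
  change P.side t ⊆ _
  rw [← e]
  exact ((hp.face i).side_subset_region s).trans (subset_iUnion (fun i => (hp.face i).region) i)

/-- The union of the triangles is star-shaped about `p 0` and contains the frontier. From a point
outside the union, the ray away from `p 0` never meets the frontier, so it would remain in the
polygon, which is bounded. -/
theorem region_subset : P.region ⊆ ⋃ i, (hp.face i).region := by
  intro z hz
  by_contra hzS
  have hstar : ∀ y ∈ ⋃ i, (hp.face i).region, ∀ t ∈ Icc (0 : ℝ) 1,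
      p 0 + t • (y - p 0) ∈ ⋃ i, (hp.face i).region := by
    intro y hy t ht
    obtain ⟨i, hi⟩ := mem_iUnion.1 hy
    exact mem_iUnion.2 ⟨i, (convex_triangle (hp.pos i i.2)).add_smul_sub_mem
      (vert_mem_triangle (hp.pos i i.2)).1 hi ht⟩
  let ray : Set ℂ := (fun t : ℝ => p 0 + t • (z - p 0)) '' Ici 1
  have hray : IsPreconnected ray :=
    isPreconnected_Ici.image _ (by fun_prop)
  have hdisj : Disjoint ray (frontier P.region) := by
    rw [Set.disjoint_left]
    rintro _ ⟨t, ht, rfl⟩ hf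
    have ht' : (1 : ℝ) ≤ t := ht
    have h1 := hstar _ (hp.frontier_subset hf) t⁻¹ ⟨by positivity, inv_le_one_of_one_le₀ ht'⟩
    apply hzS
    have h0 : t ≠ 0 := by positivity
    simp only [add_sub_cancel_left, smul_smul, inv_mul_cancel₀ h0, one_smul] at h1
    simpa using h1
  have hz_ray : z ∈ ray := ⟨1, self_mem_Ici, by simp⟩
  rcases hray.subset_interior_or_of_disjoint_frontier hdisj with h | h
  · have hb := P.isCompact_region.isBounded.subset (h.trans interior_subset)
    rw [Metric.isBounded_iff_subset_closedBall (p 0)] at hb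
    obtain ⟨r, hr⟩ := hb
    have hne : z - p 0 ≠ 0 := by
      intro e
      rw [sub_eq_zero.1 e] at hzS
      have h3 := P.three_le
      exact hzS (mem_iUnion.2 ⟨⟨0, by omega⟩, (vert_mem_triangle (hp.pos 0 (by omega))).1⟩)
    have hn : 0 < ‖z - p 0‖ := norm_pos_iff.2 hne
    have h1 := hr ⟨max 1 ((|r| + 1) / ‖z - p 0‖), mem_Ici.2 (le_max_left _ _), rfl⟩
    rw [mem_closedBall_iff_norm, add_sub_cancel_left, norm_smul, Real.norm_of_nonneg
      (le_max_of_le_left zero_le_one)] at h1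
    have h2 : |r| + 1 ≤ max 1 ((|r| + 1) / ‖z - p 0‖) * ‖z - p 0‖ :=
      (div_le_iff₀ hn).1 (le_max_right _ _)
    linarith [le_abs_self r]
  · exact h hz_ray (subset_closure hz)

theorem disjoint_interior_face {i j : Fin (n - 2)} (hij : i ≠ j) :
    Disjoint (interior (hp.face i).region) (hp.face j).region := by
  rcases lt_or_gt_of_ne hij with h | h
  · obtain ⟨w, hw, h1, h2, h3, h4⟩ := hp.separated i i.2 j j.2 h
    exact disjoint_interior_triangle _ _ hw h1 h2 h3 h4
  · obtain ⟨w, hw, h1, h2, h3, h4⟩ := hp.separated j j.2 i i.2 h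
    exact disjoint_interior_triangle _ _ (neg_ne_zero.2 hw) (by simpa using h3) (by simpa using h4)
      (by simpa using h1) (by simpa using h2)

theorem disjoint_interior_face_frontier (i : Fin (n - 2)) :
    Disjoint (interior (hp.face i).region) (frontier P.region) := by
  rw [P.frontier_region, Set.disjoint_iUnion_right]
  intro t
  obtain ⟨j, s, -, e⟩ := hp.exists_face_side t
  change Disjoint _ (P.side t)
  rw [← e]
  by_cases hij : i = j
  · subst hij
    exact disjoint_interior_frontier.mono_right ((hp.face i).side_subset_frontier s)
  · exact (hp.disjoint_interior_face hij).mono_right ((hp.face j).side_subset_region s)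

theorem disjoint_diagonal_face {k i : ℕ} (hk : 2 ≤ k) (hk' : k < n - 1) (hi : i < n - 2)
    (h1 : k ≠ i + 1) (h2 : k ≠ i + 2) :
    Disjoint (openSegment ℝ (p 0) (p k)) (hp.face ⟨i, hi⟩).region := by
  obtain ⟨w, hw1, hw2, hw3⟩ := hp.diagonal k hk hk' i hi h1 h2
  rw [Set.disjoint_left]
  intro z hz hz'
  obtain ⟨h3, -, h5⟩ := (mem_triangle (hp.pos i hi)).1 hz'
  have e := map_sub_triangle (a := p 0) (b := p (i + 1)) (c := p (i + 2)) w z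
  have hpos := hp.pos i hi
  have hn1 := mul_nonneg h3 hw2
  have hn2 := mul_nonneg h5 hw1
  rw [openSegment_eq_image] at hz
  obtain ⟨t, ⟨ht0, ht1⟩, rfl⟩ := hz
  have e2 : (1 - t) • p 0 + t • p k - p 0 = t • (p k - p 0) := by
    rw [sub_smul, one_smul, smul_sub]; abel
  have := mul_pos hpos (mul_pos ht0 (neg_pos.2 hw3))
  have e3 : w ((1 - t) • p 0 + t • p k - p 0) = t * w (p k - p 0) := by
    rw [e2, map_smul, smul_eq_mul]
  simp only [e3] at e
  linarith

include hp in
theorem disjoint_diagonal_frontier {k : ℕ} (hk : 2 ≤ k) (hk' : k < n - 1) :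
    Disjoint (openSegment ℝ (p 0) (p k)) (frontier P.region) := by
  rw [P.frontier_region, Set.disjoint_iUnion_right]
  intro t
  change Disjoint _ (P.side t)
  obtain ⟨j, s, e, e'⟩ := hp.exists_face_side t
  obtain ⟨l, hl, el, -⟩ := hp.side_eq_segment t
  rw [← e']
  have hmain : ∀ s', (hp.face j).openSide s' = openSegment ℝ (p 0) (p k) →
      Disjoint (openSegment ℝ (p 0) (p k)) ((hp.face j).side s) := by
    intro s' hs'
    rw [← hs']
    by_cases hss : s = s'
    · subst hss
      have h1 : segment ℝ (p 0) (p k) = segment ℝ (p l) (p (l + 1)) := by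
        rw [← closure_openSegment, ← closure_openSegment, ← hs', e, el]
      have h0k : p 0 ≠ p k := fun h => by
        have := hp.injOn 0 (by omega) k (by omega) h
        omega
      rcases endpoints_eq_of_segment_eq h0k h1 with ⟨h2, h3⟩ | ⟨h2, h3⟩
      · obtain rfl := hp.injOn 0 (by omega) l hl h2
        have := hp.injOn k (by omega) (0 + 1) (by omega) h3
        omega
      · have h4 := hp.injOn k (by omega) l hl h3
        have := hp.injOn 0 (by omega) (l + 1) (by omega) h2
        omega
    · exact Set.disjoint_left.2 fun z hz => (hp.face j).notMem_side_of_mem_openSide hss hz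
  by_cases h1 : k = j + 1
  · exact hmain 0 (by rw [face, triangle_openSide_zero, h1])
  by_cases h2 : k = j + 2
  · exact hmain 2 (by rw [face, triangle_openSide_two, h2, openSegment_symm])
  exact (hp.disjoint_diagonal_face hk hk' j.2 h1 h2).mono_right ((hp.face j).side_subset_region s)

theorem diagonal_subset_face {k : ℕ} {i : Fin (n - 2)} (hi : k = i + 1 ∨ k = i + 2) :
    openSegment ℝ (p 0) (p k) ⊆ (hp.face i).region := by
  rcases hi with h | h
  · rw [h]
    exact (hp.face i).openSide_subset_region 0
  · rw [h, openSegment_symm]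
    exact (hp.face i).openSide_subset_region 2

theorem isPreconnected_interior_face_union {k : ℕ}
    {i : Fin (n - 2)} (hi : k = i + 1 ∨ k = i + 2) :
    IsPreconnected (interior (hp.face i).region ∪ openSegment ℝ (p 0) (p k)) := by
  refine (convex_triangle (hp.pos i i.2)).interior.isPreconnected.subset_closure subset_union_left
    (union_subset subset_closure ?_)
  exact (hp.diagonal_subset_face hi).trans (triangle_subset_closure_interior _)

/-- Consecutive triangles share a diagonal, which does not meet the frontier. Each triangle interior
together with the diagonal is connected, so both are on the same side of the frontier as the
diagonal. -/
theorem interior_face_subset_iff_succ {i : ℕ} (hi : i + 1 < n - 2) :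
    ∀ i' i'' : Fin (n - 2), i' = ⟨i, by omega⟩ → i'' = ⟨i + 1, hi⟩ →
    (interior (hp.face i').region ⊆ interior P.region ↔
      interior (hp.face i'').region ⊆ interior P.region) := by
  rintro i' i'' rfl rfl
  have hd := hp.disjoint_diagonal_frontier (k := i + 2) (by omega) (by omega)
  have h1 := hp.isPreconnected_interior_face_union (k := i + 2)
    (i := ⟨i, by omega⟩) (.inr rfl)
  have h2 := hp.isPreconnected_interior_face_union (k := i + 2)
    (i := ⟨i + 1, hi⟩) (.inl rfl)
  have hne : (openSegment ℝ (p 0) (p (i + 2))).Nonempty :=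
    ⟨_, 1 / 2, 1 / 2, by norm_num, by norm_num, by norm_num, rfl⟩
  obtain ⟨y, hy⟩ := hne
  have key : ∀ j : Fin (n - 2),
      IsPreconnected (interior (hp.face j).region ∪ openSegment ℝ (p 0) (p (i + 2))) →
      (interior (hp.face j).region ⊆ interior P.region ↔ y ∈ interior P.region) := by
    intro j hj
    rcases hj.subset_interior_or_of_disjoint_frontier
      (Set.disjoint_union_left.2 ⟨hp.disjoint_interior_face_frontier j, hd⟩) with h | h
    · exact ⟨fun _ => h (.inr hy), fun _ => subset_union_left.trans h⟩
    · refine ⟨fun h' => ?_, fun h' => ?_⟩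
      · obtain ⟨x, hx⟩ := (hp.face j).interior_nonempty
        exact (h (.inl hx) (subset_closure (interior_subset (h' hx)))).elim
      · exact (h (.inr hy) (subset_closure (interior_subset h'))).elim
  rw [key _ h1, key _ h2]

/-- The triangles cover the polygon, so one of them meets its interior and is contained in it by
connectedness; this passes to all the others across the diagonals. -/
theorem interior_face_subset (i : Fin (n - 2)) :
    interior (hp.face i).region ⊆ interior P.region := by
  have hall : ∀ j : ℕ, ∀ hj : j < n - 2, (interior (hp.face ⟨j, hj⟩).region ⊆ interior P.region ↔
      interior (hp.face ⟨0, by omega⟩).region ⊆ interior P.region) := by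
    intro j
    induction j with
    | zero => intro hj; rfl
    | succ j ih =>
      intro hj
      rw [← ih (by omega)]
      exact (hp.interior_face_subset_iff_succ hj _ _ rfl rfl).symm
  obtain ⟨z, hz⟩ := P.interior_nonempty
  obtain ⟨j, hj⟩ := mem_iUnion.1 (hp.region_subset (interior_subset hz))
  obtain ⟨y, hy, hy'⟩ := mem_closure_iff.1
    (triangle_subset_closure_interior (hp.pos j j.2) hj) _ isOpen_interior hz
  have hj' : interior (hp.face j).region ⊆ interior P.region := by
    rcases (convex_triangle (hp.pos j j.2)).interior.isPreconnected
      |>.subset_interior_or_of_disjoint_frontier (hp.disjoint_interior_face_frontier j) with h | h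
    · exact h
    · exact (h hy' (subset_closure (interior_subset hy))).elim
  exact (hall i i.2).2 ((hall j j.2).1 hj')

theorem face_subset (i : Fin (n - 2)) : (hp.face i).region ⊆ P.region :=
  (triangle_subset_closure_interior (hp.pos i i.2)).trans
    (closure_minimal ((hp.interior_face_subset i).trans interior_subset) P.isClosed_region)

include hp in
theorem diagonal_subset_interior {k : ℕ} (hk : 2 ≤ k) (hk' : k < n - 1) :
    openSegment ℝ (p 0) (p k) ⊆ interior P.region := by
  have h := hp.disjoint_diagonal_frontier hk hk'
  have h1 : openSegment ℝ (p 0) (p k) ⊆ P.region :=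
    (hp.diagonal_subset_face (i := ⟨k - 1, by omega⟩)
      (.inl (by simp only; omega))).trans (hp.face_subset _)
  intro z hz
  by_contra hn
  exact Set.disjoint_left.1 h hz ⟨subset_closure (h1 hz), hn⟩

/-- A side of a triangle of the fan is a side of the polygon or a diagonal. -/
theorem openSide_face_cases (i : Fin (n - 2)) (s : ZMod 3) :
    (∃ t, (hp.face i).openSide s = P.openSide t) ∨
      ∃ k, 2 ≤ k ∧ k < n - 1 ∧ (hp.face i).openSide s = openSegment ℝ (p 0) (p k) := by
  have hi := i.2
  have hs : s = 0 ∨ s = 1 ∨ s = 2 := by revert s; decide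
  rcases hs with rfl | rfl | rfl
  · rw [face, triangle_openSide_zero]
    by_cases h0 : (i : ℕ) = 0
    · obtain ⟨t, ht⟩ := hp.side 0
      exact .inl ⟨t, by rw [h0]; exact ht⟩
    · exact .inr ⟨i + 1, by omega, by omega, rfl⟩
  · rw [face, triangle_openSide_one]
    exact .inl (hp.side (i + 1))
  · rw [face, triangle_openSide_two]
    by_cases h0 : (i : ℕ) + 2 = n - 1
    · obtain ⟨t, ht⟩ := hp.side (n - 1)
      refine .inl ⟨t, ?_⟩
      rw [← ht, h0, show n - 1 + 1 = n by omega, hp.periodic]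
    · exact .inr ⟨i + 2, by omega, by omega, openSegment_symm _ _ _⟩

theorem openSide_face_eq_or_disjoint (i : Fin (n - 2)) (s : ZMod 3) (i' : Fin (n - 2))
    (s' : ZMod 3) : (hp.face i).openSide s = (hp.face i').openSide s' ∨
      Disjoint ((hp.face i).openSide s) ((hp.face i').openSide s') := by
  rcases hp.openSide_face_cases i s with ⟨t, e⟩ | ⟨k, hk, hk', e⟩ <;>
    rcases hp.openSide_face_cases i' s' with ⟨t', e'⟩ | ⟨k', hk1, hk1', e'⟩ <;> rw [e, e']
  · by_cases h : t = t'
    · exact .inl (by rw [h])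
    · exact .inr (Set.disjoint_left.2 fun z hz hz' => h (P.eq_of_mem_openSide hz hz'))
  · exact .inr ((P.disjoint_openSide_interior t).mono_right (hp.diagonal_subset_interior hk1 hk1'))
  · exact .inr ((P.disjoint_openSide_interior t').symm.mono_left
      (hp.diagonal_subset_interior hk hk'))
  · by_cases h : k = k'
    · exact .inl (by rw [h])
    · right
      by_cases h1 : k = k' + 1
      · exact (hp.disjoint_diagonal_face hk hk' (i := k' - 2) (by omega) (by omega)
          (by omega)).mono_right (hp.diagonal_subset_face
            (i := ⟨k' - 2, by omega⟩) (.inr (by simp only; omega)))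
      · exact (hp.disjoint_diagonal_face hk hk' (i := k' - 1) (by omega) (by omega)
          (by omega)).mono_right (hp.diagonal_subset_face
            (i := ⟨k' - 1, by omega⟩) (.inl (by simp only; omega)))

theorem openSide_face_subset_interior {i : Fin (n - 2)} {s : ZMod 3}
    (h : ¬∃ t, (hp.face i).openSide s = P.openSide t) :
    (hp.face i).openSide s ⊆ interior P.region := by
  obtain ⟨k, hk, hk', e⟩ := (hp.openSide_face_cases i s).resolve_left h
  rw [e]
  exact hp.diagonal_subset_interior hk hk'

theorem mem_range_vert_iff {i : Fin (n - 2)} {z : ℂ} (hz : z ∈ (hp.face i).region) :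
    z ∈ range P.vert ↔ z ∈ range (hp.face i).vert := by
  constructor
  · rintro ⟨l, rfl⟩
    have hint : P.vert l ∉ interior P.region := fun h =>
      (P.side_subset_frontier l (left_mem_segment ℝ _ _)).2 h
    rcases (hp.face i).mem_region_cases hz with h | h | ⟨s, h⟩
    · exact (hint (hp.interior_face_subset i h)).elim
    · exact h
    · by_cases hs : ∃ t, (hp.face i).openSide s = P.openSide t
      · obtain ⟨t, e⟩ := hs
        rw [e] at h
        exact (P.notMem_range_vert h ⟨l, rfl⟩).elim
      · exact (hint (hp.openSide_face_subset_interior hs h)).elim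
  · rw [face, range_triangle_vert]
    rintro (rfl | rfl | rfl)
    all_goals exact hp.mem_range _

end IsFan

end PlanarPolygon

/-! ### Triangulating the surface -/

namespace DilationStructure

variable {X : Type*} [TopologicalSpace X] {D : DilationStructure X}

open PlanarPolygon in
/-- A polygon with a fan can be replaced by the triangles of the fan. -/
theorem IsDecomposition.fan {ι : Type} {n : ι → ℕ} {face : ∀ j, PlanarPolygon (n j)}
    {map : ι → ℂ → X} (hT : D.IsDecomposition face map) {p : ι → ℕ → ℂ}
    (hp : ∀ j, (face j).IsFan (p j)) :
    D.IsDecomposition (ι := Σ j, Fin (n j - 2)) (n := fun _ => 3) (fun j => (hp j.1).face j.2)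
      fun j => map j.1 := by
  have hsub : ∀ (j : Σ j, Fin (n j - 2)), ((hp j.1).face j.2).region ⊆ (face j.1).region :=
    fun j => (hp j.1).face_subset j.2
  refine ⟨fun j => ⟨?_, fun z hz => ?_, fun z hz c hc hzc => ?_⟩, fun x => ?_, ?_, ?_, ?_, ?_⟩
  · exact (hT.isPolygonMap j.1).continuousOn.mono (hsub j)
  · rw [(hT.isPolygonMap j.1).sing_iff z (hsub j hz), (hp j.1).mem_range_vert_iff hz]
  · have hss : ((hp j.1).face j.2).region \ range ((hp j.1).face j.2).vert ⊆
        (face j.1).region \ range (face j.1).vert := fun y hy =>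
      ⟨hsub j hy.1, fun h => hy.2 (((hp j.1).mem_range_vert_iff hy.1).1 h)⟩
    obtain ⟨g, hg, h⟩ := (hT.isPolygonMap j.1).dilation z (hss hz) c hc hzc
    exact ⟨g, hg, nhdsWithin_mono z hss h⟩
  · obtain ⟨j, z, hz, e⟩ := hT.surjective x
    obtain ⟨i, hi⟩ := mem_iUnion.1 ((hp j).region_subset hz)
    exact ⟨⟨j, i⟩, z, hi, e⟩
  · rintro ⟨j, i⟩ z hz ⟨j', i'⟩ z' hz' e
    obtain ⟨rfl, rfl⟩ := hT.interior_injective j z ((hp j).interior_face_subset i hz) j' z'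
      (hsub ⟨j', i'⟩ hz') e
    refine ⟨?_, rfl⟩
    by_contra hne
    exact Set.disjoint_left.1 ((hp j).disjoint_interior_face (i := i) (j := i')
      fun h => hne (by rw [h])) hz hz'
  · rintro ⟨j, i⟩ s
    by_cases h : ∃ t, ((hp j).face i).openSide s = (face j).openSide t
    · obtain ⟨t, e⟩ := h
      simp only [e]
      exact hT.side_injective j t
    · intro z hz w hw e
      have hi := (hp j).openSide_face_subset_interior h
      exact (hT.interior_injective j z (hi hz) j w (interior_subset (hi hw)) e).2
  · rintro ⟨j, i⟩ s ⟨j', i'⟩ s'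
    by_cases h : ∃ t, ((hp j).face i).openSide s = (face j).openSide t
    · obtain ⟨t, e⟩ := h
      by_cases h' : ∃ t, ((hp j').face i').openSide s' = (face j').openSide t
      · obtain ⟨t', e'⟩ := h'
        simp only [e, e']
        exact hT.side_match j t j' t'
      · right
        have hi := (hp j').openSide_face_subset_interior h'
        rw [Set.disjoint_left]
        rintro _ ⟨z, hz, rfl⟩ ⟨w, hw, ew⟩
        rw [e] at hz
        exact hT.not_interior_of_openSide hz ew.symm (hi hw)
    · have hi := (hp j).openSide_face_subset_interior h
      by_cases hdis : Disjoint (map j '' ((hp j).face i).openSide s)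
          (map j' '' ((hp j').face i').openSide s')
      · exact .inr hdis
      · left
        obtain ⟨_, ⟨z, hz, rfl⟩, ⟨w, hw, ew⟩⟩ := Set.not_disjoint_iff.1 hdis
        obtain ⟨rfl, rfl⟩ := hT.interior_injective j z (hi hz) j' w
          (hsub ⟨j', i'⟩ (((hp j').face i').openSide_subset_region s' hw)) ew.symm
        rcases (hp j).openSide_face_eq_or_disjoint i s i' s' with h1 | h1
        · simp only [h1]
        · exact (Set.disjoint_left.1 h1 hz hw).elim
  · intro x hx
    obtain ⟨j, hj⟩ := mem_iUnion.1 (hT.bdry_subset hx)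
    obtain ⟨t, ht⟩ := mem_iUnion.1 hj
    obtain ⟨i, s, -, e⟩ := (hp j).exists_face_side t
    refine mem_iUnion.2 ⟨⟨j, i⟩, mem_iUnion.2 ⟨s, ?_⟩⟩
    simp only [e]
    exact ht

/-- A polygonable one-holed torus is triangulated by at most three triangles. -/
theorem IsPolygonable.exists_triangulation {s : X} (hD : D.IsTorusWithBoundarySingularity s)
    (h : D.IsPolygonable) : ∃ (ι : Type) (_ : Fintype ι) (V : ι → ZMod 3 → ℂ)
      (hV : ∀ j, IsConvexCycle (V j)) (map : ι → ℂ → X), Fintype.card ι ≤ 3 ∧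
      D.IsDecomposition (n := fun _ => 3) (fun j => (hV j).polygon le_rfl) map := by
  obtain ⟨T⟩ := h
  have hT := T.isDecomposition
  choose p hp using fun j => (T.face j).exists_isFan (hT.numSides_le hD j)
  have h1 := hT.fan hp
  refine ⟨Σ j, Fin (T.numSides j - 2), inferInstance,
    fun j => triangleVert (p j.1 0) (p j.1 (j.2 + 1)) (p j.1 (j.2 + 2)),
    fun j => isConvexCycle_triangleVert ((hp j.1).pos j.2 j.2.2), _, ?_, h1⟩
  -- Applied to F triangles, the count of sides reads 3 F ≤ 3 + 2 F.
  have h2 := h1.sum_numSides_le hD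
  simp only [Finset.sum_const, Finset.card_univ, smul_eq_mul] at h2
  omega

end DilationStructure

/-! ### Gluing convex faces -/

theorem crossForm_injective : Function.Injective crossForm := by
  intro e e' h
  have h1 := LinearMap.congr_fun h 1
  have h2 := LinearMap.congr_fun h Complex.I
  simp only [crossForm_apply, Complex.one_re, Complex.one_im, Complex.I_re, Complex.I_im] at h1 h2
  exact Complex.ext (by linarith) (by linarith)

theorem crossForm_smul (t : ℝ) (e : ℂ) : crossForm (t • e) = t • crossForm e := by
  refine LinearMap.ext fun z => ?_
  simp only [LinearMap.smul_apply, crossForm_apply, Complex.smul_re, Complex.smul_im, smul_eq_mul]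
  ring

theorem IsDilation.exists_ratio {g : ℂ → ℂ} (hg : IsDilation g) :
    ∃ a : ℝ, 0 < a ∧ ∀ z w, g z - g w = a • (z - w) := by
  obtain ⟨a, ha, b, h⟩ := hg
  refine ⟨a, ha, fun z w => ?_⟩
  rw [h, h, Complex.real_smul]
  ring

/-- The forms of the other sides are positive near the point, so only side `i` matters. The
counterclockwise orientation fixes the sign that `exists_isHalfPlaneAt` leaves open. -/
theorem IsConvexCycle.isHalfPlaneAt {n : ℕ} {v : ZMod n → ℂ} (h3 : 3 ≤ n) (hv : IsConvexCycle v)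
    {i : ZMod n} {z : ℂ} (hz : z ∈ openSegment ℝ (v i) (v (i + 1))) :
    IsHalfPlaneAt (hv.polygon h3).region z (crossForm (v (i + 1) - v i)) := by
  have : NeZero n := ⟨by omega⟩
  have h1 : ∀ᶠ w in 𝓝 z, ∀ j, j ≠ i → 0 < orient (v j) (v (j + 1)) w := by
    rw [eventually_all]
    intro j
    by_cases hj : j = i
    · exact Eventually.of_forall fun w h => (h hj).elim
    · have hc : Continuous fun w => orient (v j) (v (j + 1)) w := by
        unfold orient
        fun_prop
      filter_upwards [hc.continuousAt.eventually
        (lt_mem_nhds (hv.orient_pos_of_openSegment h3 hj hz))] with w hw _ using hw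
  have h0 := orient_eq_zero_of_mem_segment (openSegment_subset_segment ℝ _ _ hz)
  filter_upwards [h1] with w hw
  rw [← orient_eq_crossForm_sub h0]
  constructor
  · refine ⟨fun h => h i, fun h j => ?_⟩
    by_cases hj : j = i
    · rw [hj]; exact h
    · exact (hw j hj).le
  · refine (hv.mem_interior_iff h3).trans ⟨fun h => h i, fun h j => ?_⟩
    by_cases hj : j = i
    · rw [hj]; exact h
    · exact hw j hj

namespace DilationStructure

variable {X : Type*} [TopologicalSpace X] {D : DilationStructure X}

namespace IsDecomposition

variable {ι : Type} {n : ι → ℕ} {V : ∀ j, ZMod (n j) → ℂ} {h3 : ∀ j, 3 ≤ n j}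
  {hV : ∀ j, IsConvexCycle (V j)} {map : ι → ℂ → X}

/-- The gluing of two sides of convex faces reverses the orientation of the sides. -/
theorem exists_convex_gluing (hT : D.IsDecomposition (fun j => (hV j).polygon (h3 j)) map) {s : X}
    (hs : D.sing = {s}) {h h' : Σ j, ZMod (n j)} (hne : h ≠ h')
    (he : edge (fun j => (hV j).polygon (h3 j)) map h =
      edge (fun j => (hV j).polygon (h3 j)) map h') :
    ∃ g, IsDilation g ∧ g (V h.1 h.2) = V h'.1 (h'.2 + 1) ∧ g (V h.1 (h.2 + 1)) = V h'.1 h'.2 ∧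
      ∀ z ∈ segment ℝ (V h.1 h.2) (V h.1 (h.2 + 1)), map h'.1 (g z) = map h.1 z := by
  obtain ⟨g, hg, himg, hmap, hor⟩ := hT.exists_gluing_endpoints he
  have hv : ∀ j i, map j (V j i) = s := fun j i => hT.map_vert hs j i
  obtain ⟨a, ha, hga⟩ := hg.exists_ratio
  have hend : g (V h.1 h.2) = V h'.1 (h'.2 + 1) ∧ g (V h.1 (h.2 + 1)) = V h'.1 h'.2 := by
    rcases hor with ⟨e1, e2, -⟩ | ⟨e1, e2, -⟩
    -- If the gluing preserved the direction of the sides, the side vectors would be positive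
    -- multiples of each other, while the half-planes are opposite.
    · exfalso
      change g (V h.1 h.2) = V h'.1 h'.2 at e1
      change g (V h.1 (h.2 + 1)) = V h'.1 (h'.2 + 1) at e2
      obtain ⟨y, hy⟩ := edge_nonempty (face := fun j => (hV j).polygon (h3 j)) (map := map) h
      have hy' := he ▸ hy
      obtain ⟨z, hz, rfl⟩ := hy
      obtain ⟨z', hz', ez⟩ := hy'
      have n0 := crossForm_ne_zero (sideVector_ne_zero (fun j => (hV j).polygon (h3 j)) h)
      have n1 := crossForm_ne_zero (sideVector_ne_zero (fun j => (hV j).polygon (h3 j)) h')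
      obtain ⟨t, ht, e⟩ := hT.exists_opposite hne hz hz' ez.symm
        ((hV h.1).isHalfPlaneAt (h3 h.1) hz) ((hV h'.1).isHalfPlaneAt (h3 h'.1) hz') n0 n1
      rw [← crossForm_smul] at e
      have e3 := crossForm_injective e
      have e4 := hga (V h.1 (h.2 + 1)) (V h.1 h.2)
      rw [e1, e2] at e4
      rw [e4, smul_smul] at e3
      have e5 : (1 - -t * a) • (V h.1 (h.2 + 1) - V h.1 h.2) = 0 := by
        rw [sub_smul, one_smul, sub_eq_zero]
        exact e3
      rcases smul_eq_zero.1 e5 with h0 | h0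
      · nlinarith [mul_pos ht ha]
      · exact sideVector_ne_zero (fun j => (hV j).polygon (h3 j)) h h0
    · exact ⟨e1, e2⟩
  refine ⟨g, hg, hend.1, hend.2, fun z hz => ?_⟩
  rw [segment_eq_image] at hz
  obtain ⟨t, ⟨h0, h1⟩, rfl⟩ := hz
  -- The gluing identity is known on the open side; at the endpoints both members are the unique
  -- singularity.
  rcases h0.eq_or_lt with rfl | h0
  · simp [hend.1, hv]
  rcases h1.eq_or_lt with rfl | h1
  · simp [hend.2, hv]
  · refine hmap _ ?_
    rw [PlanarPolygon.openSide, openSegment_eq_image]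
    exact ⟨t, ⟨h0, h1⟩, rfl⟩

/-- Two consecutive sides of a convex face are not parallel, hence not glued. -/
theorem edge_ne_succ (hT : D.IsDecomposition (fun j => (hV j).polygon (h3 j)) map) {s : X}
    (hs : D.sing = {s}) (j : ι) (i : ZMod (n j)) :
    edge (fun j => (hV j).polygon (h3 j)) map ⟨j, i⟩ ≠
      edge (fun j => (hV j).polygon (h3 j)) map ⟨j, i + 1⟩ := by
  intro he
  have h1 := ZMod.one_ne_zero_of_three_le (h3 j)
  have h2 := ZMod.two_ne_zero_of_three_le (h3 j)
  have hne : (⟨j, i⟩ : Σ j, ZMod (n j)) ≠ ⟨j, i + 1⟩ := by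
    intro e
    have := eq_of_heq (Sigma.mk.inj e).2
    exact h1 (by linear_combination -this)
  obtain ⟨g, hg, e1, e2, -⟩ := hT.exists_convex_gluing hs hne he
  obtain ⟨a, ha, hga⟩ := hg.exists_ratio
  have e3 := hga (V j i) (V j (i + 1))
  rw [e1, e2] at e3
  have hpos := hV j i (i + 1 + 1) (fun e => h2 (by linear_combination e))
    (fun e => h1 (by linear_combination e))
  -- The second side would run back along the line of the first one, so three consecutive vertices
  -- would be collinear.
  have e4 : V j (i + 1 + 1) = V j (i + 1) + a • (V j i - V j (i + 1)) := by
    rw [← e3]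
    simp
  rw [e4] at hpos
  simp only [orient, Complex.sub_re, Complex.sub_im, Complex.add_re, Complex.add_im,
    Complex.smul_re, Complex.smul_im, smul_eq_mul] at hpos
  nlinarith

end IsDecomposition

end DilationStructure

/-! ### Moving triangles by dilations and merging a fan into one face -/

namespace DilationStructure

variable {X : Type*} [TopologicalSpace X] {D : DilationStructure X}

/-- The faces of a decomposition into convex polygons can be moved by dilations. -/
theorem IsDecomposition.reposition {ι ι' : Type} (e : ι' ≃ ι) {m : ℕ} (h3 : 3 ≤ m)
    {V : ι → ZMod m → ℂ} {hV : ∀ j, IsConvexCycle (V j)} {V' : ι' → ZMod m → ℂ}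
    {hV' : ∀ j, IsConvexCycle (V' j)} {map : ι → ℂ → X}
    (hT : D.IsDecomposition (n := fun _ => m) (fun j => (hV j).polygon h3) map)
    {r : ι' → ZMod m} {ψ : ι' → ℂ → ℂ} (hψ : ∀ j, IsDilation (ψ j))
    (hr : ∀ j i, ψ j (V' j i) = V (e j) (i + r j)) :
    D.IsDecomposition (n := fun _ => m) (fun j => (hV' j).polygon h3) fun j z =>
      map (e j) (ψ j z) := by
  -- A dilation multiplies areas by the square of its ratio, and the numbering of the vertices is
  -- shifted by `r j`; the signs that define regions and interiors are therefore preserved.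
  have hor : ∀ j, ∃ c : ℝ, 0 < c ∧ ∀ i z, orient (V (e j) (i + r j)) (V (e j) (i + r j + 1)) (ψ j z)
      = c * orient (V' j i) (V' j (i + 1)) z := by
    intro j
    obtain ⟨a, ha, h⟩ := (hψ j).exists_ratio
    refine ⟨a * a, mul_pos ha ha, fun i z => ?_⟩
    have e1 : i + r j + 1 = i + 1 + r j := by ring
    rw [e1, ← hr, ← hr]
    unfold orient
    rw [h, h]
    simp only [Complex.smul_re, Complex.smul_im, smul_eq_mul]
    ring
  have hreg : ∀ j z, ψ j z ∈ ((hV (e j)).polygon h3).region ↔ z ∈ ((hV' j).polygon h3).region := by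
    intro j z
    obtain ⟨c, hc, h⟩ := hor j
    constructor
    · intro hz i
      have := hz (i + r j)
      rw [h] at this
      exact nonneg_of_mul_nonneg_right this hc
    · intro hz i
      have := mul_nonneg hc.le (hz (i - r j))
      rw [← h] at this
      simpa using this
  have hint : ∀ j z, ψ j z ∈ interior ((hV (e j)).polygon h3).region ↔
      z ∈ interior ((hV' j).polygon h3).region := by
    intro j z
    obtain ⟨c, hc, h⟩ := hor j
    refine ((hV (e j)).mem_interior_iff h3).trans (Iff.trans ?_ ((hV' j).mem_interior_iff h3).symm)
    constructor
    · intro hz i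
      have := hz (i + r j)
      rw [h] at this
      exact (mul_pos_iff_of_pos_left hc).1 this
    · intro hz i
      have := mul_pos hc (hz (i - r j))
      rw [← h] at this
      simpa using this
  have hvert : ∀ j z, ψ j z ∈ range ((hV (e j)).polygon h3).vert ↔
      z ∈ range ((hV' j).polygon h3).vert := by
    intro j z
    constructor
    · rintro ⟨i, hi⟩
      refine ⟨i - r j, (hψ j).injective ?_⟩
      change ψ j (V' j _) = _
      rw [hr, sub_add_cancel]
      exact hi
    · rintro ⟨i, rfl⟩
      exact ⟨_, (hr j i).symm⟩
  have hside : ∀ j i, ψ j '' ((hV' j).polygon h3).side i =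
      ((hV (e j)).polygon h3).side (i + r j) := by
    intro j i
    refine ((hψ j).image_segment _ _).trans ?_
    change segment ℝ (ψ j (V' j i)) (ψ j (V' j (i + 1))) = segment ℝ _ _
    rw [hr, hr, add_right_comm]
    rfl
  have hoside : ∀ j i, ψ j '' ((hV' j).polygon h3).openSide i =
      ((hV (e j)).polygon h3).openSide (i + r j) := by
    intro j i
    refine ((hψ j).image_openSegment _ _).trans ?_
    change openSegment ℝ (ψ j (V' j i)) (ψ j (V' j (i + 1))) = openSegment ℝ _ _
    rw [hr, hr, add_right_comm]
    rfl
  have himg : ∀ j i, (fun z => map (e j) (ψ j z)) '' ((hV' j).polygon h3).openSide i =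
      map (e j) '' ((hV (e j)).polygon h3).openSide (i + r j) := by
    intro j i
    rw [← hoside, image_image]
  refine ⟨fun j => ⟨?_, fun z hz => ?_, fun z hz c hc hzc => ?_⟩, fun x => ?_, ?_, ?_, ?_, ?_⟩
  · exact (hT.isPolygonMap (e j)).continuousOn.comp (hψ j).continuous.continuousOn
      fun z hz => (hreg j z).2 hz
  · rw [← hvert]
    exact (hT.isPolygonMap (e j)).sing_iff _ ((hreg j z).2 hz)
  · obtain ⟨g, hg, h⟩ := (hT.isPolygonMap (e j)).dilation (ψ j z)
      ⟨(hreg j z).2 hz.1, fun h => hz.2 ((hvert j z).1 h)⟩ c hc hzc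
    refine ⟨fun z => g (ψ j z), hg.comp (hψ j), ?_⟩
    refine (tendsto_nhdsWithin_iff.2 ⟨((hψ j).continuous.tendsto z).mono_left nhdsWithin_le_nhds,
      ?_⟩).eventually h
    filter_upwards [self_mem_nhdsWithin] with y hy
    exact ⟨(hreg j y).2 hy.1, fun h => hy.2 ((hvert j y).1 h)⟩
  · obtain ⟨j, z, hz, rfl⟩ := hT.surjective x
    obtain ⟨φ, -, -, h2⟩ := (hψ (e.symm j)).exists_inverse
    obtain ⟨j, rfl⟩ := e.surjective j
    rw [e.symm_apply_apply] at h2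
    refine ⟨j, φ z, (hreg j _).1 ?_, ?_⟩
    · rw [h2]; exact hz
    · simp only [h2]
  · intro j z hz j' z' hz' h
    obtain ⟨h1, h2⟩ := hT.interior_injective (e j) _ ((hint j z).2 hz) (e j') _
      ((hreg j' z').2 hz') h
    obtain rfl := e.injective h1
    exact ⟨rfl, (hψ j).injective h2⟩
  · intro j i z hz w hw h
    refine (hψ j).injective (hT.side_injective (e j) (i + r j) ?_ ?_ h)
    · exact hoside j i ▸ mem_image_of_mem _ hz
    · exact hoside j i ▸ mem_image_of_mem _ hw
  · intro j i j' i'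
    rw [himg, himg]
    exact hT.side_match _ _ _ _
  · intro x hx
    obtain ⟨j, hj⟩ := mem_iUnion.1 (hT.bdry_subset hx)
    obtain ⟨i, hi⟩ := mem_iUnion.1 hj
    obtain ⟨j, rfl⟩ := e.surjective j
    refine mem_iUnion.2 ⟨j, mem_iUnion.2 ⟨i - r j, ?_⟩⟩
    rw [← image_image (map (e j)), hside, sub_add_cancel]
    exact hi

end DilationStructure

namespace DilationStructure

variable {X : Type*} [TopologicalSpace X] {D : DilationStructure X}

namespace IsDecomposition

section Merge

variable {n : ℕ} {P : PlanarPolygon n} {p : ℕ → ℂ} {hp : P.IsFan p} {G : Fin (n - 2) → ℂ → X}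
  {s : X}

omit [TopologicalSpace X] in
/-- The two half-edges of a diagonal of a fan. -/
theorem edge_diagonal {k : ℕ} (hk : 2 ≤ k) (hk' : k < n - 1)
    (hG : ∀ z ∈ openSegment ℝ (p 0) (p k), G ⟨k - 2, by omega⟩ z = G ⟨k - 1, by omega⟩ z) :
    (hp.face ⟨k - 2, by omega⟩).openSide 2 = openSegment ℝ (p 0) (p k) ∧
    (hp.face ⟨k - 1, by omega⟩).openSide 0 = openSegment ℝ (p 0) (p k) ∧
    edge (n := fun _ => 3) (fun i => hp.face i) G ⟨⟨k - 1, by omega⟩, 0⟩ =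
      edge (n := fun _ => 3) (fun i => hp.face i) G ⟨⟨k - 2, by omega⟩, 2⟩ := by
  have e1 : (hp.face ⟨k - 2, by omega⟩).openSide 2 = openSegment ℝ (p 0) (p k) := by
    simp only [PlanarPolygon.IsFan.face, PlanarPolygon.triangle_openSide_two]
    rw [show k - 2 + 2 = k by omega, openSegment_symm]
  have e2 : (hp.face ⟨k - 1, by omega⟩).openSide 0 = openSegment ℝ (p 0) (p k) := by
    simp only [PlanarPolygon.IsFan.face, PlanarPolygon.triangle_openSide_zero]
    rw [show k - 1 + 1 = k by omega]
  refine ⟨e1, e2, ?_⟩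
  simp only [edge, e1, e2]
  exact image_congr fun z hz => (hG z hz).symm

/-- The triangles of a fan which are glued along the diagonals form a single polygon. -/
theorem merge (hT : D.IsDecomposition (n := fun _ => 3) (fun i => hp.face i) G)
    (hs : D.sing = {s})
    (hinter : ∀ i j, i ≠ j → ∀ z ∈ (hp.face i).region, z ∈ (hp.face j).region →
      z ∈ range P.vert ∨ ∃ k, 2 ≤ k ∧ k < n - 1 ∧ z ∈ openSegment ℝ (p 0) (p k))
    (hG : ∀ k (hk : 2 ≤ k) (hk' : k < n - 1), ∀ z ∈ openSegment ℝ (p 0) (p k),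
      G ⟨k - 2, by omega⟩ z = G ⟨k - 1, by omega⟩ z) :
    ∃ F : ℂ → X, D.IsDecomposition (ι := Unit) (n := fun _ => n) (fun _ => P) fun _ => F := by
  have hn := P.three_le
  have := P.neZero
  have hvert : ∀ i, ∀ z ∈ (hp.face i).region, z ∈ range P.vert → G i z = s := by
    intro i z hz h
    obtain ⟨l, rfl⟩ := (hp.mem_range_vert_iff hz).1 h
    exact hT.map_vert hs i l
  have hdiag : ∀ k, 2 ≤ k → k < n - 1 → ∀ z ∈ openSegment ℝ (p 0) (p k), ∀ i,
      z ∈ (hp.face i).region → k = i + 1 ∨ k = i + 2 := by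
    intro k hk hk' z hz i hi
    by_contra! h
    exact Set.disjoint_left.1 (hp.disjoint_diagonal_face hk hk' i.2 h.1 h.2) hz hi
  have hGd : ∀ k, 2 ≤ k → k < n - 1 → ∀ z ∈ openSegment ℝ (p 0) (p k), ∀ i j : Fin (n - 2),
      (k = i + 1 ∨ k = i + 2) → (k = j + 1 ∨ k = j + 2) → G i z = G j z := by
    intro k hk hk' z hz i j hi hj
    have key : ∀ i : Fin (n - 2), (k = i + 1 ∨ k = i + 2) → G i z = G ⟨k - 1, by omega⟩ z := by
      intro i hi
      rcases hi with h | h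
      · congr 1
        ext
        simp only
        omega
      · rw [← hG k hk hk' z hz]
        congr 1
        ext
        simp only
        omega
    rw [key i hi, key j hj]
  -- Triangles of the fan only meet at vertices, where every map has the value `s`, or on diagonals,
  -- where the maps agree by hypothesis. So they define a single map.
  have hagree : ∀ i j z, z ∈ (hp.face i).region → z ∈ (hp.face j).region → G i z = G j z := by
    intro i j z hi hj
    by_cases hij : i = j
    · rw [hij]
    rcases hinter i j hij z hi hj with h | ⟨k, hk, hk', h⟩
    · rw [hvert i z hi h, hvert j z hj h]
    · exact hGd k hk hk' z h i j (hdiag k hk hk' z h i hi) (hdiag k hk hk' z h j hj)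
  have hF : ∀ z, ∃ x, ∀ i, z ∈ (hp.face i).region → x = G i z := by
    intro z
    by_cases h : ∃ i, z ∈ (hp.face i).region
    · obtain ⟨i, hi⟩ := h
      exact ⟨G i z, fun j hj => hagree i j z hi hj⟩
    · exact ⟨s, fun i hi => (h ⟨i, hi⟩).elim⟩
  choose F hF using hF
  have hcover : ∀ z ∈ P.region, ∃ i, z ∈ (hp.face i).region := fun z hz =>
    mem_iUnion.1 (hp.region_subset hz)
  have hint : ∀ l, P.vert l ∉ interior P.region := fun l h =>
    (P.side_subset_frontier l (left_mem_segment ℝ _ _)).2 h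
  have hFside : ∀ t, ∃ i s, (hp.face i).openSide s = P.openSide t ∧
      F '' P.openSide t = G i '' (hp.face i).openSide s := by
    intro t
    obtain ⟨i, s, e, -⟩ := hp.exists_face_side t
    refine ⟨i, s, e, ?_⟩
    rw [← e]
    exact image_congr fun z hz => hF z i ((hp.face i).openSide_subset_region s hz)
  refine ⟨F, ⟨fun _ => ⟨?_, fun z hz => ?_, fun z hz c hc hzc => ?_⟩, fun x => ?_, ?_, ?_, ?_, ?_⟩⟩
  · have h1 : ContinuousOn F (⋃ i, (hp.face i).region) :=
      (locallyFinite_of_finite _).continuousOn_iUnion (fun i => (hp.face i).isClosed_region)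
        fun i => ((hT.isPolygonMap i).continuousOn).congr fun z hz => hF z i hz
    exact h1.mono hp.region_subset
  · obtain ⟨i, hi⟩ := hcover z hz
    rw [hF z i hi, (hT.isPolygonMap i).sing_iff z hi, hp.mem_range_vert_iff hi]
  · have hdil : ∀ i, z ∈ (hp.face i).region → ∃ g, IsDilation g ∧
        ∀ᶠ q in 𝓝 z, q ∈ (hp.face i).region \ range P.vert → c.toFun (F q) = g q := by
      intro i hi
      have hz' : z ∈ (hp.face i).region \ range (hp.face i).vert :=
        ⟨hi, fun h => hz.2 ((hp.mem_range_vert_iff hi).2 h)⟩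
      obtain ⟨g, hg, h⟩ := (hT.isPolygonMap i).dilation z hz' c hc (by rwa [← hF z i hi])
      refine ⟨g, hg, ?_⟩
      filter_upwards [eventually_nhdsWithin_iff.1 h] with q hq hq'
      rw [hF q i hq'.1]
      exact hq ⟨hq'.1, fun h => hq'.2 ((hp.mem_range_vert_iff hq'.1).2 h)⟩
    obtain ⟨i₀, hi₀⟩ := hcover z hz.1
    obtain ⟨g, hg, hg0⟩ := hdil i₀ hi₀
    refine ⟨g, hg, ?_⟩
    have hall : ∀ᶠ q in 𝓝 z, ∀ i, q ∈ (hp.face i).region \ range P.vert → c.toFun (F q) = g q := by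
      rw [eventually_all]
      intro i
      by_cases hi : z ∈ (hp.face i).region
      · by_cases hii : i = i₀
        · rw [hii]; exact hg0
        · obtain ⟨g', hg', hgi⟩ := hdil i hi
          obtain ⟨k, hk, hk', hzk⟩ := (hinter i i₀ hii z hi hi₀).resolve_left hz.2
          have hk1 := hdiag k hk hk' z hzk i hi
          have hk2 := hdiag k hk hk' z hzk i₀ hi₀
          have hne : p 0 ≠ p k := fun h => by
            have := hp.injOn 0 (by omega) k (by omega) h
            omega
          -- On both sides of a diagonal the map is a dilation in the chart. The two dilations agree
          -- at two distinct points of the diagonal, hence they are equal.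
          obtain ⟨w, hw, hwz, hw1, hw2⟩ := exists_ne_mem_openSegment hne hzk (hgi.and hg0)
          have hwv : w ∉ range P.vert := by
            rintro ⟨l, rfl⟩
            exact hint l (hp.diagonal_subset_interior hk hk' hw)
          have e1 : g' = g := by
            refine hg'.eq_of_eq_of_eq hg hwz ?_ ?_
            · rw [← hw1 ⟨hp.diagonal_subset_face hk1 hw, hwv⟩,
                ← hw2 ⟨hp.diagonal_subset_face hk2 hw, hwv⟩]
            · rw [← hgi.self_of_nhds ⟨hi, hz.2⟩, ← hg0.self_of_nhds ⟨hi₀, hz.2⟩]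
          rw [← e1]
          exact hgi
      · filter_upwards [(hp.face i).isClosed_region.isOpen_compl.mem_nhds hi] with q hq hq'
        exact (hq hq'.1).elim
    refine eventually_nhdsWithin_iff.2 ?_
    filter_upwards [hall] with q hq hq'
    obtain ⟨i, hi⟩ := hcover q hq'.1
    exact hq i ⟨hi, hq'.2⟩
  · obtain ⟨i, z, hz, rfl⟩ := hT.surjective x
    exact ⟨(), z, hp.face_subset i hz, hF z i hz⟩
  · rintro - z hz - z' hz' e
    refine ⟨rfl, ?_⟩
    obtain ⟨i, hi⟩ := hcover z (interior_subset hz)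
    obtain ⟨j, hj⟩ := hcover z' hz'
    rcases (hp.face i).mem_region_cases hi with h | h | ⟨t, h⟩
    · rw [hF z i hi, hF z' j hj] at e
      exact (hT.interior_injective i z h j z' hj e).2
    · obtain ⟨l, rfl⟩ := (hp.mem_range_vert_iff hi).2 h
      exact (hint l hz).elim
    · rcases hp.openSide_face_cases i t with ⟨t', e'⟩ | ⟨k, hk, hk', e'⟩
      · rw [e'] at h
        exact (Set.disjoint_left.1 (P.disjoint_openSide_interior t') h hz).elim
      · rw [e'] at h
        -- The two triangle sides along a diagonal are already partners, so no third side has the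
        -- same image; a point with the same image is on this diagonal and injectivity on it
        -- concludes.
        obtain ⟨e1, e2, e3⟩ := edge_diagonal (hp := hp) hk hk' (hG k hk hk')
        have hk2 : k = k - 2 + 2 := by omega
        have hz2 : z ∈ (hp.face ⟨k - 2, by omega⟩).region :=
          hp.diagonal_subset_face (.inr hk2) h
        rw [hF z _ hz2, hF z' j hj] at e
        have hz1 := h
        rw [← e1] at hz1
        obtain ⟨t', ht'⟩ := hT.exists_openSide hz1 hj e
        have he := hT.edge_eq_of_mem (h := ⟨⟨k - 2, by omega⟩, 2⟩) (h' := ⟨j, t'⟩)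
          (mem_image_of_mem _ hz1) ⟨z', ht', e.symm⟩
        have hz'd : z' ∈ openSegment ℝ (p 0) (p k) := by
          by_cases h1 : (⟨j, t'⟩ : Σ _ : Fin (n - 2), ZMod 3) = ⟨⟨k - 2, by omega⟩, 2⟩
          · obtain ⟨rfl, h2⟩ := Sigma.mk.inj h1
            rw [eq_of_heq h2, e1] at ht'
            exact ht'
          · have h2 := hT.eq_of_edge_eq he.symm e3 h1 (by
              intro h
              have := congrArg Fin.val (Sigma.mk.inj h).1
              simp only at this
              omega)
            obtain ⟨rfl, h3⟩ := Sigma.mk.inj h2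
            rw [eq_of_heq h3, e2] at ht'
            exact ht'
        refine hT.side_injective ⟨k - 2, by omega⟩ 2 hz1 (by rw [e1]; exact hz'd) (e.trans ?_)
        rw [← hF z' j hj]
        exact hF z' _ (hp.diagonal_subset_face (.inr hk2) hz'd)
  · rintro - t z hz w hw e
    obtain ⟨i, s, e', -⟩ := hFside t
    rw [← e'] at hz hw
    rw [hF z i ((hp.face i).openSide_subset_region s hz),
      hF w i ((hp.face i).openSide_subset_region s hw)] at e
    exact hT.side_injective i s hz hw e
  · rintro - t - t'
    obtain ⟨i, s, -, e⟩ := hFside t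
    obtain ⟨i', s', -, e'⟩ := hFside t'
    rw [e, e']
    exact hT.side_match i s i' s'
  · intro x hx
    obtain ⟨i, hi⟩ := mem_iUnion.1 (hT.bdry_subset hx)
    obtain ⟨t, z, hz, rfl⟩ := mem_iUnion.1 hi
    refine mem_iUnion.2 ⟨(), mem_iUnion.2 ?_⟩
    have hzi := (hp.face i).side_subset_region t hz
    by_cases hv : z ∈ range P.vert
    · obtain ⟨l, rfl⟩ := hv
      exact ⟨l, P.vert l, left_mem_segment ℝ _ _, hF _ i hzi⟩
    · have hz' : z ∈ (hp.face i).openSide t := by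
        rw [PlanarPolygon.side_eq] at hz
        rcases hz with rfl | rfl | hz
        · exact (hv ((hp.mem_range_vert_iff hzi).2 ⟨_, rfl⟩)).elim
        · exact (hv ((hp.mem_range_vert_iff hzi).2 ⟨_, rfl⟩)).elim
        · exact hz
      rcases hp.openSide_face_cases i t with ⟨t', e'⟩ | ⟨k, hk, hk', e'⟩
      · rw [e'] at hz'
        exact ⟨t', z, P.openSide_subset_side t' hz', hF z i hzi⟩
      · exfalso
        rw [e'] at hz'
        obtain ⟨e1, e2, e3⟩ := edge_diagonal (hp := hp) hk hk' (hG k hk hk')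
        have hk2 : k = k - 2 + 2 := by omega
        have hzG : G ⟨k - 2, by omega⟩ z = G i z :=
          hGd k hk hk' z hz' _ _ (.inr hk2) (hdiag k hk hk' z hz' i hzi)
        have hz1 := hz'
        rw [← e1] at hz1
        refine hT.notMem_other_side (j := ⟨k - 2, by omega⟩) (i := 2) (j' := ⟨k - 1, by omega⟩)
          (i' := 0) ?_ hz1 (by rwa [hzG]) ?_
        · intro h
          have := congrArg Fin.val (Sigma.mk.inj h).1
          simp only at this
          omega
        · change _ ∈ edge (n := fun _ => 3) (fun i => hp.face i) G ⟨⟨k - 1, by omega⟩, 0⟩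
          rw [e3]
          exact mem_image_of_mem _ hz1

end Merge

end IsDecomposition

end DilationStructure

/-! ### The fan of a convex pentagon -/

namespace IsConvexCycle

variable {v : ZMod 5 → ℂ} (h3 : 3 ≤ 5) (hv : IsConvexCycle v)

include hv

theorem orient_pos_of_eq (i : ZMod 5) {a b c : ZMod 5} (ha : a = i) (hb : b = i + 1)
    (hc : c ≠ i) (hc' : c ≠ i + 1) : 0 < orient (v a) (v b) (v c) := by
  subst ha hb
  exact hv _ _ hc hc'

theorem isFan_pentagon : (hv.polygon h3).IsFan fun l : ℕ => v l := by
  refine (hv.polygon h3).isFan_of_orient le_rfl 0 1 (.inl rfl) (fun l => by simp) ?_ fun _ => .inl ?_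
  · intro i hi
    have hi' : i = 0 ∨ i = 1 ∨ i = 2 := by omega
    rw [← orient_rotate]
    rcases hi' with rfl | rfl | rfl
    · exact hv.orient_pos_of_eq 1 (by decide) (by decide) (by decide) (by decide)
    · exact hv.orient_pos_of_eq 2 (by decide) (by decide) (by decide) (by decide)
    · exact hv.orient_pos_of_eq 3 (by decide) (by decide) (by decide) (by decide)
  · exact (hv.orient_pos_of_eq 0 (by decide) (by decide) (by decide) (by decide)).le

/-- The line through `p 0` and `p (i + 2)` has triangle `i` on its right and, by convexity, triangle
`j` on its left. A common point is on this line, hence on the last side of triangle `i`, which is a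
diagonal. -/
theorem fan_inter {i j : Fin (5 - 2)} (hij : i < j) {z : ℂ}
    (hi : z ∈ ((hv.isFan_pentagon h3).face i).region)
    (hj : z ∈ ((hv.isFan_pentagon h3).face j).region) :
    z ∈ range v ∨ ∃ k : ℕ, 2 ≤ k ∧ k < 5 - 1 ∧ z ∈ openSegment ℝ (v (0 : ℕ)) (v k) := by
  set p : ℕ → ℂ := fun l => v l with hp
  have hposj := (hv.isFan_pentagon h3).pos j j.2
  obtain ⟨-, -, h0⟩ := (PlanarPolygon.mem_triangle _).1 hi
  obtain ⟨h1, -, h2⟩ := (PlanarPolygon.mem_triangle _).1 hj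
  have hw : 0 ≤ orient (p 0) (p (i + 2)) (p (j + 1)) ∧
      0 ≤ orient (p 0) (p (i + 2)) (p (j + 2)) := by
    have hcase : (i = 0 ∧ j = 1) ∨ (i = 0 ∧ j = 2) ∨ (i = 1 ∧ j = 2) := by
      clear * - hij; revert i j; decide
    rcases hcase with ⟨rfl, rfl⟩ | ⟨rfl, rfl⟩ | ⟨rfl, rfl⟩
    · refine ⟨(orient_self_right _ _).ge, ?_⟩
      rw [← orient_rotate]
      exact (hv.orient_pos_of_eq 2 (by decide) (by decide) (by decide) (by decide)).le
    · constructor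
      · rw [← orient_rotate]
        exact (hv.orient_pos_of_eq 2 (by decide) (by decide) (by decide) (by decide)).le
      · rw [← orient_rotate, ← orient_rotate]
        exact (hv.orient_pos_of_eq 4 (by decide) (by decide) (by decide) (by decide)).le
    · refine ⟨(orient_self_right _ _).ge, ?_⟩
      rw [← orient_rotate]
      exact (hv.orient_pos_of_eq 3 (by decide) (by decide) (by decide) (by decide)).le
  have e := PlanarPolygon.map_sub_triangle (a := p 0) (b := p (j + 1)) (c := p (j + 2))
    (crossForm (p (i + 2) - p 0)) z
  rw [← orient_eq_crossForm, ← orient_eq_crossForm, ← orient_eq_crossForm] at e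
  have h4 : orient (p (i + 2)) (p 0) z = 0 := by
    refine le_antisymm ?_ h0
    rw [orient_swap, neg_nonpos]
    refine nonneg_of_mul_nonneg_right ?_ hposj
    rw [e]
    exact add_nonneg (mul_nonneg h2 hw.1) (mul_nonneg h1 hw.2)
  rcases ((hv.isFan_pentagon h3).face i).mem_region_cases hi with h | h | ⟨t, h⟩
  · have := ((PlanarPolygon.mem_interior_triangle _).1 h).2.2
    exact (this.ne' h4).elim
  · exact .inl (((hv.isFan_pentagon h3).mem_range_vert_iff hi).2 h)
  · right
    have hposi := (hv.isFan_pentagon h3).pos i i.2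
    by_cases ht : t = 2
    · subst ht
      refine ⟨i + 2, by omega, by omega, ?_⟩
      rw [openSegment_symm]
      exact h
    · have := (isConvexCycle_triangleVert hposi).orient_pos_of_openSegment le_rfl (i := t) (j := 2)
        (Ne.symm ht) h
      exact (this.ne' h4).elim

end IsConvexCycle

/-! ### From a single pentagonal face to a pentagon gluing -/

namespace DilationStructure

variable {X : Type*} [TopologicalSpace X] {D : DilationStructure X}

/-- A decomposition with a single convex pentagon is a gluing of that pentagon along two pairs of
sides. -/
theorem IsDecomposition.isPentagonGluing {v : ZMod 5 → ℂ} {h3 : 3 ≤ 5} {hv : IsConvexCycle v}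
    {F : ℂ → X} {s : X} (hT : D.IsDecomposition (ι := Unit) (n := fun _ => 5)
      (fun _ => hv.polygon h3) fun _ => F) (hD : D.IsTorusWithBoundarySingularity s) :
    D.IsPentagonGluing (hv.polygon h3) := by
  have hs := hD.sing_eq
  obtain ⟨⟨⟨⟩, m⟩, p, hb, hpp, hfix, hedge, huniq⟩ := hT.exists_partner hD
  obtain ⟨q, hq⟩ : ∃ q : ZMod 5 → ZMod 5, ∀ i, p ⟨(), i⟩ = ⟨(), q i⟩ :=
    ⟨fun i => (p ⟨(), i⟩).2, fun i => rfl⟩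
  have hqq : ∀ i, q (q i) = i := by
    intro i
    have := hpp ⟨(), i⟩
    rw [hq, hq] at this
    exact eq_of_heq (Sigma.mk.inj this).2
  have hqm : ∀ i, q i = i → i = m := by
    intro i hi
    have := (hfix ⟨(), i⟩).1 (by rw [hq, hi])
    exact eq_of_heq (Sigma.mk.inj this).2
  have hqs : ∀ i, q i ≠ i + 1 := by
    intro i hi
    have := hedge ⟨(), i⟩
    rw [hq, hi] at this
    exact hT.edge_ne_succ hs () i this.symm
  have hqs' : ∀ i, q (i + 1) ≠ i := fun i hi => hqs i (by rw [← hi, hqq, hi])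
  have hm : q m = m := by
    have := (hfix ⟨(), m⟩).2 rfl
    rw [hq] at this
    exact eq_of_heq (Sigma.mk.inj this).2
  have h11 : ∀ m : ZMod 5, m + 1 + 1 = m + 2 := by decide
  have h21 : ∀ m : ZMod 5, m + 2 + 1 = m + 3 := by decide
  have h31 : ∀ m : ZMod 5, m + 3 + 1 = m + 4 := by decide
  have h41 : ∀ m : ZMod 5, m + 4 + 1 = m := by decide
  -- The partner of side `m + 2` is not an adjacent side, nor the boundary side, nor itself: only `m
  -- + 4` is left. Then `m + 1` is paired with `m + 3`.
  have hq2 : q (m + 2) = m + 4 := by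
    have a1 : q (m + 2) ≠ m := fun h => by
      have := hqq (m + 2)
      rw [h, hm] at this
      revert this; clear * -; revert m; decide
    have a2 : q (m + 2) ≠ m + 2 := fun h => by
      have := hqm _ h
      revert this; clear * -; revert m; decide
    have a3 : q (m + 2) ≠ m + 3 := h21 m ▸ hqs (m + 2)
    have a4 : q (m + 2) ≠ m + 1 := h11 m ▸ hqs' (m + 1)
    generalize q (m + 2) = x at *
    clear * - a1 a2 a3 a4
    revert m x
    decide
  have hq1 : q (m + 1) = m + 3 := by
    have a1 : q (m + 1) ≠ m := hqs' m
    have a2 : q (m + 1) ≠ m + 1 := fun h => by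
      have := hqm _ h
      revert this; clear * -; revert m; decide
    have a3 : q (m + 1) ≠ m + 2 := h11 m ▸ hqs (m + 1)
    have a4 : q (m + 1) ≠ m + 4 := fun h => by
      have := hqq (m + 1)
      rw [h, ← hq2, hqq] at this
      revert this; clear * -; revert m; decide
    generalize q (m + 1) = x at *
    clear * - a1 a2 a3 a4
    revert m x
    decide
  have hne13 : (⟨(), m + 1⟩ : Σ _ : Unit, ZMod 5) ≠ ⟨(), m + 3⟩ := fun h => by
    have := eq_of_heq (Sigma.mk.inj h).2
    revert this; clear * -; revert m; decide
  have hne24 : (⟨(), m + 2⟩ : Σ _ : Unit, ZMod 5) ≠ ⟨(), m + 4⟩ := fun h => by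
    have := eq_of_heq (Sigma.mk.inj h).2
    revert this; clear * -; revert m; decide
  obtain ⟨g, hg, hg1, hg2, hgF⟩ := hT.exists_convex_gluing hs hne13
    (by rw [← hedge ⟨(), m + 1⟩, hq, hq1])
  obtain ⟨h, hh, hh1, hh2, hhF⟩ := hT.exists_convex_gluing hs hne24
    (by rw [← hedge ⟨(), m + 2⟩, hq, hq2])
  simp only [h11, h21, h31, h41] at hg1 hg2 hgF hh1 hh2 hhF
  have hgs : g '' (hv.polygon h3).side (m + 1) = (hv.polygon h3).side (m + 3) := by
    refine (hg.image_segment _ _).trans ?_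
    simp only [IsConvexCycle.polygon_vert, h11, hg1, hg2, PlanarPolygon.side, h31]
    exact segment_symm _ _ _
  have hhs : h '' (hv.polygon h3).side (m + 2) = (hv.polygon h3).side (m + 4) := by
    refine (hh.image_segment _ _).trans ?_
    simp only [IsConvexCycle.polygon_vert, h21, hh1, hh2, PlanarPolygon.side, h41]
    exact segment_symm _ _ _
  have hgo : ∀ z ∈ (hv.polygon h3).openSide (m + 1), g z ∈ (hv.polygon h3).openSide (m + 3) := by
    intro z hz
    have := mem_image_of_mem g hz
    rw [PlanarPolygon.openSide, hg.image_openSegment] at this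
    simp only [IsConvexCycle.polygon_vert, h11, hg1, hg2] at this
    rw [openSegment_symm] at this
    simpa only [PlanarPolygon.openSide, IsConvexCycle.polygon_vert, h31] using this
  have hho : ∀ z ∈ (hv.polygon h3).openSide (m + 2), h z ∈ (hv.polygon h3).openSide (m + 4) := by
    intro z hz
    have := mem_image_of_mem h hz
    rw [PlanarPolygon.openSide, hh.image_openSegment] at this
    simp only [IsConvexCycle.polygon_vert, h21, hh1, hh2] at this
    rw [openSegment_symm] at this
    simpa only [PlanarPolygon.openSide, IsConvexCycle.polygon_vert, h41] using this
  have hgF' : ∀ z ∈ (hv.polygon h3).side (m + 1), F (g z) = F z := fun z hz => hgF z (by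
    simpa only [PlanarPolygon.side, IsConvexCycle.polygon_vert, h11] using hz)
  have hhF' : ∀ z ∈ (hv.polygon h3).side (m + 2), F (h z) = F z := fun z hz => hhF z (by
    simpa only [PlanarPolygon.side, IsConvexCycle.polygon_vert, h21] using hz)
  set R := Relation.EqvGen ((hv.polygon h3).GlueRel (m + 1) (m + 2) g h) with hR
  have hRg : ∀ z ∈ (hv.polygon h3).side (m + 1), R z (g z) := fun z hz => .rel _ _ (.inl ⟨hz, rfl⟩)
  have hRh : ∀ z ∈ (hv.polygon h3).side (m + 2), R z (h z) := fun z hz => .rel _ _ (.inr ⟨hz, rfl⟩)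
  have hvl : ∀ i, v i ∈ (hv.polygon h3).side i := fun i => left_mem_segment ℝ _ _
  have hvr : ∀ i, v (i + 1) ∈ (hv.polygon h3).side i := fun i => right_mem_segment ℝ _ _
  -- The four endpoint identifications connect all five vertices, so the gluing relation already
  -- identifies every two points over the singularity.
  have r14 : R (v (m + 1)) (v (m + 4)) := hg1 ▸ hRg _ (hvl _)
  have r23 : R (v (m + 2)) (v (m + 3)) := hg2 ▸ hRg _ (h11 m ▸ hvr (m + 1))
  have r20 : R (v (m + 2)) (v m) := hh1 ▸ hRh _ (hvl _)
  have r34 : R (v (m + 3)) (v (m + 4)) := hh2 ▸ hRh _ (h21 m ▸ hvr (m + 2))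
  have hall : ∀ i, R (v i) (v m) := by
    intro i
    have hi : i = m ∨ i = m + 1 ∨ i = m + 2 ∨ i = m + 3 ∨ i = m + 4 := by
      clear * -; revert m i; decide
    have r30 : R (v (m + 3)) (v m) := (r23.symm).trans _ _ _ r20
    have r40 : R (v (m + 4)) (v m) := (r34.symm).trans _ _ _ r30
    rcases hi with rfl | rfl | rfl | rfl | rfl
    exacts [.refl _, r14.trans _ _ _ r40, r20, r30, r40]
  have hRF : ∀ z w, R z w → F z = F w := by
    intro z w e
    induction e with
    | rel a b hab =>
      rcases hab with ⟨ha, rfl⟩ | ⟨ha, rfl⟩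
      · exact (hgF' a ha).symm
      · exact (hhF' a ha).symm
    | refl a => rfl
    | symm a b _ ih => exact ih.symm
    | trans a b c _ _ ih1 ih2 => exact ih1.trans ih2
  refine ⟨m + 1, m + 3, m + 2, m + 4, m, ?_, g, h, hg, hgs, hh, hhs, F, hT.isPolygonMap (), ?_, ?_,
    hb⟩
  · clear * -; revert m; decide
  · refine eq_univ_of_forall fun x => ?_
    obtain ⟨-, z, hz, e⟩ := hT.surjective x
    exact ⟨z, hz, e⟩
  · intro z hz w hw
    constructor
    · intro e
      rcases (hv.polygon h3).mem_region_cases hz with h' | ⟨i, rfl⟩ | ⟨i, h'⟩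
      · rw [(hT.interior_injective () z h' () w hw e).2]
        exact .refl _
      · have h1 : F w ∈ D.sing := by
          rw [← e]
          exact ((hT.isPolygonMap ()).sing_iff _ hz).2 ⟨i, rfl⟩
        obtain ⟨i', rfl⟩ := ((hT.isPolygonMap ()).sing_iff _ hw).1 h1
        exact (hall i).trans _ _ _ (hall i').symm
      · obtain ⟨i', hi'⟩ := hT.exists_openSide (j := ()) (j' := ()) h' hw e
        have he := hT.edge_eq_of_mem (h := ⟨(), i⟩) (h' := ⟨(), i'⟩) (mem_image_of_mem _ h')
          ⟨w, hi', e.symm⟩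
        have hcase : i' = i ∨ i' = q i := by
          rcases huniq _ _ he.symm with h1 | h1
          · exact .inl (eq_of_heq (Sigma.mk.inj h1).2)
          · rw [hq] at h1
            exact .inr (eq_of_heq (Sigma.mk.inj h1).2)
        have hinj : ∀ i, ∀ z ∈ (hv.polygon h3).openSide i, ∀ w ∈ (hv.polygon h3).openSide i,
            F z = F w → z = w := fun i z hz w hw e => hT.side_injective () i hz hw e
        have hss := fun i => (hv.polygon h3).openSide_subset_side i
        rcases hcase with rfl | rfl
        · rw [hinj i' z h' w hi' e]
          exact .refl _
        · have hi : i = m ∨ i = m + 1 ∨ i = m + 2 ∨ i = m + 3 ∨ i = m + 4 := by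
            clear * -; revert m i; decide
          rcases hi with rfl | rfl | rfl | rfl | rfl
          · rw [hm] at hi'
            rw [hinj _ z h' w hi' e]
            exact .refl _
          · rw [hq1] at hi'
            rw [hinj _ w hi' _ (hgo z h') (by rw [hgF' z (hss _ h'), e])]
            exact hRg _ (hss _ h')
          · rw [hq2] at hi'
            rw [hinj _ w hi' _ (hho z h') (by rw [hhF' z (hss _ h'), e])]
            exact hRh _ (hss _ h')
          · rw [← hq1, hqq] at hi'
            rw [hinj _ z h' _ (hgo w hi') (by rw [hgF' w (hss _ hi'), e])]
            exact (hRg _ (hss _ hi')).symm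
          · rw [← hq2, hqq] at hi'
            rw [hinj _ z h' _ (hho w hi') (by rw [hhF' w (hss _ hi'), e])]
            exact (hRh _ (hss _ hi')).symm
    · exact hRF z w

end DilationStructure

/-! ### Two families of convex pentagons in affine coordinates -/

theorem orient_add_combo (A C D : ℂ) (a b c d e f : ℝ) :
    orient (A + (a • C + b • D)) (A + (c • C + d • D)) (A + (e • C + f • D)) =
      ((c - a) * (f - b) - (d - b) * (e - a)) * crossForm C D := by
  simp only [orient, crossForm_apply, Complex.sub_re, Complex.sub_im, Complex.add_re,
    Complex.add_im, Complex.smul_re, Complex.smul_im, smul_eq_mul]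
  ring

/-- The vertices of a pentagon with the given affine coordinates. -/
noncomputable def affineCycle (A C D : ℂ) (a b : ZMod 5 → ℝ) (i : ZMod 5) : ℂ := A + (a i • C + b i • D)

theorem isConvexCycle_affineCycle {A C D : ℂ} (h : 0 < crossForm C D) {a b : ZMod 5 → ℝ}
    (hab : ∀ i k, k ≠ i → k ≠ i + 1 →
      0 < (a (i + 1) - a i) * (b k - b i) - (b (i + 1) - b i) * (a k - a i)) :
    IsConvexCycle (affineCycle A C D a b) := by
  intro i k hk hk'
  unfold affineCycle
  rw [orient_add_combo]
  exact mul_pos (hab i k hk hk') h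

/-- The coordinates of the first type of pentagon. -/
def pentagonCoord (u ρ : ℝ) : (ZMod 5 → ℝ) × (ZMod 5 → ℝ) :=
  (![0, -(u * ρ), -1, 0, ρ], ![0, -u, -1, -1, 0])

/-- The coordinates of the second type of pentagon. -/
def pentagonCoord' (μ ν : ℝ) : (ZMod 5 → ℝ) × (ZMod 5 → ℝ) :=
  (![0, 0, -1, -1, -ν], ![0, 1, 0, -μ, -ν])

theorem forall_zmod_five {Q : ZMod 5 → ZMod 5 → ZMod 5 → Prop}
    (h0 : Q 0 1 2 ∧ Q 0 1 3 ∧ Q 0 1 4) (h1 : Q 1 2 0 ∧ Q 1 2 3 ∧ Q 1 2 4)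
    (h2 : Q 2 3 0 ∧ Q 2 3 1 ∧ Q 2 3 4) (h3 : Q 3 4 0 ∧ Q 3 4 1 ∧ Q 3 4 2)
    (h4 : Q 4 0 1 ∧ Q 4 0 2 ∧ Q 4 0 3) : ∀ i k, k ≠ i → k ≠ i + 1 → Q i (i + 1) k := by
  intro i k hk hk'
  have hcase : ∀ i k : ZMod 5, k ≠ i → k ≠ i + 1 → k = i + 2 ∨ k = i + 3 ∨ k = i + 4 := by decide
  have hi : ∀ i : ZMod 5, i = 0 ∨ i = 1 ∨ i = 2 ∨ i = 3 ∨ i = 4 := by decide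
  rcases hi i with rfl | rfl | rfl | rfl | rfl <;> rcases hcase _ k hk hk' with rfl | rfl | rfl
  exacts [h0.1, h0.2.1, h0.2.2, h1.2.1, h1.2.2, h1.1, h2.2.2, h2.1, h2.2.1, h3.1, h3.2.1, h3.2.2,
    h4.1, h4.2.1, h4.2.2]

/-- Vertices 0, 2, 3 will be the middle triangle, vertex 4 the apex of the triangle attached with
ratio `ρ`, and vertex 1 that of the triangle with the boundary side. Beyond positivity, the corner
at vertex 1 requires `1 < ρ` and the corner at vertex 2 requires `u < 1`. -/
theorem isConvexCycle_pentagonCoord {A C D : ℂ} (h : 0 < crossForm C D) {u ρ : ℝ} (hu : 0 < u)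
    (hu1 : u < 1) (hρ : 1 < ρ) :
    IsConvexCycle (affineCycle A C D (pentagonCoord u ρ).1 (pentagonCoord u ρ).2) := by
  refine isConvexCycle_affineCycle h ?_
  have a0 : (pentagonCoord u ρ).1 0 = 0 := rfl
  have a1 : (pentagonCoord u ρ).1 1 = -(u * ρ) := rfl
  have a2 : (pentagonCoord u ρ).1 2 = -1 := rfl
  have a3 : (pentagonCoord u ρ).1 3 = 0 := rfl
  have a4 : (pentagonCoord u ρ).1 4 = ρ := rfl
  have b0 : (pentagonCoord u ρ).2 0 = 0 := rfl
  have b1 : (pentagonCoord u ρ).2 1 = -u := rfl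
  have b2 : (pentagonCoord u ρ).2 2 = -1 := rfl
  have b3 : (pentagonCoord u ρ).2 3 = -1 := rfl
  have b4 : (pentagonCoord u ρ).2 4 = 0 := rfl
  -- All the required determinants are linear in `u`, `ρ` and `u * ρ`; these three products supply
  -- the nonlinear information.
  have k1 : 0 < u * (ρ - 1) := mul_pos hu (by linarith)
  have k2 : 0 < u * ρ := mul_pos hu (by linarith)
  have k3 : 0 < (1 - u) * ρ := mul_pos (by linarith) (by linarith)
  refine forall_zmod_five (Q := fun i j k => 0 < ((pentagonCoord u ρ).1 j - (pentagonCoord u ρ).1 i)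
    * ((pentagonCoord u ρ).2 k - (pentagonCoord u ρ).2 i) -
    ((pentagonCoord u ρ).2 j - (pentagonCoord u ρ).2 i) *
    ((pentagonCoord u ρ).1 k - (pentagonCoord u ρ).1 i)) ?_ ?_ ?_ ?_ ?_ <;>
    refine ⟨?_, ?_, ?_⟩ <;> simp only [a0, a1, a2, a3, a4, b0, b1, b2, b3, b4] <;> linarith

/-- Again vertices 0, 2, 3 will be the middle triangle, but the triangle with the boundary side has
vertices 0, 3, 4, and its apex 4 is on the line from `A` in the direction `C + D`. -/
theorem isConvexCycle_pentagonCoord' {A C D : ℂ} (h : 0 < crossForm C D) {μ ν : ℝ} (hμ : 0 < μ)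
    (hμ1 : μ < 1) (hν : 0 < ν) (hν1 : ν < 1) :
    IsConvexCycle (affineCycle A C D (pentagonCoord' μ ν).1 (pentagonCoord' μ ν).2) := by
  refine isConvexCycle_affineCycle h ?_
  have a0 : (pentagonCoord' μ ν).1 0 = 0 := rfl
  have a1 : (pentagonCoord' μ ν).1 1 = 0 := rfl
  have a2 : (pentagonCoord' μ ν).1 2 = -1 := rfl
  have a3 : (pentagonCoord' μ ν).1 3 = -1 := rfl
  have a4 : (pentagonCoord' μ ν).1 4 = -ν := rfl
  have b0 : (pentagonCoord' μ ν).2 0 = 0 := rfl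
  have b1 : (pentagonCoord' μ ν).2 1 = 1 := rfl
  have b2 : (pentagonCoord' μ ν).2 2 = 0 := rfl
  have b3 : (pentagonCoord' μ ν).2 3 = -μ := rfl
  have b4 : (pentagonCoord' μ ν).2 4 = -ν := rfl
  have k1 : 0 < ν * (1 - μ) := mul_pos hν (by linarith)
  have k2 : 0 < μ * (1 - ν) := mul_pos hμ (by linarith)
  refine forall_zmod_five (Q := fun i j k =>
    0 < ((pentagonCoord' μ ν).1 j - (pentagonCoord' μ ν).1 i)
    * ((pentagonCoord' μ ν).2 k - (pentagonCoord' μ ν).2 i) -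
    ((pentagonCoord' μ ν).2 j - (pentagonCoord' μ ν).2 i) *
    ((pentagonCoord' μ ν).1 k - (pentagonCoord' μ ν).1 i)) ?_ ?_ ?_ ?_ ?_ <;>
    refine ⟨?_, ?_, ?_⟩ <;> simp only [a0, a1, a2, a3, a4, b0, b1, b2, b3, b4] <;> linarith

namespace DilationStructure

variable {X : Type*} [TopologicalSpace X] {D : DilationStructure X}

/-- Three triangles that are glued around a vertex into a convex pentagon `q`, the middle one being
in place, and the two others being placed by the gluing dilations `g₀` and `g₂`. -/
theorem IsDecomposition.exists_pentagon {ι : Type} {V : ι → ZMod 3 → ℂ}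
    {hV : ∀ j, IsConvexCycle (V j)} {map : ι → ℂ → X}
    (hT : D.IsDecomposition (n := fun _ => 3) (fun j => (hV j).polygon le_rfl) map) {s : X}
    (hs : D.sing = {s}) (e : Fin 3 ≃ ι) (r : Fin 3 → ZMod 3) {g₀ g₂ : ℂ → ℂ} (hg₀ : IsDilation g₀)
    (hg₂ : IsDilation g₂) (h₀ : g₀ (V (e 0) (r 0)) = V (e 1) (r 1))
    (h₀' : g₀ (V (e 0) (r 0 + 2)) = V (e 1) (r 1 + 1))
    (m₀ : ∀ z ∈ segment ℝ (V (e 0) (r 0 + 2)) (V (e 0) (r 0)), map (e 1) (g₀ z) = map (e 0) z)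
    (h₂ : g₂ (V (e 2) (r 2)) = V (e 1) (r 1)) (h₂' : g₂ (V (e 2) (r 2 + 1)) = V (e 1) (r 1 + 2))
    (m₂ : ∀ z ∈ segment ℝ (V (e 2) (r 2)) (V (e 2) (r 2 + 1)), map (e 1) (g₂ z) = map (e 2) z)
    {q : ZMod 5 → ℂ} (hq : IsConvexCycle q) (q0 : q 0 = V (e 1) (r 1))
    (q1 : q 1 = g₀ (V (e 0) (r 0 + 1))) (q2 : q 2 = V (e 1) (r 1 + 1))
    (q3 : q 3 = V (e 1) (r 1 + 2)) (q4 : q 4 = g₂ (V (e 2) (r 2 + 2))) :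
    ∃ F : ℂ → X, D.IsDecomposition (ι := Unit) (n := fun _ => 5)
      (fun _ => hq.polygon (by norm_num)) fun _ => F := by
  obtain ⟨f₀, hf₀, hfg₀, hgf₀⟩ := hg₀.exists_inverse
  obtain ⟨f₂, hf₂, hfg₂, hgf₂⟩ := hg₂.exists_inverse
  have hp := hq.isFan_pentagon (by norm_num)
  -- Repositioning needs the maps from the pentagon back to the original triangles, that is, the
  -- inverses of the placing dilations.
  let ψ : Fin (5 - 2) → ℂ → ℂ := ![f₀, id, f₂]
  have hψ : ∀ j, IsDilation (ψ j) := by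
    intro j
    fin_cases j
    exacts [hf₀, IsDilation.id, hf₂]
  have hz3 : ∀ i : ZMod 3, i = 0 ∨ i = 1 ∨ i = 2 := by decide
  have hT' := hT.reposition (ι' := Fin (5 - 2)) e le_rfl (V' := fun j : Fin (5 - 2) =>
      triangleVert (q (0 : ℕ)) (q ((j : ℕ) + 1 : ℕ)) (q ((j : ℕ) + 2 : ℕ)))
    (hV' := fun j => isConvexCycle_triangleVert (hp.pos j j.2)) (r := r) hψ (by
      intro j i
      rw [add_comm i]
      fin_cases j
      · rcases hz3 i with rfl | rfl | rfl
        · change f₀ (q 0) = _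
          rw [q0, ← h₀, hfg₀, add_zero]; rfl
        · change f₀ (q 1) = _
          rw [q1, hfg₀]; rfl
        · change f₀ (q 2) = _
          rw [q2, ← h₀', hfg₀]; rfl
      · rcases hz3 i with rfl | rfl | rfl
        · change q 0 = _
          rw [q0, add_zero]; rfl
        · exact q2
        · exact q3
      · rcases hz3 i with rfl | rfl | rfl
        · change f₂ (q 0) = _
          rw [q0, ← h₂, hfg₂, add_zero]; rfl
        · change f₂ (q 3) = _
          rw [q3, ← h₂', hfg₂]; rfl
        · change f₂ (q 4) = _
          rw [q4, hfg₂]; rfl)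
  refine IsDecomposition.merge (hp := hp) hT' hs (fun i j hij z hi hj => ?_) fun k hk hk' z hz => ?_
  · rcases lt_or_gt_of_ne hij with h | h
    · exact hq.fan_inter _ h hi hj
    · exact hq.fan_inter _ h hj hi
  · have hk2 : k = 2 ∨ k = 3 := by omega
    have hz' := openSegment_subset_segment ℝ _ _ hz
    rcases hk2 with rfl | rfl
    · change map (e 0) (f₀ z) = map (e 1) z
      have h1 := mem_image_of_mem f₀ hz'
      rw [hf₀.image_segment] at h1
      change f₀ z ∈ segment ℝ (f₀ (q 0)) (f₀ (q 2)) at h1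
      rw [q0, q2, ← h₀, ← h₀', hfg₀, hfg₀, segment_symm] at h1
      rw [← m₀ _ h1, hgf₀]
    · change map (e 1) z = map (e 2) (f₂ z)
      have h1 := mem_image_of_mem f₂ hz'
      rw [hf₂.image_segment] at h1
      change f₂ z ∈ segment ℝ (f₂ (q 0)) (f₂ (q 3)) at h1
      rw [q0, q3, ← h₂, ← h₂', hfg₂, hfg₂] at h1
      rw [← m₂ _ h1, hgf₂]

end DilationStructure

/-! ### Combinatorics of the three triangles -/

theorem ZMod.three_cases (i k : ZMod 3) : k = i ∨ k = i + 1 ∨ k = i + 2 := by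
  revert i k; decide

namespace DilationStructure

variable {X : Type*} [TopologicalSpace X] {D : DilationStructure X}

namespace IsDecomposition

variable {ι : Type} {V : ι → ZMod 3 → ℂ} {hV : ∀ j, IsConvexCycle (V j)} {map : ι → ℂ → X} {s : X}

/-- The vectors of the sides of a triangle that are glued to the next two sides of another triangle
appear in the same cyclic order. -/
theorem not_edge_eq_swap
    (hT : D.IsDecomposition (n := fun _ => 3) (fun j => (hV j).polygon le_rfl) map)
    (hs : D.sing = {s}) {j k : ι} (hjk : j ≠ k) {a b : ZMod 3}
    (h₁ : edge (n := fun _ => 3) (fun j => (hV j).polygon le_rfl) map ⟨j, a⟩ =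
      edge (n := fun _ => 3) (fun j => (hV j).polygon le_rfl) map ⟨k, b + 1⟩)
    (h₂ : edge (n := fun _ => 3) (fun j => (hV j).polygon le_rfl) map ⟨j, a + 1⟩ =
      edge (n := fun _ => 3) (fun j => (hV j).polygon le_rfl) map ⟨k, b⟩) : False := by
  have hne : ∀ x y : ZMod 3, (⟨j, x⟩ : Σ _ : ι, ZMod 3) ≠ ⟨k, y⟩ := fun x y h =>
    hjk (Sigma.mk.inj h).1
  obtain ⟨g, hg, e1, e2, -⟩ := hT.exists_convex_gluing hs (hne _ _) h₁
  obtain ⟨g', hg', e1', e2', -⟩ := hT.exists_convex_gluing hs (hne _ _) h₂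
  obtain ⟨c, hc, h⟩ := hg.exists_ratio
  obtain ⟨c', hc', h'⟩ := hg'.exists_ratio
  have f1 := h (V j (a + 1)) (V j a)
  have f2 := h' (V j (a + 1 + 1)) (V j (a + 1))
  rw [e1, e2] at f1
  rw [e1', e2'] at f2
  have hj := hV j a (a + 1 + 1) (by clear * -; revert a; decide) (by clear * -; revert a; decide)
  have hk := hV k b (b + 1 + 1) (by clear * -; revert b; decide) (by clear * -; revert b; decide)
  -- The gluings multiply the side vectors by `-c` and `-c'`, and the exchange of the two sides
  -- changes the sign of their determinant; both triangles are positively oriented.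
  have f3 : orient (V k b) (V k (b + 1)) (V k (b + 1 + 1)) =
      -(c * c') * orient (V j a) (V j (a + 1)) (V j (a + 1 + 1)) := by
    have g1 := congrArg Complex.re f1
    have g2 := congrArg Complex.im f1
    have g3 := congrArg Complex.re f2
    have g4 := congrArg Complex.im f2
    simp only [Complex.sub_re, Complex.sub_im, Complex.smul_re, Complex.smul_im,
      smul_eq_mul] at g1 g2 g3 g4
    simp only [orient, Complex.sub_re, Complex.sub_im]
    have g5 : (V k b).re = (V k (b + 1)).re + c' * ((V j (a + 1 + 1)).re - (V j (a + 1)).re) := by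
      linarith
    have g6 : (V k b).im = (V k (b + 1)).im + c' * ((V j (a + 1 + 1)).im - (V j (a + 1)).im) := by
      linarith
    have g7 : (V k (b + 1 + 1)).re = (V k (b + 1)).re - c * ((V j (a + 1)).re - (V j a).re) := by
      linarith
    have g8 : (V k (b + 1 + 1)).im = (V k (b + 1)).im - c * ((V j (a + 1)).im - (V j a).im) := by
      linarith
    rw [g5, g6, g7, g8]
    ring
  nlinarith [mul_pos (mul_pos hc hc') hj]

/-- The way in which the sides of the triangles of a triangulation are glued. -/
theorem exists_three_triangles [Fintype ι] (hcard : Fintype.card ι ≤ 3)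
    (hT : D.IsDecomposition (n := fun _ => 3) (fun j => (hV j).polygon le_rfl) map)
    (hD : D.IsTorusWithBoundarySingularity s) :
    ∃ (e : Fin 3 ≃ ι) (m α β : ZMod 3),
      edge (n := fun _ => 3) (fun j => (hV j).polygon le_rfl) map ⟨e 0, m + 1⟩ =
        edge (n := fun _ => 3) (fun j => (hV j).polygon le_rfl) map ⟨e 1, α⟩ ∧
      edge (n := fun _ => 3) (fun j => (hV j).polygon le_rfl) map ⟨e 0, m + 2⟩ =
        edge (n := fun _ => 3) (fun j => (hV j).polygon le_rfl) map ⟨e 2, β⟩ ∧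
      edge (n := fun _ => 3) (fun j => (hV j).polygon le_rfl) map ⟨e 1, α + 1⟩ =
        edge (n := fun _ => 3) (fun j => (hV j).polygon le_rfl) map ⟨e 2, β + 1⟩ ∧
      edge (n := fun _ => 3) (fun j => (hV j).polygon le_rfl) map ⟨e 1, α + 2⟩ =
        edge (n := fun _ => 3) (fun j => (hV j).polygon le_rfl) map ⟨e 2, β + 2⟩ := by
  classical
  have hs := hD.sing_eq
  obtain ⟨⟨j₁, m⟩, p, -, hpp, hfix, hedge, -⟩ := hT.exists_partner hD
  have hinj : ∀ {j : ι} {i k : ZMod 3}, (⟨j, i⟩ : Σ _ : ι, ZMod 3) = ⟨j, k⟩ → i = k := fun h =>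
    eq_of_heq (Sigma.mk.inj h).2
  have h10 : ∀ m : ZMod 3, m + 1 ≠ m := by decide
  have h20 : ∀ m : ZMod 3, m + 2 ≠ m := by decide
  have h21 : ∀ m : ZMod 3, m + 2 ≠ m + 1 := by decide
  have h2s : ∀ m : ZMod 3, m + 2 + 1 = m := by decide
  have hm : p ⟨j₁, m⟩ = ⟨j₁, m⟩ := (hfix _).2 rfl
  have hsucc : ∀ j i, p ⟨j, i⟩ ≠ ⟨j, i + 1⟩ := fun j i h => by
    have := hedge ⟨j, i⟩
    rw [h] at this
    exact hT.edge_ne_succ hs j i this.symm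
  -- Two distinct sides of a triangle are always adjacent, so a side partnered within its own
  -- triangle is its own partner, that is, the boundary.
  have hself : ∀ j i k, p ⟨j, i⟩ = ⟨j, k⟩ → (⟨j, i⟩ : Σ _ : ι, ZMod 3) = ⟨j₁, m⟩ := by
    intro j i k h
    rcases ZMod.three_cases i k with rfl | rfl | rfl
    · exact (hfix _).1 h
    · exact (hsucc j i h).elim
    · have h1 := hpp ⟨j, i⟩
      rw [h] at h1
      exact (hsucc j (i + 2) (by rw [h1, h2s])).elim
  have hfour : ∀ a b c d : ι, a ≠ b → a ≠ c → a ≠ d → b ≠ c → b ≠ d → c ≠ d → False := by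
    intro a b c d h1 h2 h3 h4 h5 h6
    have h7 := Finset.card_le_univ ({a, b, c, d} : Finset ι)
    rw [Finset.card_insert_of_notMem (by simp [h1, h2, h3]),
      Finset.card_insert_of_notMem (by simp [h4, h5]),
      Finset.card_insert_of_notMem (by simp [h6]), Finset.card_singleton] at h7
    omega
  obtain ⟨j₂, α, hα⟩ : ∃ j α, p ⟨j₁, m + 1⟩ = ⟨j, α⟩ := ⟨_, _, rfl⟩
  obtain ⟨j₃, β, hβ⟩ : ∃ j β, p ⟨j₁, m + 2⟩ = ⟨j, β⟩ := ⟨_, _, rfl⟩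
  have hα' : p ⟨j₂, α⟩ = ⟨j₁, m + 1⟩ := by rw [← hα, hpp]
  have hβ' : p ⟨j₃, β⟩ = ⟨j₁, m + 2⟩ := by rw [← hβ, hpp]
  have h12 : j₁ ≠ j₂ := fun h => by
    subst h
    exact h10 m (hinj (hself _ _ _ hα))
  have h13 : j₁ ≠ j₃ := fun h => by
    subst h
    exact h20 m (hinj (hself _ _ _ hβ))
  have hcase1 : ∀ x, p ⟨j₁, x⟩ = ⟨j₁, m⟩ ∨ p ⟨j₁, x⟩ = ⟨j₂, α⟩ ∨ p ⟨j₁, x⟩ = ⟨j₃, β⟩ := by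
    intro x
    rcases ZMod.three_cases m x with rfl | rfl | rfl
    exacts [.inl hm, .inr (.inl hα), .inr (.inr hβ)]
  have hback : ∀ j i x, p ⟨j, i⟩ = ⟨j₁, x⟩ → (⟨j, i⟩ : Σ _ : ι, ZMod 3) = ⟨j₁, m⟩ ∨
      (⟨j, i⟩ : Σ _ : ι, ZMod 3) = ⟨j₂, α⟩ ∨ (⟨j, i⟩ : Σ _ : ι, ZMod 3) = ⟨j₃, β⟩ := by
    intro j i x h
    have := hcase1 x
    rwa [← h, hpp] at this
  -- If both sides next to the boundary led to the same triangle, its third side would lead to a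
  -- third triangle, and another side of that one to a fourth, but there are at most three.
  have h23 : j₂ ≠ j₃ := by
    rintro rfl
    have hαβ : α ≠ β := fun h => by
      rw [h, hβ'] at hα'
      exact h21 m (hinj hα')
    obtain ⟨γ, hγα, hγβ, hγ⟩ : ∃ γ, γ ≠ α ∧ γ ≠ β ∧ ∀ x, x = α ∨ x = β ∨ x = γ := by
      clear * - hαβ
      revert α β; decide
    obtain ⟨j₄, δ, hδ⟩ : ∃ j δ, p ⟨j₂, γ⟩ = ⟨j, δ⟩ := ⟨_, _, rfl⟩
    have hδ' : p ⟨j₄, δ⟩ = ⟨j₂, γ⟩ := by rw [← hδ, hpp]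
    have h24 : j₂ ≠ j₄ := fun h => by
      subst h
      exact h12 (Sigma.mk.inj (hself _ _ _ hδ)).1.symm
    have h14 : j₁ ≠ j₄ := fun h => by
      subst h
      rcases hback _ _ _ hδ with h | h | h
      · exact h12 (Sigma.mk.inj h).1.symm
      · exact hγα (hinj h)
      · exact hγβ (hinj h)
    obtain ⟨j₅, ε, hε⟩ : ∃ j ε, p ⟨j₄, δ + 1⟩ = ⟨j, ε⟩ := ⟨_, _, rfl⟩
    have hε' : p ⟨j₅, ε⟩ = ⟨j₄, δ + 1⟩ := by rw [← hε, hpp]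
    refine hfour j₁ j₂ j₄ j₅ h12 h14 (fun h => ?_) h24 (fun h => ?_) (fun h => ?_)
    · subst h
      rcases hback _ _ _ hε with h | h | h
      · exact h14 (Sigma.mk.inj h).1.symm
      · exact h24 (Sigma.mk.inj h).1.symm
      · exact h24 (Sigma.mk.inj h).1.symm
    · subst h
      rcases hγ ε with rfl | rfl | rfl
      · rw [hα'] at hε'
        exact h14 (Sigma.mk.inj hε').1
      · rw [hβ'] at hε'
        exact h14 (Sigma.mk.inj hε').1
      · rw [hδ] at hε'
        exact h10 δ (hinj hε').symm
    · subst h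
      exact h14 (Sigma.mk.inj (hself _ _ _ hε)).1.symm
  have hto : ∀ x, x ≠ α → ∃ y, y ≠ β ∧ p ⟨j₂, x⟩ = ⟨j₃, y⟩ := by
    intro x hx
    obtain ⟨j, y, hy⟩ : ∃ j y, p ⟨j₂, x⟩ = ⟨j, y⟩ := ⟨_, _, rfl⟩
    have a1 : j₁ ≠ j := fun h => by
      subst h
      rcases hback _ _ _ hy with h | h | h
      · exact h12 (Sigma.mk.inj h).1.symm
      · exact hx (hinj h)
      · exact h23 (Sigma.mk.inj h).1
    have a2 : j₂ ≠ j := fun h => by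
      subst h
      exact h12 (Sigma.mk.inj (hself _ _ _ hy)).1.symm
    have a3 : j₃ = j := by
      by_contra h
      exact hfour j₁ j₂ j₃ j h12 h13 a1 h23 a2 h
    subst a3
    refine ⟨y, fun h => ?_, hy⟩
    rw [h] at hy
    have := hpp ⟨j₂, x⟩
    rw [hy, hβ'] at this
    exact h12 (Sigma.mk.inj this).1
  obtain ⟨y₁, hy₁, e₁⟩ := hto (α + 1) (h10 α)
  obtain ⟨y₂, hy₂, e₂⟩ := hto (α + 2) (h20 α)
  have hy12 : y₁ ≠ y₂ := fun h => by
    have := hpp ⟨j₂, α + 1⟩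
    rw [e₁, h, ← e₂, hpp] at this
    exact h21 α (hinj this)
  have hE : ∀ {h h' : Σ _ : ι, ZMod 3}, p h = h' →
      edge (n := fun _ => 3) (fun j => (hV j).polygon le_rfl) map h =
        edge (n := fun _ => 3) (fun j => (hV j).polygon le_rfl) map h' := fun h => by
    rw [← h, hedge]
  have hy : y₁ = β + 1 ∧ y₂ = β + 2 := by
    rcases ZMod.three_cases β y₁ with rfl | rfl | rfl
    · exact (hy₁ rfl).elim
    · rcases ZMod.three_cases β y₂ with rfl | rfl | rfl
      · exact (hy₂ rfl).elim
      · exact (hy12 rfl).elim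
      · exact ⟨rfl, rfl⟩
    · rcases ZMod.three_cases β y₂ with rfl | rfl | rfl
      · exact (hy₂ rfl).elim
      -- Only the two remaining sides of `j₃` are available; taking them in the opposite order is
      -- excluded by orientation.
      · exfalso
        refine hT.not_edge_eq_swap hs h23 (a := α + 1) (b := β + 1) ?_ ?_
        · rw [hE e₁]
          congr 2
          ring
        · rw [← hE e₂]
          congr 2
          ring
      · exact (hy12 rfl).elim
  let f : Fin 3 → ι := ![j₁, j₂, j₃]
  have hf : Function.Bijective f := by
    constructor
    · have h01 : f 0 ≠ f 1 := h12
      have h02 : f 0 ≠ f 2 := h13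
      have h12 : f 1 ≠ f 2 := h23
      intro a b hab
      fin_cases a <;> fin_cases b
      exacts [rfl, (h01 hab).elim, (h02 hab).elim, (h01 hab.symm).elim, rfl, (h12 hab).elim,
        (h02 hab.symm).elim, (h12 hab.symm).elim, rfl]
    · intro j
      by_cases h1 : j₁ = j
      · exact ⟨0, h1⟩
      by_cases h2 : j₂ = j
      · exact ⟨1, h2⟩
      by_cases h3 : j₃ = j
      · exact ⟨2, h3⟩
      exact (hfour j₁ j₂ j₃ j h12 h13 h1 h23 h2 h3).elim
  exact ⟨Equiv.ofBijective f hf, m, α, β, hE hα, hE hβ, hE (hy.1 ▸ e₁), hE (hy.2 ▸ e₂)⟩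

end IsDecomposition

end DilationStructure

/-! ### Gluing ratios and the choice of the convex pentagon -/

theorem ZMod.add_two_add_one (i : ZMod 3) : i + 2 + 1 = i := by revert i; decide

theorem ZMod.add_two_add_two (i : ZMod 3) : i + 2 + 2 = i + 1 := by revert i; decide

theorem ZMod.add_one_add_one (i : ZMod 3) : i + 1 + 1 = i + 2 := by revert i; decide

theorem ZMod.add_one_add_two (i : ZMod 3) : i + 1 + 2 = i := by revert i; decide

/-- The ratios by which three triangles are glued, in pairs of sides except for one, satisfy an
inequality. -/
theorem one_lt_mul_of_gluing {p₀ p₁ p₂ a₀ a₁ a₂ b₀ b₁ b₂ : ℂ} {x y κ d : ℝ} (hx : 0 < x)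
    (hy : 0 < y) (hd : 0 < d) (hA : a₀ - a₁ = x • (p₂ - p₁)) (hB : b₀ - b₁ = y • (p₀ - p₂))
    (hC : b₁ - b₂ = κ • (a₂ - a₁)) (hE : a₂ - a₀ = d • (b₀ - b₂))
    (hp : 0 < orient p₀ p₁ p₂) (ha : 0 < crossForm (a₂ - a₁) (a₀ - a₂)) : 1 < κ * d := by
  -- The same area is computed twice. Through the gluings with ratios `κ` and `d` it is `κ * d - 1`
  -- times the area of the triangle `a`; through those with ratios `x` and `y` it is a positive
  -- multiple of the area of the triangle `p`.
  have h1 : crossForm (a₀ - a₁) (d • (b₀ - b₁)) =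
      (κ * d - 1) * crossForm (a₂ - a₁) (a₀ - a₂) := by
    have e1 : a₀ - a₁ = (a₂ - a₁) + (a₀ - a₂) := by abel
    have e2 : d • (b₀ - b₁) = -((κ * d) • (a₂ - a₁) + (a₀ - a₂)) := by
      linear_combination (norm := module) (-d) • hC - hE
    rw [e1, e2]
    simp only [crossForm_apply, Complex.add_re, Complex.add_im, Complex.neg_re, Complex.neg_im,
      Complex.smul_re, Complex.smul_im, smul_eq_mul]
    ring
  have h2 : crossForm (a₀ - a₁) (d • (b₀ - b₁)) = x * (d * (y * orient p₀ p₁ p₂)) := by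
    rw [hA, hB]
    simp only [orient, crossForm_apply, Complex.sub_re, Complex.sub_im, Complex.smul_re,
      Complex.smul_im, smul_eq_mul]
    ring
  have h3 : 0 < (κ * d - 1) * crossForm (a₂ - a₁) (a₀ - a₂) := by
    rw [← h1, h2]
    positivity
  linarith [(pos_iff_pos_of_mul_pos h3).2 ha]

namespace DilationStructure

variable {X : Type*} [TopologicalSpace X] {D : DilationStructure X}

/-- A triangulated dilation torus with one boundary singularity is decomposed into a single convex
pentagon. -/
theorem IsDecomposition.exists_convex_pentagon {ι : Type} [Fintype ι] {V : ι → ZMod 3 → ℂ}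
    {hV : ∀ j, IsConvexCycle (V j)} {map : ι → ℂ → X} {s : X}
    (hT : D.IsDecomposition (n := fun _ => 3) (fun j => (hV j).polygon le_rfl) map)
    (hD : D.IsTorusWithBoundarySingularity s) (hcard : Fintype.card ι ≤ 3) :
    ∃ (q : ZMod 5 → ℂ) (hq : IsConvexCycle q) (F : ℂ → X), D.IsDecomposition (ι := Unit)
      (n := fun _ => 5) (fun _ => hq.polygon (by norm_num)) fun _ => F := by
  have hs := hD.sing_eq
  obtain ⟨e, m, α, β, E₁, E₂, E₃, E₄⟩ := exists_three_triangles hcard hT hD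
  have hne : ∀ {j k : Fin 3}, j ≠ k → ∀ x y, (⟨e j, x⟩ : Σ _ : ι, ZMod 3) ≠ ⟨e k, y⟩ :=
    fun hjk x y h => hjk (e.injective (Sigma.mk.inj h).1)
  obtain ⟨gA, hgA, A₁, A₂, mA⟩ := hT.exists_convex_gluing hs (hne (by decide) _ _) E₁
  obtain ⟨gB, hgB, B₁, B₂, mB⟩ := hT.exists_convex_gluing hs (hne (by decide) _ _) E₂
  obtain ⟨gC, hgC, C₁, C₂, mC⟩ := hT.exists_convex_gluing hs (hne (by decide) _ _) E₃
  obtain ⟨gE, hgE, D₁, D₂, mE⟩ := hT.exists_convex_gluing hs (hne (by decide) _ _) E₄.symm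
  simp only [ZMod.add_two_add_one, ZMod.add_one_add_one] at A₁ A₂ mA B₁ B₂ mB C₁ C₂ mC D₁ D₂ mE
  obtain ⟨x, hx, rA⟩ := hgA.exists_ratio
  obtain ⟨y, hy, rB⟩ := hgB.exists_ratio
  obtain ⟨κ, hκ, rC⟩ := hgC.exists_ratio
  obtain ⟨d, hd, rE⟩ := hgE.exists_ratio
  have fA := rA (V (e 0) (m + 2)) (V (e 0) (m + 1))
  have fA' := rA (V (e 0) m) (V (e 0) (m + 2))
  have fB := rB (V (e 0) m) (V (e 0) (m + 2))
  have fB' := rB (V (e 0) (m + 1)) (V (e 0) (m + 2))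
  have fC := rC (V (e 1) (α + 2)) (V (e 1) (α + 1))
  have fC' := rC (V (e 1) α) (V (e 1) (α + 2))
  have fE := rE (V (e 2) β) (V (e 2) (β + 2))
  have fE' := rE (V (e 2) (β + 1)) (V (e 2) (β + 2))
  rw [A₁, A₂] at fA
  rw [A₂] at fA'
  rw [B₁, B₂] at fB
  rw [B₁] at fB'
  rw [C₁, C₂] at fC
  rw [C₂] at fC'
  rw [D₁, D₂] at fE
  rw [D₁] at fE'
  have hp := hV (e 0) m (m + 2) (by clear * -; revert m; decide) (by clear * -; revert m; decide)
  have ha : 0 < crossForm (V (e 1) (α + 2) - V (e 1) (α + 1)) (V (e 1) α - V (e 1) (α + 2)) := by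
    have := hV (e 1) (α + 1) α (by clear * -; revert α; decide) (by clear * -; revert α; decide)
    rw [ZMod.add_one_add_one] at this
    convert this using 1
    simp only [orient, crossForm_apply, Complex.sub_re, Complex.sub_im]
    ring
  have hκd := one_lt_mul_of_gluing hx hy hd fA fB fC fE hp ha
  have hκ0 := hκ.ne'
  have hd0 := hd.ne'
  have hx0 := hx.ne'
  have hy0 := hy.ne'
  rcases lt_or_ge x (y * d) with hxy | hxy
  -- The triangle `e 1` is in the middle and everything is developed around its vertex `α`. The
  -- triangle `e 2` is placed by `gE`, which puts its apex at `ρ = κ * d` along `C`; the triangle `e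
  -- 0` is placed by `gA`, and `u` compares its scale `x` with the scale `y * d` it would have
  -- through `e 2`.
  · refine ⟨_, isConvexCycle_pentagonCoord (A := V (e 1) α) ha (u := x / (y * d)) (ρ := κ * d)
      (by positivity) ((div_lt_one (by positivity)).2 hxy) hκd, hT.exists_pentagon hs e
      ![m + 2, α, β + 2] hgA hgE A₂ ?_ ?_ D₁ ?_ ?_ _ ?_ ?_ ?_ ?_ ?_⟩
    · simpa [ZMod.add_two_add_two] using A₁
    · simpa [ZMod.add_two_add_two, segment_symm] using mA
    · simpa [ZMod.add_two_add_one] using D₂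
    · simpa [ZMod.add_two_add_one] using mE
    · simp [affineCycle, pentagonCoord]
    · change V (e 1) α + ((-(x / (y * d) * (κ * d))) • (V (e 1) (α + 2) - V (e 1) (α + 1)) +
        (-(x / (y * d))) • (V (e 1) α - V (e 1) (α + 2))) = gA (V (e 0) (m + 2 + 1))
      rw [ZMod.add_two_add_one]
      linear_combination (norm := skip) -fA' + (x / y) • fB + (x / y) • fC + (x / (y * d)) • fE
      match_scalars <;> field_simp <;> ring
    · change V (e 1) α + (((-1 : ℝ)) • (V (e 1) (α + 2) - V (e 1) (α + 1)) +
        ((-1 : ℝ)) • (V (e 1) α - V (e 1) (α + 2))) = V (e 1) (α + 1)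
      module
    · change V (e 1) α + (((0 : ℝ)) • (V (e 1) (α + 2) - V (e 1) (α + 1)) +
        ((-1 : ℝ)) • (V (e 1) α - V (e 1) (α + 2))) = V (e 1) (α + 2)
      module
    · change V (e 1) α + ((κ * d) • (V (e 1) (α + 2) - V (e 1) (α + 1)) +
        ((0 : ℝ)) • (V (e 1) α - V (e 1) (α + 2))) = gE (V (e 2) (β + 2 + 2))
      rw [ZMod.add_two_add_two]
      linear_combination (norm := module) -fE' - d • fC
  -- Now `e 2` is in the middle, with `e 1` placed by `gC` and `e 0` by `gB` around the vertex `β +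
  -- 1`... more precisely, `finRotate` moves the triangles one step along, so that `e 1`, `e 2`, `e
  -- 0` take the three places of the fan. The side vectors of `e 1` are scaled by `κ`, its size
  -- after gluing to `e 2`.
  · refine ⟨_, isConvexCycle_pentagonCoord' (A := V (e 2) (β + 1))
      (C := κ • (V (e 1) (α + 2) - V (e 1) (α + 1))) (D := κ • (V (e 1) α - V (e 1) (α + 2)))
      ?_ (μ := (κ * d)⁻¹) (ν := y / (x * κ)) (by positivity) (inv_lt_one_of_one_lt₀ hκd)
      (by positivity) ((div_lt_one (by positivity)).2 ?_),
      hT.exists_pentagon hs ((finRotate 3).trans e)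
      ![α + 2, β + 1, m + 2] hgC hgB C₂ ?_ ?_ B₁ ?_ ?_ _ ?_ ?_ ?_ ?_ ?_⟩
    · rw [crossForm_smul, LinearMap.smul_apply, map_smul, smul_eq_mul, smul_eq_mul]
      positivity
    -- From `y * d ≤ x` and `1 < κ * d` it follows that `y < y * (κ * d) ≤ x * κ`.
    · nlinarith [mul_lt_mul_of_pos_left hκd hy]
    · simpa [ZMod.add_two_add_two, ZMod.add_one_add_one] using C₁
    · simpa [ZMod.add_two_add_two, segment_symm] using mC
    · simpa [ZMod.add_two_add_one, ZMod.add_one_add_two] using B₂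
    · simpa [ZMod.add_two_add_one] using mB
    · simp [affineCycle, pentagonCoord']
    · change V (e 2) (β + 1) + (((0 : ℝ)) • κ • (V (e 1) (α + 2) - V (e 1) (α + 1)) +
        ((1 : ℝ)) • κ • (V (e 1) α - V (e 1) (α + 2))) = gC (V (e 1) (α + 2 + 1))
      rw [ZMod.add_two_add_one]
      linear_combination (norm := module) -fC'
    · change V (e 2) (β + 1) + (((-1 : ℝ)) • κ • (V (e 1) (α + 2) - V (e 1) (α + 1)) +
        ((0 : ℝ)) • κ • (V (e 1) α - V (e 1) (α + 2))) = V (e 2) (β + 1 + 1)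
      rw [ZMod.add_one_add_one]
      linear_combination (norm := module) fC
    · change V (e 2) (β + 1) + (((-1 : ℝ)) • κ • (V (e 1) (α + 2) - V (e 1) (α + 1)) +
        (-(κ * d)⁻¹) • κ • (V (e 1) α - V (e 1) (α + 2))) = V (e 2) (β + 1 + 2)
      rw [ZMod.add_one_add_two]
      linear_combination (norm := skip) fC + d⁻¹ • fE
      match_scalars <;> field_simp <;> ring
    · change V (e 2) (β + 1) + ((-(y / (x * κ))) • κ • (V (e 1) (α + 2) - V (e 1) (α + 1)) +
        (-(y / (x * κ))) • κ • (V (e 1) α - V (e 1) (α + 2))) = gB (V (e 0) (m + 2 + 2))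
      rw [ZMod.add_two_add_two]
      linear_combination (norm := skip) -fB' - (y / x) • fA
      match_scalars <;> field_simp <;> ring

end DilationStructure

theorem mainTheorem6 {X : Type*} [TopologicalSpace X] (D : DilationStructure X)
    (hD : D.InD111) :
    ∃ Q : PlanarPolygon 5, Q.IsConvex ∧ D.IsPentagonGluing Q := by
  obtain ⟨s, hs⟩ := hD.exists_isTorus
  obtain ⟨ι, _, V, hV, map, hcard, hT⟩ := hD.polygonable.exists_triangulation hs
  obtain ⟨q, hq, F, hF⟩ := hT.exists_convex_pentagon hs hcard
  exact ⟨hq.polygon (by norm_num), hq.polygon_isConvex _, hF.isPentagonGluing hs⟩
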